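/- A $d$-dimensional 1-VASS-MDP $S=\langle Q,Q_1,Q_P,T,\tau\rangle$ consists of a finite set $Q$ of control-states partitioned into $Q_1$ (Player 1) and $Q_P$ (Player P, probabilistic), a finite set $T\subseteq Q\times\mathbb Z^d\times Q$ of transitions such that $z=0$ for every $(q,z,q')\in T$ with $q\in Q_P$, and weights $\tau(t)\in\mathbb N$ that are positive on the transitions leaving $Q_P$. Its configurations are the pairs $\langle q,v\rangle\in C=Q\times\mathbb N^d$; a transition $t=(q,z,q')$ is enabled in $\langle q,v\rangle$ if $v+z\ge 0$, and then gives a step $\langle q,v\rangle\to\langle q',v+z\rangle$. In a configuration of $Q_1$ that is not a deadlock, a (history-dependent) strategy $\sigma$ of Player 1 chooses a successor; in a configuration of $Q_P$ that is not a deadlock, an enabled transition is drawn with probability proportional to its weight; a play that meets a deadlock ends there. Let $\mathbb P(M_S,c,\sigma,\cdot)$ be the resulting probability measure on the maximal plays from $c$, let $\Diamond q_F$ be the event that the control-state $q_F\in Q$ is visited, and let $$V^1_{AS}=\{c\in C\mid \exists\sigma.\ \mathbb P(M_S,c,\sigma,\Diamond q_F)=1\}.$$ Formulae of the positive $\mu$-calculus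 are built from control-states $q$ (true in $\langle q,v\rangle$ for all $v$) and variables by $\wedge,\vee,\Diamond,\Box,\mu X,\nu X$, interpreted as usual over $(C,\to)$, with $Q_i$ standing for $\bigvee_{q\in Q_i}q$. The fragment $L^{sv}_\mu$ consists of those formulae in which $\Box$ occurs only in the form $Q_P\wedge\Box\varphi$. Put $$\mathrm{InvPre}(X,Y)=(Q_1\wedge\Diamond(X\wedge Y))\vee(\Diamond Y\wedge Q_P\wedge\Box X).$$ **Theorem.** 1. The almost-sure reachability problem for 1-VASS-MDPs (given a 1-VASS-MDP $S$ of any dimension, a configuration $c_0$ and a control-state $q_F$, is $c_0\in V^1_{AS}$?) is decidable. 2. For every 1-VASS-MDP $S$ and every control-state $q_F$: - the formula $\nu X.\mu Y.(q_F\vee \mathrm{InvPre}(X,Y))$ belongs to $L^{sv}_\mu$, and $V^1_{AS}$ equals its denotation; - $V^1_{AS}$ is upward closed for the order $\langle q,v\rangle\le\langle q',v'\rangle\iff q=q'\wedge v\le v'$; - there are $N\in\mathbb N$ and one strategy $\sigma$ of Player 1 such that for every $c\in V^1_{AS}$ we have $\mathbb P(M_S,c,\sigma,\Diamond q_F)=1$,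 and there is a play $c_0c_1c_2\cdots$ from $c_0=c$ respecting $\sigma$ and an index $i\le N$ such that $c_i$ has control-state $q_F$, $c_j\in V^1_{AS}$ for all $j\le i$, and, for every $j<i$ such that $c_j$ is a configuration of Player P, all successors of $c_j$ lie in $V^1_{AS}$. -/

import Mathlib

open MeasureTheory ProbabilityTheory
open scoped ENNReal

/-! ### VASS and VASS-MDPs -/

/-- A transition `(q, z, q')` of a `d`-dimensional VASS over the control-states `Q`. -/
abbrev VTrans (Q : Type*) (d : ℕ) := Q × (Fin d → ℤ) × Q

/-- A configuration `⟨q, v⟩` in `Q × ℕ^d`. -/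
@[ext]
structure Config (Q : Type*) (d : ℕ) where
  state : Q
  count : Fin d → ℕ

/-- A `d`-dimensional VASS-MDP `⟨Q, Q₁, Q_P, T, τ⟩`. The states of Player P are those outside `Q₁`.
Only the weights of the transitions that leave states of Player P matter, hence only these are
required to be positive. -/
structure VASSMDP (Q : Type*) (d : ℕ) where
  Q₁ : Finset Q
  T : Finset (VTrans Q d)
  τ : VTrans Q d → ℕ
  τ_pos : ∀ t ∈ T, t.1 ∉ Q₁ → 0 < τ t

/-- The control-states of Player P. -/
def VASSMDP.QP {Q : Type*} [Fintype Q] [DecidableEq Q] {d : ℕ} (S : VASSMDP Q d) : Finset Q :=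
  Finset.univ \ S.Q₁

/-- The transitions leaving states of `Q₂` do not change the counters. For a partition `Q₁`, `Q₂`
of the control-states, this says that the VASS `⟨Q, T⟩` is `(Q₁, Q₂)`-single-sided. -/
def IsSingleSided {Q : Type*} {d : ℕ} (T : Finset (VTrans Q d)) (Q₂ : Finset Q) : Prop :=
  ∀ t ∈ T, t.1 ∈ Q₂ → t.2.1 = 0

/-- 1-VASS-MDPs: only Player 1 can change the counters. -/
def VASSMDP.IsOneVASSMDP {Q : Type*} [Fintype Q] [DecidableEq Q] {d : ℕ} (S : VASSMDP Q d) : Prop :=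
  IsSingleSided S.T S.QP

/-! ### Configurations and moves -/

namespace Config

variable {Q : Type*} {d : ℕ}

/-- Same control-state and componentwise order on the counters. -/
instance : LE (Config Q d) := ⟨fun c c' => c.state = c'.state ∧ c.count ≤ c'.count⟩

/-- All sets of configurations are measurable. -/
instance : MeasurableSpace (Config Q d) := ⊤

instance : DiscreteMeasurableSpace (Config Q d) := ⟨fun _ => trivial⟩

instance [Finite Q] : Countable (Config Q d) :=
  Function.Injective.countable (f := fun c : Config Q d => (c.state, c.count))
    (fun a b h => by cases a; cases b; simpa using h)

/-- `t` leaves the control-state of `c` and keeps all counters nonnegative. -/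
def Enabled (c : Config Q d) (t : VTrans Q d) : Prop :=
  t.1 = c.state ∧ ∀ i, 0 ≤ (c.count i : ℤ) + t.2.1 i

/-- The configuration reached by firing `t` in `c` (used when `t` is enabled in `c`). -/
def fire (c : Config Q d) (t : VTrans Q d) : Config Q d :=
  ⟨t.2.2, fun i => ((c.count i : ℤ) + t.2.1 i).toNat⟩

end Config

/-- The transition relation `c → c'` on the configurations of the VASS `⟨Q, T⟩`. -/
def VStep {Q : Type*} {d : ℕ} (T : Finset (VTrans Q d)) (c c' : Config Q d) : Prop :=
  ∃ t ∈ T, c.Enabled t ∧ c' = c.fire t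

/-- A configuration without successor. -/
def VDeadlock {Q : Type*} {d : ℕ} (T : Finset (VTrans Q d)) (c : Config Q d) : Prop :=
  ∀ c', ¬ VStep T c c'

/-! ### The MDP induced by a VASS-MDP: strategies, plays, probabilities -/

namespace VASSMDP

variable {Q : Type*} {d : ℕ}

open Classical in
/-- The transitions that are enabled in `c`. -/
noncomputable def enabled (S : VASSMDP Q d) (c : Config Q d) : Finset (VTrans Q d) :=
  {t ∈ S.T | c.Enabled t}

/-- The distribution `p(c)` for a configuration `c` of Player P that is not a deadlock:
`p(c)(c')` is the total weight of the enabled transitions leading from `c` to `c'`, divided by the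
total weight of all transitions enabled in `c`. -/
noncomputable def prob (S : VASSMDP Q d) (c : Config Q d) : Measure (Config Q d) :=
  (∑ t ∈ S.enabled c, (S.τ t : ℝ≥0∞))⁻¹ •
    ∑ t ∈ S.enabled c, (S.τ t : ℝ≥0∞) • Measure.dirac (c.fire t)

/-- A strategy of Player 1: to a finite sequence `ρ · c` with `c` a configuration of Player 1 that
is not a deadlock it assigns a successor of `c`. (Values at other `c` are never used.) -/
structure Strategy (S : VASSMDP Q d) where
  next : List (Config Q d) → Config Q d → Config Q d
  next_valid : ∀ ρ c, c.state ∈ S.Q₁ → ¬ VDeadlock S.T c → VStep S.T c (next ρ c)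

open Classical in
/-- The law of the next configuration after `ρ · c` under the strategy `σ`. Plays that end in a
deadlock are represented by repeating the deadlock configuration forever. -/
noncomputable def nextLaw (S : VASSMDP Q d) (σ : S.Strategy) (ρ : List (Config Q d))
    (c : Config Q d) : Measure (Config Q d) :=
  if VDeadlock S.T c then Measure.dirac c
  else if c.state ∈ S.Q₁ then Measure.dirac (σ.next ρ c)
  else S.prob c

instance (S : VASSMDP Q d) (σ : S.Strategy) (ρ : List (Config Q d)) (c : Config Q d) :
    IsProbabilityMeasure (S.nextLaw σ ρ c) := by
  unfold nextLaw
  split_ifs with h1 h2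
  · infer_instance
  · infer_instance
  · refine ⟨?_⟩
    simp only [prob, Measure.smul_apply, Measure.coe_finsetSum, Finset.sum_apply, smul_eq_mul,
      measure_univ, mul_one]
    apply ENNReal.inv_mul_cancel
    · intro h0
      simp only [VDeadlock, not_forall, not_not] at h1
      obtain ⟨_, t, ht, hen, -⟩ := h1
      have h3 := (Finset.sum_eq_zero_iff.mp h0) t (by simp [enabled, ht, hen])
      have h4 := S.τ_pos t ht (by rw [hen.1]; exact h2)
      simp only [Nat.cast_eq_zero] at h3
      omega
    · exact ENNReal.sum_ne_top.mpr fun t _ => ENNReal.natCast_ne_top _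

/-- The transition kernels of the process: from the first `n + 1` configurations of a play to the
next one. -/
noncomputable def kernel [Finite Q] (S : VASSMDP Q d) (σ : S.Strategy) (n : ℕ) :
    Kernel ((i : Finset.Iic n) → Config Q d) (Config Q d) where
  toFun h := S.nextLaw σ
    (List.ofFn fun i : Fin n => h ⟨i, Finset.mem_Iic.mpr i.2.le⟩)
    (h ⟨n, Finset.mem_Iic.mpr le_rfl⟩)
  measurable' := measurable_of_countable _

instance [Finite Q] (S : VASSMDP Q d) (σ : S.Strategy) (n : ℕ) : IsMarkovKernel (S.kernel σ n) :=
  ⟨fun _ => inferInstanceAs (IsProbabilityMeasure (S.nextLaw σ _ _))⟩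

/-- The probability measure `ℙ(M_S, c, σ, ·)` on the plays. -/
noncomputable def playMeasure [Finite Q] (S : VASSMDP Q d) (c : Config Q d) (σ : S.Strategy) :
    Measure (ℕ → Config Q d) :=
  Kernel.traj (X := fun _ => Config Q d) (S.kernel σ) 0 (fun _ => c)

/-- The (maximal) plays that start in `c` and respect `σ`; a play that ends in a deadlock is
prolonged by repeating its last configuration. -/
def Outcome (S : VASSMDP Q d) (c : Config Q d) (σ : S.Strategy) : Set (ℕ → Config Q d) :=
  {ω | ω 0 = c ∧ ∀ k,
    (VDeadlock S.T (ω k) → ω (k + 1) = ω k) ∧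
    (¬ VDeadlock S.T (ω k) → (ω k).state ∈ S.Q₁ →
      ω (k + 1) = σ.next (List.ofFn fun i : Fin k => ω i) (ω k)) ∧
    (¬ VDeadlock S.T (ω k) → (ω k).state ∉ S.Q₁ → VStep S.T (ω k) (ω (k + 1)))}

/-- The event `◇ q_F`. -/
def Reach (d : ℕ) (qF : Q) : Set (ℕ → Config Q d) := {ω | ∃ i, (ω i).state = qF}

/-- The configurations from which Player 1 has a strategy to reach `qF` with probability one. -/
def almostSureSet [Finite Q] (S : VASSMDP Q d) (qF : Q) : Set (Config Q d) :=
  {c | ∃ σ : S.Strategy, S.playMeasure c σ (Reach d qF) = 1}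

end VASSMDP

/-! ### The positive mu-calculus over VASS -/

/-- Formulae of the positive mu-calculus, with control-states as atomic propositions and
variables named by natural numbers. -/
inductive MuForm (Q : Type*) where
  | atom (q : Q)
  | var (x : ℕ)
  | and (φ ψ : MuForm Q)
  | or (φ ψ : MuForm Q)
  | dia (φ : MuForm Q)
  | box (φ : MuForm Q)
  | mu (x : ℕ) (φ : MuForm Q)
  | nu (x : ℕ) (φ : MuForm Q)

namespace MuForm

variable {Q : Type*}

/-- The denotation of a formula over the configurations of the VASS `⟨Q, T⟩`, in an
environment `ε`. -/
def interp {d : ℕ} (T : Finset (VTrans Q d)) :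
    MuForm Q → (ℕ → Set (Config Q d)) → Set (Config Q d)
  | atom q, _ => {c | c.state = q}
  | var x, ε => ε x
  | and φ ψ, ε => interp T φ ε ∩ interp T ψ ε
  | or φ ψ, ε => interp T φ ε ∪ interp T ψ ε
  | dia φ, ε => {c | ∃ c', VStep T c c' ∧ c' ∈ interp T φ ε}
  | box φ, ε => {c | ∀ c', VStep T c c' → c' ∈ interp T φ ε}
  | mu x φ, ε => ⋂₀ {A | interp T φ (Function.update ε x A) ⊆ A}
  | nu x φ, ε => ⋃₀ {A | A ⊆ interp T φ (Function.update ε x A)}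

/-- The denotation in the environment `ε₀` that maps every variable to the empty set. -/
def denot {d : ℕ} (T : Finset (VTrans Q d)) (φ : MuForm Q) : Set (Config Q d) :=
  interp T φ (fun _ => ∅)

/-- The disjunction of a list of control-states; the empty disjunction is `μ Z. Z` (false). -/
def disjList : List Q → MuForm Q
  | [] => mu 2 (var 2)
  | [q] => atom q
  | q :: r :: l => or (atom q) (disjList (r :: l))

/-- The formula `⋁_{q ∈ A} q`, written `A` in formulae. -/
noncomputable def disj (A : Finset Q) : MuForm Q := disjList A.toList

/-- The fragment `L^sv_μ` for `(Q₁, Q₂)`-single-sided VASS: the operator `□` occurs only in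
subformulae `Q₂ ∧ □ φ`. -/
inductive InLsv (Q₂ : Finset Q) : MuForm Q → Prop
  | atom (q : Q) : InLsv Q₂ (atom q)
  | var (x : ℕ) : InLsv Q₂ (var x)
  | and {φ ψ : MuForm Q} : InLsv Q₂ φ → InLsv Q₂ ψ → InLsv Q₂ (and φ ψ)
  | or {φ ψ : MuForm Q} : InLsv Q₂ φ → InLsv Q₂ ψ → InLsv Q₂ (or φ ψ)
  | dia {φ : MuForm Q} : InLsv Q₂ φ → InLsv Q₂ (dia φ)
  | guardedBox {φ : MuForm Q} : InLsv Q₂ φ → InLsv Q₂ (and (disj Q₂) (box φ))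
  | mu (x : ℕ) {φ : MuForm Q} : InLsv Q₂ φ → InLsv Q₂ (mu x φ)
  | nu (x : ℕ) {φ : MuForm Q} : InLsv Q₂ φ → InLsv Q₂ (nu x φ)

/-- `InvPre(φ, ψ) = (Q₁ ∧ ◇ (φ ∧ ψ)) ∨ (◇ ψ ∧ (Q_P ∧ □ φ))`. -/
noncomputable def invPre (Q₁ QP : Finset Q) (φ ψ : MuForm Q) : MuForm Q :=
  or (and (disj Q₁) (dia (and φ ψ))) (and (dia ψ) (and (disj QP) (box φ)))

/-- `ν X. μ Y. (q_F ∨ InvPre(X, Y))`, where `X` is variable `0` and `Y` is variable `1`. -/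
noncomputable def almostSureForm (Q₁ QP : Finset Q) (qF : Q) : MuForm Q :=
  nu 0 (mu 1 (or (atom qF) (invPre Q₁ QP (var 0) (var 1))))

end MuForm

/-! ### The decision problem -/

/-- Inputs of the decision problem: number of control-states, dimension, ownership of the
control-states by Player 1, list of weighted transitions, initial configuration, target. -/
abbrev Code : Type :=
  ℕ × ℕ × List Bool × List ((ℕ × List ℤ × ℕ) × ℕ) × (ℕ × List ℕ) × ℕ

/-- `w` is a code of the VASS-MDP `S` with control-states `0, …, n - 1`, the initial configuration
`c₀` and the target state `qF`. The transitions may be listed in any order. -/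
def Encodes {n d : ℕ} (w : Code) (S : VASSMDP (Fin n) d) (c₀ : Config (Fin n) d)
    (qF : Fin n) : Prop :=
  ∃ L : List (VTrans (Fin n) d), L.toFinset = S.T ∧
    w = (n, d, List.ofFn (fun q : Fin n => decide (q ∈ S.Q₁)),
      L.map (fun t => (((t.1 : ℕ), List.ofFn t.2.1, (t.2.2 : ℕ)), S.τ t)),
      ((c₀.state : ℕ), List.ofFn c₀.count), (qF : ℕ))

/-- The almost-sure reachability problem for 1-VASS-MDPs, as a set of codes: `w` encodes a
1-VASS-MDP, an initial configuration and a control-state such that Player 1 has a strategy that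
reaches the control-state from the initial configuration with probability one. -/
def AlmostSureReachability (w : Code) : Prop :=
  ∃ (n d : ℕ) (S : VASSMDP (Fin n) d) (c₀ : Config (Fin n) d) (qF : Fin n),
    S.IsOneVASSMDP ∧ Encodes w S c₀ qF ∧ c₀ ∈ S.almostSureSet qF

/-! ### The fixed point characterization -/

namespace MuForm

variable {Q : Type*} {d : ℕ}

/-! Write `W` for `winSet`, the greatest `X` with `X ⊆ reachLfp X`. If a strategy reaches `q_F`
almost surely, then the configurations met along histories of positive probability that have not yet
visited `q_F` form such an `X`, so they lie in `W` (`almostSureSet_subset_winSet`). Conversely, the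
inner least fixed point is exhausted by the iterates `winLevel`. Player P never changes the
counters, so at a control-state of Player P the same transitions are enabled whatever the counters
are; hence `W` and all levels are upward closed, and Dickson's lemma yields one `N` with `W =
winLevel N` (`exists_winLevel_eq`). A memoryless strategy that lowers the level then has a chance
bounded below to reach `q_F` within `N` steps, from everywhere in `W`, so it wins almost surely
(`playMeasure_rankStrategy`).

For decidability, both answers get finite certificates that can be checked mechanically. A positive
one lists minimal configurations with ranks (`exists_isPosCert`). A negative one consists of boxes
disjoint from `W`, a strategy of Player P on them, and a lexicographic ranking by affine functions
of the counters that bounds how often Player P must force a move; its soundness is an induction on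
this ranking (`IsLosingCert.notMem_winSet`).

Completeness of negative certificates (`exists_losingCert`) is the hard half. The boxes disjoint
from `W`, with bounds up to some `M`, are the nodes of an energy Büchi game with unknown initial
credit. Player 1 cannot win it, since a win would put a configuration of such a box into `W`
(`not_winnable_losingChoices`). The opponent then has a memoryless refutation (`exists_memoryless`),
whose graph contains no closed walk of nonnegative weight through an accepting edge. By Farkas'
lemma, either an affine potential decreases somewhere and increases nowhere, or circulations exist
that can be assembled into such a walk. Discarding the decreasing edges and repeating gives the
lexicographic ranking (`exists_lexRanking`). -/

lemma interp_disjList (T : Finset (VTrans Q d)) (l : List Q) (ε : ℕ → Set (Config Q d)) :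
    interp T (disjList l) ε = {c | c.state ∈ l} := by
  induction l with
  | nil =>
    ext c
    simp only [disjList, interp, Function.update_self, Set.mem_sInter, Set.mem_ofPred_eq,
      List.not_mem_nil, iff_false, not_forall]
    exact ⟨∅, subset_rfl, by simp⟩
  | cons q l ih =>
    cases l with
    | nil => ext c; simp [disjList, interp]
    | cons r l =>
      rw [disjList, interp, ih]
      ext c
      simp [interp]

lemma interp_disj (T : Finset (VTrans Q d)) (A : Finset Q) (ε : ℕ → Set (Config Q d)) :
    interp T (disj A) ε = {c | c.state ∈ A} := by
  simp [disj, interp_disjList]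

lemma inLsv_disjList (Q₂ : Finset Q) : ∀ l : List Q, InLsv Q₂ (disjList l)
  | [] => .mu _ (.var _)
  | [q] => .atom q
  | _ :: r :: l => .or (.atom _) (inLsv_disjList Q₂ (r :: l))

lemma inLsv_almostSureForm (Q₁ QP : Finset Q) (qF : Q) : InLsv QP (almostSureForm Q₁ QP qF) :=
  .nu _ (.mu _ (.or (.atom _) (.or (.and (inLsv_disjList _ _) (.dia (.and (.var _) (.var _))))
    (.and (.dia (.var _)) (.guardedBox (.var _))))))

end MuForm

namespace VASSMDP

variable {Q : Type*} {d : ℕ}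

/-- The operator `(X, Y) ↦ q_F ∨ InvPre(X, Y)` on sets of configurations. -/
def reachStep (S : VASSMDP Q d) (qF : Q) (X Y : Set (Config Q d)) : Set (Config Q d) :=
  {c | c.state = qF ∨ (c.state ∈ S.Q₁ ∧ ∃ c', VStep S.T c c' ∧ c' ∈ X ∧ c' ∈ Y) ∨
    (c.state ∉ S.Q₁ ∧ (∃ c', VStep S.T c c' ∧ c' ∈ Y) ∧ ∀ c', VStep S.T c c' → c' ∈ X)}

/-- The least fixed point of `reachStep S qF X`. -/
def reachLfp (S : VASSMDP Q d) (qF : Q) (X : Set (Config Q d)) : Set (Config Q d) :=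
  ⋂₀ {Y | S.reachStep qF X Y ⊆ Y}

/-- The greatest fixed point of `reachLfp S qF`. -/
def winSet (S : VASSMDP Q d) (qF : Q) : Set (Config Q d) :=
  ⋃₀ {X | X ⊆ S.reachLfp qF X}

lemma denot_almostSureForm [Fintype Q] [DecidableEq Q] (S : VASSMDP Q d) (qF : Q) :
    MuForm.denot S.T (MuForm.almostSureForm S.Q₁ S.QP qF) = S.winSet qF := by
  have key : ∀ X Y : Set (Config Q d),
      MuForm.interp S.T (.or (.atom qF) (MuForm.invPre S.Q₁ S.QP (.var 0) (.var 1)))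
        (Function.update (Function.update (fun _ => ∅) 0 X) 1 Y) = S.reachStep qF X Y := by
    intro X Y
    ext c
    simp only [MuForm.interp, MuForm.invPre, MuForm.interp_disj, reachStep, QP, Set.mem_union,
      Set.mem_inter_iff, Set.mem_ofPred_eq, Finset.mem_sdiff, Finset.mem_univ, true_and,
      Function.update_self, ne_eq, zero_ne_one, not_false_eq_true, Function.update_of_ne,
      and_left_comm (b := c.state ∉ S.Q₁)]
  simp only [MuForm.denot, MuForm.almostSureForm, winSet, reachLfp]
  rw [MuForm.interp]
  congr 1
  ext X
  rw [Set.mem_ofPred_eq, Set.mem_ofPred_eq, MuForm.interp]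
  simp only [key]

variable (S : VASSMDP Q d) (qF : Q)

lemma reachStep_mono {X X' Y Y' : Set (Config Q d)} (hX : X ⊆ X') (hY : Y ⊆ Y') :
    S.reachStep qF X Y ⊆ S.reachStep qF X' Y' := by
  rintro c (h | ⟨h, c', h1, h2, h3⟩ | ⟨h, ⟨c', h1, h2⟩, h3⟩)
  · exact .inl h
  · exact .inr (.inl ⟨h, c', h1, hX h2, hY h3⟩)
  · exact .inr (.inr ⟨h, ⟨c', h1, hY h2⟩, fun c'' h4 => hX (h3 c'' h4)⟩)

lemma reachStep_reachLfp (X : Set (Config Q d)) :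
    S.reachStep qF X (S.reachLfp qF X) ⊆ S.reachLfp qF X :=
  fun _ hc _ hY => hY (S.reachStep_mono qF subset_rfl (Set.sInter_subset_of_mem hY) hc)

lemma reachLfp_mono {X X' : Set (Config Q d)} (h : X ⊆ X') :
    S.reachLfp qF X ⊆ S.reachLfp qF X' :=
  fun _ hc Y hY => hc Y ((S.reachStep_mono qF h subset_rfl).trans hY)

lemma subset_winSet {X : Set (Config Q d)} (h : X ⊆ S.reachLfp qF X) : X ⊆ S.winSet qF :=
  Set.subset_sUnion_of_mem h

lemma winSet_subset_reachLfp : S.winSet qF ⊆ S.reachLfp qF (S.winSet qF) :=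
  Set.sUnion_subset fun _ hX => hX.trans (S.reachLfp_mono qF (S.subset_winSet qF hX))

lemma reachLfp_winSet : S.reachLfp qF (S.winSet qF) = S.winSet qF :=
  (S.subset_winSet qF (S.reachLfp_mono qF (S.winSet_subset_reachLfp qF))).antisymm
    (S.winSet_subset_reachLfp qF)

lemma reachStep_winSet_subset : S.reachStep qF (S.winSet qF) (S.winSet qF) ⊆ S.winSet qF := by
  conv_lhs => rw [← S.reachLfp_winSet qF]
  rw [S.reachLfp_winSet qF]
  conv_rhs => rw [← S.reachLfp_winSet qF]
  -- Only the second argument becomes the least fixed point; the first stays `winSet`, in the shape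
  -- of `reachStep_reachLfp`.
  conv_lhs => arg 4; rw [← S.reachLfp_winSet qF]
  exact S.reachStep_reachLfp qF _

/-- A ranked family of configurations, up to the winning set, certifies winning. -/
lemma mem_winSet_of_ranked (X : Config Q d → ℕ → Prop)
    (h : ∀ c k, X c k → c.state = qF ∨
      (c.state ∈ S.Q₁ ∧ ∃ c', VStep S.T c c' ∧ (c' ∈ S.winSet qF ∨ ∃ k' < k, X c' k')) ∨
      (c.state ∉ S.Q₁ ∧ (∃ c', VStep S.T c c' ∧ (c' ∈ S.winSet qF ∨ ∃ k' < k, X c' k')) ∧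
        ∀ c', VStep S.T c c' → c' ∈ S.winSet qF ∨ ∃ k', X c' k'))
    {c : Config Q d} {k : ℕ} (hc : X c k) : c ∈ S.winSet qF := by
  set Z : Set (Config Q d) := S.winSet qF ∪ {c | ∃ k, X c k} with hZ
  suffices hs : Z ⊆ S.reachLfp qF Z from S.subset_winSet qF hs (.inr ⟨k, hc⟩)
  have h0 : S.winSet qF ⊆ S.reachLfp qF Z :=
    (S.winSet_subset_reachLfp qF).trans (S.reachLfp_mono qF Set.subset_union_left)
  rintro c (hc | ⟨k, hc⟩)
  · exact h0 hc
  -- The rank drives the inner least fixed point. Successors that Player P may choose against Player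
  -- 1 only have to lie in `Z`, so their ranks are unrestricted.
  induction k using Nat.strong_induction_on generalizing c with
  | _ k ih =>
    apply S.reachStep_reachLfp qF
    have aux : ∀ c', (c' ∈ S.winSet qF ∨ ∃ k' < k, X c' k') → c' ∈ Z ∧ c' ∈ S.reachLfp qF Z := by
      rintro c' (h1 | ⟨k', hk, h1⟩)
      · exact ⟨.inl h1, h0 h1⟩
      · exact ⟨.inr ⟨k', h1⟩, ih k' hk h1⟩
    rcases h c k hc with h1 | ⟨h1, c', h2, h3⟩ | ⟨h1, ⟨c', h2, h3⟩, h4⟩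
    · exact .inl h1
    · exact .inr (.inl ⟨h1, c', h2, aux c' h3⟩)
    · exact .inr (.inr ⟨h1, ⟨c', h2, (aux c' h3).2⟩, fun c'' h5 => h4 c'' h5⟩)

/-- The configurations from which Player 1 can force, within the winning set, a visit of `qF` in
fewer than `n` moves when Player P cooperates. -/
def winLevel : ℕ → Set (Config Q d)
  | 0 => ∅
  | n + 1 => S.reachStep qF (S.winSet qF) (winLevel n)

lemma winLevel_subset_winSet : ∀ n, S.winLevel qF n ⊆ S.winSet qF
  | 0 => Set.empty_subset _
  | n + 1 => (S.reachStep_mono qF subset_rfl (winLevel_subset_winSet n)).trans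
      (S.reachStep_winSet_subset qF)

lemma winLevel_subset_succ : ∀ n, S.winLevel qF n ⊆ S.winLevel qF (n + 1)
  | 0 => Set.empty_subset _
  | n + 1 => S.reachStep_mono qF subset_rfl (winLevel_subset_succ n)

lemma winLevel_mono : Monotone (S.winLevel qF) :=
  monotone_nat_of_le_succ (S.winLevel_subset_succ qF)

/-- Iteration up to `ω` suffices because `reachStep` asks for only one successor in its second
argument, and a single witness already lies in some finite level. -/
lemma winSet_eq_iUnion : S.winSet qF = ⋃ n, S.winLevel qF n := by
  refine subset_antisymm ?_ (Set.iUnion_subset (S.winLevel_subset_winSet qF))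
  refine (S.winSet_subset_reachLfp qF).trans (Set.sInter_subset_of_mem ?_)
  rintro c (h | ⟨h, c', h1, h2, h3⟩ | ⟨h, ⟨c', h1, h2⟩, h3⟩)
  · exact Set.mem_iUnion.2 ⟨1, .inl h⟩
  · obtain ⟨n, hn⟩ := Set.mem_iUnion.1 h3
    exact Set.mem_iUnion.2 ⟨n + 1, .inr (.inl ⟨h, c', h1, h2, hn⟩)⟩
  · obtain ⟨n, hn⟩ := Set.mem_iUnion.1 h2
    exact Set.mem_iUnion.2 ⟨n + 1, .inr (.inr ⟨h, ⟨c', h1, hn⟩, h3⟩)⟩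

/-! ### Upward closure and uniform convergence -/

lemma step_mono {T : Finset (VTrans Q d)} {c c' e : Config Q d} (h : VStep T c c') (hle : c ≤ e) :
    ∃ e', VStep T e e' ∧ c' ≤ e' := by
  obtain ⟨t, ht, hen, rfl⟩ := h
  refine ⟨e.fire t, ⟨t, ht, ⟨hen.1.trans hle.1, fun i => ?_⟩, rfl⟩, rfl, fun i => ?_⟩
  · have h1 := hen.2 i; have h2 : c.count i ≤ e.count i := hle.2 i; omega
  · have h2 : c.count i ≤ e.count i := hle.2 i
    simp only [Config.fire]
    omega

variable {S qF}

lemma IsOneVASSMDP.weight_eq_zero [Fintype Q] [DecidableEq Q] (hS : S.IsOneVASSMDP)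
    {t : VTrans Q d} (ht : t ∈ S.T) (h : t.1 ∉ S.Q₁) : t.2.1 = 0 :=
  hS t ht (by simp [QP, h])

/-- This is where single-sidedness enters: transitions of Player P have weight zero, so a larger
configuration offers Player P no new transition, and a condition on all successors survives when
counters grow. -/
lemma IsOneVASSMDP.step_anti [Fintype Q] [DecidableEq Q] (hS : S.IsOneVASSMDP)
    {c e e' : Config Q d} (h : VStep S.T e e') (hc : c.state ∉ S.Q₁) (hle : c ≤ e) :
    ∃ c', VStep S.T c c' ∧ c' ≤ e' := by
  obtain ⟨t, ht, hen, rfl⟩ := h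
  have hst : t.1 = c.state := hen.1.trans hle.1.symm
  have hz := hS.weight_eq_zero ht (hst ▸ hc)
  refine ⟨c.fire t, ⟨t, ht, ⟨hst, fun i => by simp [hz]⟩, rfl⟩, rfl, fun i => ?_⟩
  have := hle.2 i
  simp [Config.fire, hz]
  exact this

lemma IsOneVASSMDP.isUpperSet_reachStep [Fintype Q] [DecidableEq Q] (hS : S.IsOneVASSMDP)
    {X Y : Set (Config Q d)} (hX : IsUpperSet X) (hY : IsUpperSet Y) :
    IsUpperSet (S.reachStep qF X Y) := by
  rintro c e hle (h | ⟨h, c', h1, h2, h3⟩ | ⟨h, ⟨c', h1, h2⟩, h3⟩)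
  · exact .inl (hle.1.symm.trans h)
  · obtain ⟨e', he, hle'⟩ := step_mono h1 hle
    exact .inr (.inl ⟨hle.1 ▸ h, e', he, hX hle' h2, hY hle' h3⟩)
  · obtain ⟨e', he, hle'⟩ := step_mono h1 hle
    refine .inr (.inr ⟨hle.1 ▸ h, ⟨e', he, hY hle' h2⟩, fun e'' he'' => ?_⟩)
    obtain ⟨c'', hc'', hle''⟩ := hS.step_anti he'' h hle
    exact hX hle'' (h3 c'' hc'')

lemma Config_le_trans {a b c : Config Q d} (h : a ≤ b) (h' : b ≤ c) : a ≤ c :=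
  ⟨h.1.trans h'.1, h.2.trans h'.2⟩

/-- The upward closure `U` of the winning set is again a post-fixed point: by induction on `n`,
everything above level `n` lies in each pre-fixed point `Y` of `reachStep U`. -/
lemma IsOneVASSMDP.isUpperSet_winSet [Fintype Q] [DecidableEq Q] (hS : S.IsOneVASSMDP) :
    IsUpperSet (S.winSet qF) := by
  set U : Set (Config Q d) := {e | ∃ c ∈ S.winSet qF, c ≤ e}
  have hsub : S.winSet qF ⊆ U := fun c hc => ⟨c, hc, rfl, le_rfl⟩
  have hU : IsUpperSet U := fun a b hab ⟨c, hc, hca⟩ => ⟨c, hc, Config_le_trans hca hab⟩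
  suffices h : U ⊆ S.winSet qF from fun a b hab ha => h ⟨a, ha, hab⟩
  refine S.subset_winSet qF ?_
  rintro e ⟨c, hc, hle⟩ Y hY
  rw [winSet_eq_iUnion] at hc
  obtain ⟨n, hn⟩ := Set.mem_iUnion.1 hc
  clear hc
  have main : ∀ n, ∀ c ∈ S.winLevel qF n, ∀ e, c ≤ e → e ∈ Y := by
    intro n
    induction n with
    | zero => exact fun c hc => absurd hc (by simp [winLevel])
    | succ n ih =>
      intro c hc e hle
      apply hY
      -- `Y` need not be upward closed, so the operator is applied to the upward closure of level
      -- `n`, which the induction hypothesis places inside `Y`.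
      set W : Set (Config Q d) := {e | ∃ c ∈ S.winLevel qF n, c ≤ e}
      have hW : IsUpperSet W := fun a b hab ⟨c, hc, hca⟩ => ⟨c, hc, Config_le_trans hca hab⟩
      have hsW : S.winLevel qF n ⊆ W := fun c hc => ⟨c, hc, rfl, le_rfl⟩
      have hWY : W ⊆ Y := by
        rintro e ⟨c, hc, hle⟩
        exact ih c hc e hle
      exact S.reachStep_mono qF subset_rfl hWY (hS.isUpperSet_reachStep hU hW hle
        (S.reachStep_mono qF hsub hsW hc))
  exact main n c hn e hle

lemma IsOneVASSMDP.isUpperSet_winLevel [Fintype Q] [DecidableEq Q] (hS : S.IsOneVASSMDP) :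
    ∀ n, IsUpperSet (S.winLevel qF n)
  | 0 => isUpperSet_empty
  | n + 1 => hS.isUpperSet_reachStep hS.isUpperSet_winSet (isUpperSet_winLevel hS n)

/-- Dickson's lemma for sets of configurations. -/
lemma exists_finset_basis [Finite Q] (U : Set (Config Q d)) :
    ∃ B : Finset (Config Q d), (∀ b ∈ B, b ∈ U) ∧ ∀ c ∈ U, ∃ b ∈ B, b ≤ c := by
  have hfin : ∀ q, {v : Fin d → ℕ | Minimal (fun v => (⟨q, v⟩ : Config Q d) ∈ U) v}.Finite :=
    fun q => WellQuasiOrderedLE.finite_of_isAntichain (setOfPred_minimal_antichain _)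
  have : (⋃ q, (Config.mk q) '' {v : Fin d → ℕ |
      Minimal (fun v => (⟨q, v⟩ : Config Q d) ∈ U) v}).Finite :=
    Set.finite_iUnion fun q => (hfin q).image _
  refine ⟨this.toFinset, fun b hb => ?_, fun c hc => ?_⟩
  · simp only [Set.Finite.mem_toFinset, Set.mem_iUnion, Set.mem_image, Set.mem_ofPred_eq] at hb
    obtain ⟨q, v, hv, rfl⟩ := hb
    exact hv.1
  · obtain ⟨v, hv, hmin⟩ := exists_minimal_le_of_wellFoundedLT
      (fun v => (⟨c.state, v⟩ : Config Q d) ∈ U) c.count hc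
    refine ⟨⟨c.state, v⟩, ?_, rfl, hv⟩
    simp only [Set.Finite.mem_toFinset, Set.mem_iUnion, Set.mem_image, Set.mem_ofPred_eq]
    exact ⟨_, v, hmin, rfl⟩

/-- Each element of a finite basis lies in some level; since the levels are upward closed, the
largest of these finitely many indices serves the whole set. -/
lemma IsOneVASSMDP.exists_winLevel_eq [Fintype Q] [DecidableEq Q] (hS : S.IsOneVASSMDP) :
    ∃ N, S.winSet qF = S.winLevel qF N := by
  obtain ⟨B, hB, hB'⟩ := exists_finset_basis (S.winSet qF)
  have : ∀ b : B, ∃ n, b.1 ∈ S.winLevel qF n := fun b => by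
    have := hB b.1 b.2
    rw [winSet_eq_iUnion] at this
    exact Set.mem_iUnion.1 this
  choose r hr using this
  obtain ⟨N, hN⟩ := (Set.finite_range r).bddAbove
  refine ⟨N, Set.Subset.antisymm (fun c hc => ?_) (S.winLevel_subset_winSet qF N)⟩
  obtain ⟨b, hb, hle⟩ := hB' c hc
  exact hS.isUpperSet_winLevel N hle
    (S.winLevel_mono qF (hN ⟨⟨b, hb⟩, rfl⟩) (hr ⟨b, hb⟩))

end VASSMDP

namespace VASSMDP

variable {Q : Type*} {d : ℕ}

/-! ### The law of a play -/

section Law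

variable [Finite Q] (S : VASSMDP Q d) (c : Config Q d) (σ : S.Strategy)

instance : IsProbabilityMeasure (S.playMeasure c σ) := by
  unfold playMeasure; infer_instance

/-- The law of the `(k + 1)`-st configuration given the play `ω` up to time `k`. -/
noncomputable abbrev lawAfter (ω : ℕ → Config Q d) (k : ℕ) : Measure (Config Q d) :=
  S.nextLaw σ (List.ofFn fun i : Fin k => ω i) (ω k)

lemma map_playMeasure_succ (k : ℕ) :
    (S.playMeasure c σ).map (fun ω => (Preorder.frestrictLe k ω, ω (k + 1))) =
      ((S.playMeasure c σ).map (Preorder.frestrictLe k)) ⊗ₘ (S.kernel σ k) := by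
  unfold playMeasure
  rw [Kernel.traj_map_frestrictLe_apply, Kernel.partialTraj_compProd_eq_map_traj (Nat.zero_le k)]

lemma playMeasure_zero : ∀ᵐ ω ∂(S.playMeasure c σ), ω 0 = c := by
  have h : (S.playMeasure c σ).map (Preorder.frestrictLe 0) = Measure.dirac (fun _ => c) := by
    unfold playMeasure
    rw [Kernel.traj_map_frestrictLe_apply, Kernel.partialTraj_self, Kernel.id_apply]
  have h2 : ∀ᵐ x ∂((S.playMeasure c σ).map (Preorder.frestrictLe 0)),
      x ⟨0, by simp⟩ = c := by
    rw [h, ae_dirac_eq]; exact rfl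
  exact ae_of_ae_map (by fun_prop) h2

lemma lintegral_playMeasure_succ (k : ℕ)
    (f : ((i : Finset.Iic k) → Config Q d) × Config Q d → ℝ≥0∞) :
    ∫⁻ ω, f (Preorder.frestrictLe k ω, ω (k + 1)) ∂(S.playMeasure c σ) =
      ∫⁻ ω, ∫⁻ y, f (Preorder.frestrictLe k ω, y) ∂(S.lawAfter σ ω k) ∂(S.playMeasure c σ) := by
  have hf : Measurable f := measurable_of_countable f
  rw [← lintegral_map (f := f) (g := fun ω : ℕ → Config Q d =>
    (Preorder.frestrictLe k ω, ω (k + 1))) hf (by fun_prop), map_playMeasure_succ,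
    Measure.lintegral_compProd hf, lintegral_map (measurable_of_countable _) (by fun_prop)]
  rfl

/-- The plays that agree with `ω` up to time `k`. -/
def agree (ω : ℕ → Config Q d) (k : ℕ) : Set (ℕ → Config Q d) := {η | ∀ i ≤ k, η i = ω i}

omit [Finite Q] in
lemma mem_agree_iff {ω η : ℕ → Config Q d} {k : ℕ} : η ∈ agree ω k ↔
    Preorder.frestrictLe (π := fun _ => Config Q d) k η = Preorder.frestrictLe k ω :=
  ⟨fun h => funext fun i => h i (Finset.mem_Iic.1 i.2),
    fun h i hi => congrFun h ⟨i, Finset.mem_Iic.2 hi⟩⟩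

omit [Finite Q] in
lemma agree_eq_preimage (ω : ℕ → Config Q d) (k : ℕ) :
    agree ω k = Preorder.frestrictLe (π := fun _ => Config Q d) k ⁻¹'
      {Preorder.frestrictLe (π := fun _ => Config Q d) k ω} :=
  Set.ext fun _ => mem_agree_iff

lemma playMeasure_agree_succ (ω : ℕ → Config Q d) (k : ℕ) :
    S.playMeasure c σ (agree ω (k + 1)) =
      S.lawAfter σ ω k {ω (k + 1)} * S.playMeasure c σ (agree ω k) := by
  have h : agree ω (k + 1) = (fun η : ℕ → Config Q d => (Preorder.frestrictLe k η, η (k + 1))) ⁻¹'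
      ({Preorder.frestrictLe k ω} ×ˢ {ω (k + 1)}) := by
    ext η
    simp only [Set.mem_preimage, Set.mem_prod, Set.mem_singleton_iff]
    rw [← mem_agree_iff]
    simp only [agree, Set.mem_ofPred_eq, Nat.le_succ_iff]
    refine ⟨fun h => ⟨fun i hi => h i (.inl hi), h _ (.inr rfl)⟩, ?_⟩
    rintro ⟨h1, h2⟩ i (hi | rfl)
    exacts [h1 i hi, h2]
  rw [h, ← Measure.map_apply (by fun_prop) (measurableSet_singleton _ |>.prod
    (measurableSet_singleton _)), map_playMeasure_succ, Measure.compProd_apply_prod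
    (measurableSet_singleton _) (measurableSet_singleton _), lintegral_singleton,
    Measure.map_apply (by fun_prop) (measurableSet_singleton _), ← agree_eq_preimage]
  rfl

/-- There are only countably many prefixes of each length, so the null ones together still have
measure zero. -/
lemma ae_playMeasure_agree_ne_zero :
    ∀ᵐ ω ∂(S.playMeasure c σ), ∀ k, S.playMeasure c σ (agree ω k) ≠ 0 := by
  rw [ae_all_iff]
  intro k
  have h : ∀ᵐ x ∂((S.playMeasure c σ).map (Preorder.frestrictLe k)),
      ((S.playMeasure c σ).map (Preorder.frestrictLe k)) {x} ≠ 0 := by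
    rw [ae_iff, ← Set.biUnion_of_singleton {x | ¬ _}]
    exact (measure_biUnion_null_iff (Set.to_countable _)).2 fun x hx => not_not.1 hx
  have h2 := ae_of_ae_map (by fun_prop) h
  filter_upwards [h2] with ω hω
  rwa [Measure.map_apply (by fun_prop) (measurableSet_singleton _), ← agree_eq_preimage] at hω

omit [Finite Q] in
variable {S σ} in
lemma nextLaw_singleton_ne_zero_of_step {ρ : List (Config Q d)} {x y : Config Q d}
    (hx : x.state ∉ S.Q₁) (h : VStep S.T x y) : S.nextLaw σ ρ x {y} ≠ 0 := by
  have hd : ¬ VDeadlock S.T x := fun h' => h' y h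
  rw [nextLaw, if_neg hd, if_neg hx]
  obtain ⟨t, ht, hen, rfl⟩ := h
  have ht' : t ∈ S.enabled x := by simp [enabled, ht, hen]
  have hpos := S.τ_pos t ht (hen.1 ▸ hx)
  simp only [prob, Measure.smul_apply, Measure.coe_finsetSum, Finset.sum_apply, smul_eq_mul]
  refine mul_ne_zero (ENNReal.inv_ne_zero.2
    (ENNReal.sum_ne_top.mpr fun t _ => ENNReal.natCast_ne_top _)) fun h0 => ?_
  have := (Finset.sum_eq_zero_iff.mp h0) t ht'
  simp at this
  omega

end Law

/-! ### Almost surely winning configurations are in the winning set -/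

/-- The set `X` collects the ends of histories of positive probability without an earlier visit of
`qF`. If a point of `X` escaped some pre-fixed point `Y`, then a play continuing its history through
prefixes of positive probability would stay outside `Y` forever, hence never see `qF`, although
almost every play does. -/
theorem almostSureSet_subset_winSet [Finite Q] (S : VASSMDP Q d) (qF : Q) :
    S.almostSureSet qF ⊆ S.winSet qF := by
  rintro c ⟨σ, hσ⟩
  set μ := S.playMeasure c σ with hμ
  set X : Set (Config Q d) := {x | ∃ ω k, μ (agree ω k) ≠ 0 ∧
    (∀ i < k, (ω i).state ≠ qF) ∧ ω k = x} with hX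
  have hreach : ∀ᵐ ω ∂μ, ω ∈ Reach d qF := by
    rw [← prob_compl_eq_zero_iff] at hσ
    · exact hσ
    · have : Reach d qF = ⋃ i, (fun ω : ℕ → Config Q d => ω i) ⁻¹' {x | x.state = qF} := by
        ext; simp [Reach]
      rw [this]
      exact MeasurableSet.iUnion fun i => measurable_pi_apply i trivial
  have hcX : c ∈ X := by
    refine ⟨fun _ => c, 0, ?_, by simp, rfl⟩
    have h1 : μ (agree (fun _ => c) 0) = 1 := by
      rw [← prob_compl_eq_zero_iff]
      · filter_upwards [S.playMeasure_zero c σ] with ω h i hi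
        rw [Nat.le_zero.1 hi, h]
      · rw [agree_eq_preimage]
        exact measurableSet_preimage (by fun_prop) (measurableSet_singleton _)
    rw [h1]; exact one_ne_zero
  refine S.subset_winSet qF (X := X) ?_ hcX
  rintro x ⟨ω₀, k, hpos, hno, rfl⟩ Y hY
  by_contra hxY
  -- The plays extending the given history have positive measure, so they meet every set of full
  -- measure.
  obtain ⟨ω, hωA, hωpos, i, hi⟩ : ∃ ω ∈ agree ω₀ k, (∀ k, μ (agree ω k) ≠ 0) ∧ ω ∈ Reach d qF := by
    by_contra! hcon
    refine hpos (measure_mono_null (t := {ω | ¬ ((∀ k, μ (agree ω k) ≠ 0) ∧ ω ∈ Reach d qF)})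
      (fun ω hω h => hcon ω hω h.1 h.2) ?_)
    exact (S.ae_playMeasure_agree_ne_zero c σ).and hreach
  have key : ∀ j, k ≤ j → ω j ∉ Y ∧ ∀ i ≤ j, (ω i).state ≠ qF := by
    intro j hj
    induction j, hj using Nat.le_induction with
    | base =>
      rw [hωA k le_rfl]
      refine ⟨hxY, fun i hi => ?_⟩
      rcases hi.lt_or_eq with h | rfl
      · rw [hωA i h.le]; exact hno i h
      · rw [hωA i le_rfl]; exact fun h => hxY (hY (.inl h))
    | succ j hj ih =>
      obtain ⟨ih1, ih2⟩ := ih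
      suffices h : ω (j + 1) ∉ Y by
        refine ⟨h, fun i hi => ?_⟩
        rcases Nat.le_succ_iff.1 hi with h' | rfl
        exacts [ih2 i h', fun h' => h (hY (.inl h'))]
      intro hin
      have hlaw : S.lawAfter σ ω j {ω (j + 1)} ≠ 0 := by
        have := hωpos (j + 1)
        rw [hμ, playMeasure_agree_succ] at this
        exact left_ne_zero_of_mul this
      by_cases hd : VDeadlock S.T (ω j)
      · rw [lawAfter, nextLaw, if_pos hd] at hlaw
        have : ω j = ω (j + 1) := by
          by_contra hne
          simp [hne] at hlaw
        exact ih1 (this ▸ hin)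
      by_cases hq : (ω j).state ∈ S.Q₁
      · rw [lawAfter, nextLaw, if_neg hd, if_pos hq] at hlaw
        have : σ.next (List.ofFn fun i : Fin j => ω i) (ω j) = ω (j + 1) := by
          by_contra hne
          simp [hne] at hlaw
        refine ih1 (hY (.inr (.inl ⟨hq, ω (j + 1), this ▸ σ.next_valid _ _ hq hd, ?_, hin⟩)))
        exact ⟨ω, j + 1, hωpos _, fun i hi => ih2 i (Nat.lt_succ_iff.1 hi), rfl⟩
      · refine ih1 (hY (.inr (.inr ⟨hq, ⟨ω (j + 1), ?_, hin⟩, fun y hy => ?_⟩)))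
        · by_contra hns
          rw [lawAfter, nextLaw, if_neg hd, if_neg hq] at hlaw
          simp only [prob, Measure.smul_apply, Measure.coe_finsetSum, Finset.sum_apply,
            smul_eq_mul] at hlaw
          refine hlaw (mul_eq_zero_of_right _ (Finset.sum_eq_zero fun t ht => ?_))
          have hne : (ω j).fire t ≠ ω (j + 1) := fun h => hns ⟨t, by
            simp only [enabled, Finset.mem_filter] at ht
            exact ⟨ht.1, ht.2, h.symm⟩⟩
          simp [hne]
        · have hag : ∀ η : ℕ → Config Q d, (∀ i ≤ j, η i = ω i) → agree η j = agree ω j := by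
            intro η hη
            ext ζ
            exact ⟨fun h i hi => (h i hi).trans (hη i hi), fun h i hi => (h i hi).trans (hη i hi).symm⟩
          -- Redirecting the play at time `j + 1` to any successor `y` of a Player P configuration
          -- keeps the prefix probability positive; thus all such successors lie in `X`.
          have hup : ∀ i ≤ j, Function.update ω (j + 1) y i = ω i := fun i hi =>
            Function.update_of_ne (by omega) _ _
          refine ⟨Function.update ω (j + 1) y, j + 1, ?_, fun i hi => ?_, Function.update_self ..⟩
          · rw [hμ, playMeasure_agree_succ, hag _ hup]
            refine mul_ne_zero ?_ (hωpos j)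
            rw [lawAfter, hup j le_rfl, Function.update_self]
            exact nextLaw_singleton_ne_zero_of_step hq hy
          · rw [hup i (Nat.lt_succ_iff.1 hi)]
            exact ih2 i (Nat.lt_succ_iff.1 hi)
  exact (key (max i k) (le_max_right _ _)).2 i (le_max_left _ _) hi

end VASSMDP

namespace VASSMDP

variable {Q : Type*} {d : ℕ}

/-! ### A strategy that wins almost surely from the whole winning set -/

section Rank

variable (S : VASSMDP Q d) (qF : Q)

/-- The least `n` with `c` in the level `n` of the winning set. -/
noncomputable def winRank (c : Config Q d) : ℕ := sInf {n | c ∈ S.winLevel qF n}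

/-- A successor of `c` of smaller rank. -/
def RankStep (c c' : Config Q d) : Prop :=
  VStep S.T c c' ∧ c' ∈ S.winSet qF ∧ S.winRank qF c' < S.winRank qF c

variable {S qF}

lemma mem_winLevel_winRank {c : Config Q d} (hc : c ∈ S.winSet qF) :
    c ∈ S.winLevel qF (S.winRank qF c) := by
  rw [winSet_eq_iUnion] at hc
  exact Nat.sInf_mem (s := {n | c ∈ S.winLevel qF n}) (Set.mem_iUnion.1 hc)

lemma winRank_le {c : Config Q d} {n : ℕ} (hc : c ∈ S.winLevel qF n) : S.winRank qF c ≤ n :=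
  Nat.sInf_le hc

lemma winRank_pos {c : Config Q d} (hc : c ∈ S.winSet qF) : 0 < S.winRank qF c := by
  by_contra h
  have := mem_winLevel_winRank hc
  rw [Nat.eq_zero_of_not_pos h] at this
  exact this

lemma exists_rankStep {c : Config Q d} (hc : c ∈ S.winSet qF) (hF : c.state ≠ qF) :
    (∃ c', S.RankStep qF c c') ∧
      (c.state ∉ S.Q₁ → ∀ c', VStep S.T c c' → c' ∈ S.winSet qF) := by
  have h := mem_winLevel_winRank hc
  obtain ⟨n, hn⟩ := Nat.exists_eq_succ_of_ne_zero (winRank_pos hc).ne'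
  have hlt : ∀ {c'}, c' ∈ S.winLevel qF n → S.winRank qF c' < S.winRank qF c := fun hc' => by
    rw [hn]; exact Nat.lt_succ_of_le (winRank_le hc')
  rw [hn] at h
  rcases h with h | ⟨h, c', h1, h2, h3⟩ | ⟨h, ⟨c', h1, h2⟩, h3⟩
  · exact absurd h hF
  · exact ⟨⟨c', h1, h2, hlt h3⟩, fun h' => absurd h h'⟩
  · exact ⟨⟨c', h1, S.winLevel_subset_winSet qF n h2, hlt h2⟩, fun _ => h3⟩

variable (S qF)

open Classical in
/-- A successor of `c`, of smaller rank if possible (`c` itself if `c` is a deadlock). -/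
noncomputable def pick (c : Config Q d) : Config Q d :=
  if h : ∃ c', S.RankStep qF c c' then h.choose
  else if h : ∃ c', VStep S.T c c' then h.choose else c

variable {S qF}

lemma rankStep_pick {c : Config Q d} (hc : c ∈ S.winSet qF) (hF : c.state ≠ qF) :
    S.RankStep qF c (S.pick qF c) := by
  have h := (exists_rankStep hc hF).1
  rw [pick, dif_pos h]
  exact h.choose_spec

lemma step_pick {c : Config Q d} (hc : ¬ VDeadlock S.T c) : VStep S.T c (S.pick qF c) := by
  simp only [VDeadlock, not_forall, not_not] at hc
  rw [pick]
  split_ifs with h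
  exacts [h.choose_spec.1, hc.choose_spec]

lemma pick_of_deadlock {c : Config Q d} (hc : VDeadlock S.T c) : S.pick qF c = c := by
  rw [pick, dif_neg (fun ⟨c', h⟩ => hc c' h.1), dif_neg (fun ⟨c', h⟩ => hc c' h)]

variable (S qF)

/-- The memoryless strategy that decreases the rank. -/
noncomputable def rankStrategy : S.Strategy where
  next _ c := S.pick qF c
  next_valid _ _ _ h := step_pick h

/-- Player P cooperates by using `pick` as well. While `qF` is avoided, the rank plus the elapsed
time is at most `N`, and the rank is positive, so `qF` appears in time. -/
lemma exists_outcome_rankStrategy {N : ℕ} (hN : S.winSet qF = S.winLevel qF N)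
    {c : Config Q d} (hc : c ∈ S.winSet qF) :
    ∃ ω ∈ S.Outcome c (S.rankStrategy qF), ∃ i ≤ N, (ω i).state = qF ∧
      (∀ j ≤ i, ω j ∈ S.winSet qF) ∧
      ∀ j < i, (ω j).state ∉ S.Q₁ → ∀ c', VStep S.T (ω j) c' → c' ∈ S.winSet qF := by
  classical
  set ω : ℕ → Config Q d := fun k => (S.pick qF)^[k] c with hω
  have hs : ∀ k, ω (k + 1) = S.pick qF (ω k) := fun k => Function.iterate_succ_apply' _ _ _
  have key : ∀ j, (∀ i < j, (ω i).state ≠ qF) →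
      ω j ∈ S.winSet qF ∧ S.winRank qF (ω j) + j ≤ N := by
    intro j
    induction j with
    | zero => exact fun _ => ⟨hc, winRank_le (hN ▸ hc)⟩
    | succ j ih =>
      intro h
      obtain ⟨h1, h2⟩ := ih fun i hi => h i (by omega)
      obtain ⟨-, h3, h4⟩ := rankStep_pick h1 (h j (by omega))
      rw [hs]
      exact ⟨h3, by omega⟩
  have hex : ∃ i, (ω i).state = qF := by
    by_contra! h
    obtain ⟨h1, h2⟩ := key N fun i _ => h i
    have := winRank_pos h1
    omega
  refine ⟨ω, ⟨rfl, fun k => ⟨fun h => ?_, fun _ _ => hs k, fun h _ => hs k ▸ step_pick h⟩⟩,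
    Nat.find hex, ?_, Nat.find_spec hex, fun j hj => ?_, fun j hj hq => ?_⟩
  · rw [hs, pick_of_deadlock h]
  · have := (key (Nat.find hex) fun i hi => Nat.find_min hex hi).2
    omega
  · exact (key j fun i hi => Nat.find_min hex (by omega)).1
  · exact (exists_rankStep (key j fun i hi => Nat.find_min hex (by omega)).1
      (Nat.find_min hex hj)).2 hq

end Rank

/-! ### Geometric decay of the probability of avoiding the target -/

section AlmostSure

variable [Finite Q] (S : VASSMDP Q d) (qF : Q)

lemma lintegral_prob {x : Config Q d} (f : Config Q d → ℝ≥0∞) :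
    ∫⁻ y, f y ∂(S.prob x) =
      (∑ t ∈ S.enabled x, (S.τ t : ℝ≥0∞))⁻¹ * ∑ t ∈ S.enabled x, (S.τ t : ℝ≥0∞) * f (x.fire t) := by
  have hf : Measurable f := measurable_of_countable f
  simp [prob, lintegral_smul_measure, lintegral_finsetSum_measure, lintegral_dirac' _ hf]

/-- One step of the rank strategy decreases the expectation of the function `1 - η ^ rank`. -/
lemma lintegral_nextLaw_rankStrategy_le {W : ℕ} (hW : ∑ t ∈ S.T, S.τ t < W) {η : ℝ}
    (hη : η = 1 / (2 * W)) {x : Config Q d} (hx : x ∈ S.winSet qF) (hF : x.state ≠ qF)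
    (ρ : List (Config Q d)) (f : Config Q d → ℝ≥0∞)
    (hf : ∀ y ∈ S.winSet qF, f y ≤ ENNReal.ofReal (1 - η ^ S.winRank qF y)) :
    ∫⁻ y, f y ∂(S.nextLaw (S.rankStrategy qF) ρ x) ≤
      ENNReal.ofReal (1 - 2 * η ^ S.winRank qF x) := by
  have hW0 : (1 : ℝ) ≤ W := by exact_mod_cast (show 1 ≤ W by omega)
  have hη0 : 0 < η := by rw [hη]; positivity
  have hη2 : 2 * η ≤ 1 := by
    rw [hη]
    have : 2 * (1 / (2 * (W : ℝ))) = 1 / W := by field_simp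
    rw [this, div_le_one (by linarith)]
    exact hW0
  have hηW : 2 * η * W = 1 := by rw [hη]; field_simp
  have hfm : Measurable f := measurable_of_countable f
  obtain ⟨⟨z, hz⟩, hall⟩ := exists_rankStep hx hF
  have hd : ¬ VDeadlock S.T x := fun h => h z hz.1
  -- Each unit of rank costs a factor `1/η = 2W`. A successor of smaller rank has probability at
  -- least `1/W`, so it alone doubles the expected value of `η ^ rank`.
  have hpow : ∀ y, S.winRank qF y < S.winRank qF x →
      2 * W * η ^ S.winRank qF x ≤ η ^ S.winRank qF y := by
    intro y hy
    obtain ⟨n, hn⟩ := Nat.exists_eq_succ_of_ne_zero (Nat.ne_zero_of_lt hy)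
    rw [hn, pow_succ]
    have h1 : η ^ n ≤ η ^ S.winRank qF y :=
      pow_le_pow_of_le_one hη0.le (by linarith) (by omega)
    calc 2 * W * (η ^ n * η) = (2 * η * W) * η ^ n := by ring
      _ ≤ _ := by rw [hηW, one_mul]; exact h1
  rw [nextLaw, if_neg hd]
  split_ifs with hq
  · rw [lintegral_dirac' _ hfm]
    obtain ⟨-, h2, h3⟩ := rankStep_pick hx hF
    refine (hf _ h2).trans (ENNReal.ofReal_le_ofReal ?_)
    have h4 := hpow _ h3
    have h5 : 0 < η ^ S.winRank qF x := by positivity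
    change 1 - η ^ S.winRank qF (S.pick qF x) ≤ _
    nlinarith
  · rw [lintegral_prob]
    obtain ⟨⟨t₀, ht₀, hen₀, rfl⟩, hz1, hz2⟩ := hz
    have hmem : ∀ t ∈ S.enabled x, t ∈ S.T ∧ x.Enabled t := fun t ht => by
      simpa [enabled] using ht
    have ht₀' : t₀ ∈ S.enabled x := by simp [enabled, ht₀, hen₀]
    have hτ₀ : (1 : ℝ) ≤ S.τ t₀ := by
      exact_mod_cast S.τ_pos t₀ ht₀ (hen₀.1 ▸ hq)
    set s : ℝ := ∑ t ∈ S.enabled x, (S.τ t : ℝ) with hs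
    have hs1 : 1 ≤ s := hτ₀.trans
      (Finset.single_le_sum (f := fun t => (S.τ t : ℝ)) (fun t _ => by positivity) ht₀')
    have hsW : s ≤ W := by
      have : ∑ t ∈ S.enabled x, S.τ t ≤ ∑ t ∈ S.T, S.τ t :=
        Finset.sum_le_sum_of_subset (fun t ht => (hmem t ht).1)
      rw [hs]
      exact_mod_cast this.trans hW.le
    have hse : (∑ t ∈ S.enabled x, (S.τ t : ℝ≥0∞)) = ENNReal.ofReal s := by
      rw [hs, ENNReal.ofReal_sum_of_nonneg fun t _ => by positivity]
      simp
    have hle1 : ∀ n, (0 : ℝ) ≤ 1 - η ^ n := fun n => by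
      have := pow_le_one₀ hη0.le (by linarith : η ≤ 1) (n := n)
      linarith
    have hsum : ∑ t ∈ S.enabled x, (S.τ t : ℝ≥0∞) * f (x.fire t) ≤
        ENNReal.ofReal (∑ t ∈ S.enabled x, (S.τ t : ℝ) * (1 - η ^ S.winRank qF (x.fire t))) := by
      rw [ENNReal.ofReal_sum_of_nonneg fun t _ => mul_nonneg (by positivity) (hle1 _)]
      refine Finset.sum_le_sum fun t ht => ?_
      rw [ENNReal.ofReal_mul (by positivity), ENNReal.ofReal_natCast]
      gcongr
      exact hf _ (hall hq _ ⟨t, (hmem t ht).1, (hmem t ht).2, rfl⟩)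
    rw [hse, ← ENNReal.ofReal_inv_of_pos (by linarith)]
    refine (mul_le_mul_right hsum _).trans ?_
    rw [← ENNReal.ofReal_mul (by positivity)]
    refine ENNReal.ofReal_le_ofReal ?_
    have h1 : ∑ t ∈ S.enabled x, (S.τ t : ℝ) * (1 - η ^ S.winRank qF (x.fire t)) ≤
        s - η ^ S.winRank qF (x.fire t₀) := by
      simp only [mul_sub, mul_one, Finset.sum_sub_distrib]
      have h2 : η ^ S.winRank qF (x.fire t₀) ≤
          ∑ t ∈ S.enabled x, (S.τ t : ℝ) * η ^ S.winRank qF (x.fire t) :=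
        le_trans (le_mul_of_one_le_left (by positivity) hτ₀) (Finset.single_le_sum
          (f := fun t => (S.τ t : ℝ) * η ^ S.winRank qF (x.fire t))
          (fun t _ => by positivity) ht₀')
      linarith
    rw [inv_mul_le_iff₀ (by linarith)]
    have h3 := hpow _ hz2
    have h4 : 0 < η ^ S.winRank qF x := by positivity
    nlinarith [mul_le_mul_of_nonneg_right hsW h4.le]

/-- Let `G k` be `0` once `qF` has been seen and `1 - η ^ rank` before. Each step multiplies its
expectation by at most `l = 1 - η ^ N < 1`, while `G k ≥ 1/2` on plays that avoid `qF`. Markov's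
inequality then bounds the probability of avoidance by `2 * l ^ k` for every `k`. -/
theorem playMeasure_rankStrategy {N : ℕ} (hN : S.winSet qF = S.winLevel qF N)
    {c : Config Q d} (hc : c ∈ S.winSet qF) :
    S.playMeasure c (S.rankStrategy qF) (Reach d qF) = 1 := by
  classical
  set μ := S.playMeasure c (S.rankStrategy qF) with hμ
  set W : ℕ := ∑ t ∈ S.T, S.τ t + 1 with hWdef
  set η : ℝ := 1 / (2 * W) with hη
  have hW0 : (1 : ℝ) ≤ W := by exact_mod_cast (show 1 ≤ W by omega)
  have hη0 : 0 < η := by positivity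
  have hη2 : η ≤ 1 / 2 := by
    rw [hη]; exact one_div_le_one_div_of_le (by norm_num) (by linarith)
  have hηN : 0 < η ^ N := by positivity
  have hηN1 : η ^ N ≤ 1 := pow_le_one₀ hη0.le (by linarith)
  -- The value `⊤` outside the winning set avoids a separate proof that the play stays inside: there
  -- the estimate is trivial, provided `l ≠ 0`.
  set g : Config Q d → ℝ≥0∞ := fun x =>
    if x ∈ S.winSet qF then ENNReal.ofReal (1 - η ^ S.winRank qF x) else ⊤ with hg
  set G : ℕ → (ℕ → Config Q d) → ℝ≥0∞ := fun k ω =>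
    if ∃ i ≤ k, (ω i).state = qF then 0 else g (ω k) with hG
  set l : ℝ≥0∞ := ENNReal.ofReal (1 - η ^ N) with hl
  have hl0 : l ≠ 0 := by
    have h1 : 1 ≤ N := (winRank_pos hc).trans_le (winRank_le (hN ▸ hc))
    have h2 := pow_le_pow_of_le_one hη0.le (by linarith) h1
    rw [hl, Ne, ENNReal.ofReal_eq_zero]
    rw [pow_one] at h2
    linarith
  have hstep : ∀ k, ∫⁻ ω, G (k + 1) ω ∂μ ≤ l * ∫⁻ ω, G k ω ∂μ := by
    intro k
    set F : ((i : Finset.Iic k) → Config Q d) × Config Q d → ℝ≥0∞ := fun p =>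
      if (∃ i, (p.1 i).state = qF) ∨ p.2.state = qF then 0 else g p.2 with hFdef
    have h1 : ∀ ω : ℕ → Config Q d,
        G (k + 1) ω = F (Preorder.frestrictLe k ω, ω (k + 1)) := by
      intro ω
      have h2 : (∃ i ≤ k + 1, (ω i).state = qF) ↔
          (∃ i : Finset.Iic k, (Preorder.frestrictLe (π := fun _ => Config Q d) k ω i).state = qF) ∨
            (ω (k + 1)).state = qF := by
        constructor
        · rintro ⟨i, hi, h⟩
          rcases Nat.le_succ_iff.1 hi with h' | rfl
          exacts [.inl ⟨⟨i, Finset.mem_Iic.2 h'⟩, h⟩, .inr h]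
        · rintro (⟨i, h⟩ | h)
          exacts [⟨i, (Finset.mem_Iic.1 i.2).trans (by omega), h⟩, ⟨_, le_rfl, h⟩]
      simp only [hG, hFdef, h2]
    rw [lintegral_congr h1, hμ, S.lintegral_playMeasure_succ c _ k F, ← lintegral_const_mul' _ _ ENNReal.ofReal_ne_top]
    refine lintegral_mono fun ω => ?_
    by_cases hr : ∃ i ≤ k, (ω i).state = qF
    · have h3 : ∃ i : Finset.Iic k,
          (Preorder.frestrictLe (π := fun _ => Config Q d) k ω i).state = qF := by
        obtain ⟨i, hi, h⟩ := hr
        exact ⟨⟨i, Finset.mem_Iic.2 hi⟩, h⟩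
      have h4 : ∀ y, F (Preorder.frestrictLe k ω, y) = 0 := fun y => if_pos (.inl h3)
      simp only [h4, lintegral_zero]
      exact zero_le
    · have hF : (ω k).state ≠ qF := fun h => hr ⟨k, le_rfl, h⟩
      have hGk : G k ω = g (ω k) := by simp only [hG, if_neg hr]
      rw [hGk]
      by_cases hx : ω k ∈ S.winSet qF
      · refine (S.lintegral_nextLaw_rankStrategy_le qF (W := W) (by omega) hη hx hF _ _
          (fun y hy => ?_)).trans ?_
        · simp only [hFdef]
          split_ifs
          · exact zero_le
          · simp [hg, hy]
        · have h5 : η ^ N ≤ η ^ S.winRank qF (ω k) :=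
            pow_le_pow_of_le_one hη0.le (by linarith) (winRank_le (hN ▸ hx))
          simp only [hg, if_pos hx]
          rw [← ENNReal.ofReal_mul (by linarith)]
          refine ENNReal.ofReal_le_ofReal ?_
          -- With `r` the rank, `1 - 2η^r ≤ (1 - η^N)(1 - η^r)` because `η^N ≤ η^r`.
          nlinarith [pow_le_one₀ hη0.le (by linarith : η ≤ 1) (n := S.winRank qF (ω k)),
            mul_pos hηN (by positivity : 0 < η ^ S.winRank qF (ω k))]
      · rw [show g (ω k) = ⊤ from if_neg hx, ENNReal.mul_top hl0]
        exact le_top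
  have hbound : ∀ k, ∫⁻ ω, G k ω ∂μ ≤ l ^ k := by
    intro k
    induction k with
    | zero =>
      have h0 : ∀ᵐ ω ∂μ, G 0 ω ≤ 1 := by
        filter_upwards [S.playMeasure_zero c (S.rankStrategy qF)] with ω hω
        simp only [hG]
        split_ifs
        · exact zero_le
        · simp only [hω, hg, if_pos hc]
          rw [ENNReal.ofReal_le_one]
          have : 0 < η ^ S.winRank qF c := by positivity
          linarith
      calc _ ≤ ∫⁻ _, 1 ∂μ := lintegral_mono_ae h0
        _ = 1 := by simp
        _ ≤ _ := by simp
    | succ k ih =>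
      refine (hstep k).trans ?_
      rw [pow_succ']
      gcongr
  have hnull : μ {ω | ω ∉ Reach d qF} = 0 := by
    have h1 : ∀ k, μ {ω | ω ∉ Reach d qF} * ENNReal.ofReal (1 / 2) ≤ l ^ k := by
      intro k
      refine le_trans ?_ (hbound k)
      rw [mul_comm]
      refine (mul_le_mul_right (measure_mono fun ω hω => ?_) _).trans
        (mul_meas_ge_le_lintegral₀ (f := G k) ?_ (ENNReal.ofReal (1 / 2)))
      · simp only [Reach, Set.mem_ofPred_eq, not_exists] at hω
        simp only [Set.mem_ofPred_eq, hG]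
        rw [if_neg (by rintro ⟨i, -, h⟩; exact hω i h)]
        simp only [hg]
        split_ifs with h
        · refine ENNReal.ofReal_le_ofReal ?_
          have := pow_le_pow_of_le_one hη0.le (by linarith : η ≤ 1) (winRank_pos h)
          simp at this
          linarith
        · exact le_top
      · have : G k = (fun p : ((i : Finset.Iic k) → Config Q d) =>
            if ∃ i, (p i).state = qF then 0 else g (p ⟨k, by simp⟩)) ∘
            (Preorder.frestrictLe (π := fun _ => Config Q d) k) := by
          funext ω
          have h2 : (∃ i ≤ k, (ω i).state = qF) ↔ ∃ i : Finset.Iic k,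
              (Preorder.frestrictLe (π := fun _ => Config Q d) k ω i).state = qF :=
            ⟨fun ⟨i, hi, h⟩ => ⟨⟨i, Finset.mem_Iic.2 hi⟩, h⟩,
              fun ⟨i, h⟩ => ⟨i, Finset.mem_Iic.1 i.2, h⟩⟩
          simp only [hG, h2, Function.comp]
          rfl
        rw [this]
        exact ((measurable_of_countable _).comp (by fun_prop)).aemeasurable
    have hl1 : l < 1 := by
      rw [hl, ← ENNReal.ofReal_one, ENNReal.ofReal_lt_ofReal_iff one_pos]
      linarith
    have h2 := ge_of_tendsto' (ENNReal.tendsto_pow_atTop_nhds_zero_of_lt_one hl1) h1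
    simpa using h2
  rw [← prob_compl_eq_zero_iff]
  · exact hnull
  · have : Reach d qF = ⋃ i, (fun ω : ℕ → Config Q d => ω i) ⁻¹' {x | x.state = qF} := by
      ext; simp [Reach]
    rw [this]
    exact MeasurableSet.iUnion fun i => measurable_pi_apply i trivial

end AlmostSure

/-- The characterization of the almost surely winning configurations. -/
theorem IsOneVASSMDP.almostSureSet_eq_winSet [Fintype Q] [DecidableEq Q] {S : VASSMDP Q d}
    (hS : S.IsOneVASSMDP) (qF : Q) : S.almostSureSet qF = S.winSet qF := by
  obtain ⟨N, hN⟩ := hS.exists_winLevel_eq (qF := qF)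
  exact Set.Subset.antisymm (S.almostSureSet_subset_winSet qF) fun c hc =>
    ⟨S.rankStrategy qF, S.playMeasure_rankStrategy qF hN hc⟩

end VASSMDP

/-! ### Energy Büchi games with unknown initial credit -/

namespace EnergyGame

variable {N : Type*} {d : ℕ}

/-- An option of the opponent: whether choosing it is an accepting event, and the moves (a weight
and a target) among which the player chooses. -/
abbrev Choice (N : Type*) (d : ℕ) := Bool × Finset ((Fin d → ℤ) × N)

/-- A family of triples (node, credit, rank) in which the player can stay, keeping the credit
nonnegative and decreasing the rank between accepting events. -/
def IsWinFamily (A : N → Finset (Choice N d)) (X : N → (Fin d → ℕ) → ℕ → Prop) : Prop :=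
  ∀ n u k, X n u k → ∀ o ∈ A n, ∃ m ∈ o.2, ∃ (u' : Fin d → ℕ) (k' : ℕ),
    (∀ i, (u' i : ℤ) = u i + m.1 i) ∧ X m.2 u' k' ∧ (o.1 = false → k' < k)

/-- The player wins from some node with some initial credit. -/
def Winnable (A : N → Finset (Choice N d)) : Prop :=
  ∃ X, IsWinFamily A X ∧ ∃ n u k, X n u k

/-- For running two strategies at once: one moves while the other is parked with credit `v` and rank
`j`. -/
lemma IsWinFamily.shift {A : N → Finset (Choice N d)} {X : N → (Fin d → ℕ) → ℕ → Prop}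
    (hX : IsWinFamily A X) {n : N} {u : Fin d → ℕ} {k : ℕ} (h : X n u k) {o : Choice N d}
    (ho : o ∈ A n) (v : Fin d → ℕ) (j : ℕ) :
    ∃ m ∈ o.2, ∃ (u' : Fin d → ℕ) (k' : ℕ),
      (∀ i, ((u' + v) i : ℤ) = (u + v) i + m.1 i) ∧ X m.2 u' k' ∧
        (o.1 = false → k' + j < k + j) := by
  obtain ⟨m, hm, u', k', h1, h2, h3⟩ := hX n u k h o ho
  refine ⟨m, hm, u', k', fun i => ?_, h2, fun h => Nat.add_lt_add_right (h3 h) j⟩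
  have := h1 i
  simp only [Pi.add_apply, Nat.cast_add, this]
  ring

open Classical in
-- The two strategies run interleaved, one of them always parked at `n₀`. Whenever the play returns
-- to `n₀`, both are there, and the option picked by the opponent decides which one moves. Credits
-- and ranks add up, since each move alters only one summand.
lemma Winnable.of_split {A : N → Finset (Choice N d)} {n₀ : N} {A₁ A₂ : Finset (Choice N d)}
    (hA : A n₀ = A₁ ∪ A₂) (h₁ : Winnable (Function.update A n₀ A₁))
    (h₂ : Winnable (Function.update A n₀ A₂)) : Winnable A := by
  have single : ∀ {B X}, IsWinFamily (Function.update A n₀ B) X → (∀ u k, ¬ X n₀ u k) →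
      IsWinFamily A X := by
    intro B X hX hn n u k h o ho
    have hne : n ≠ n₀ := by rintro rfl; exact hn _ _ h
    exact hX n u k h o (by rwa [Function.update_of_ne hne])
  obtain ⟨X₁, hX₁, n₁, u₁, k₁, hw₁⟩ := h₁
  obtain ⟨X₂, hX₂, hw₂⟩ := h₂
  -- A family that never visits `n₀` does not notice the removed options and wins the full game
  -- alone.
  by_cases hc₁ : ∀ u k, ¬ X₁ n₀ u k
  · exact ⟨X₁, single hX₁ hc₁, n₁, u₁, k₁, hw₁⟩
  by_cases hc₂ : ∀ u k, ¬ X₂ n₀ u k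
  · exact ⟨X₂, single hX₂ hc₂, hw₂⟩
  push Not at hc₁ hc₂
  obtain ⟨v₁, j₁, hv₁⟩ := hc₁
  obtain ⟨v₂, j₂, hv₂⟩ := hc₂
  have mem : ∀ {n o}, o ∈ A n → n ≠ n₀ ∨ n = n₀ ∧ (o ∈ A₁ ∨ o ∈ A₂) := by
    intro n o ho
    by_cases h : n = n₀
    · subst h; rw [hA, Finset.mem_union] at ho; exact .inr ⟨rfl, ho⟩
    · exact .inl h
  refine ⟨fun n u k => ∃ u₁ k₁ u₂ k₂, u = u₁ + u₂ ∧ k = k₁ + k₂ ∧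
    (X₁ n u₁ k₁ ∧ X₂ n₀ u₂ k₂ ∨ X₁ n₀ u₁ k₁ ∧ X₂ n u₂ k₂), ?_,
    n₀, v₁ + v₂, j₁ + j₂, v₁, j₁, v₂, j₂, rfl, rfl, .inl ⟨hv₁, hv₂⟩⟩
  rintro n u k ⟨u₁, k₁, u₂, k₂, rfl, rfl, h⟩ o ho
  have left : ∀ n, X₁ n u₁ k₁ → X₂ n₀ u₂ k₂ → o ∈ Function.update A n₀ A₁ n →
      ∃ m ∈ o.2, ∃ (u' : Fin d → ℕ) (k' : ℕ), (∀ i, (u' i : ℤ) = (u₁ + u₂) i + m.1 i) ∧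
        (∃ u₁ k₁ u₂ k₂, u' = u₁ + u₂ ∧ k' = k₁ + k₂ ∧
          (X₁ m.2 u₁ k₁ ∧ X₂ n₀ u₂ k₂ ∨ X₁ n₀ u₁ k₁ ∧ X₂ m.2 u₂ k₂)) ∧
        (o.1 = false → k' < k₁ + k₂) := by
    intro n h1 h2 ho
    obtain ⟨m, hm, u', k', e1, e2, e3⟩ := hX₁.shift h1 ho u₂ k₂
    exact ⟨m, hm, u' + u₂, k' + k₂, e1, ⟨u', k', u₂, k₂, rfl, rfl, .inl ⟨e2, h2⟩⟩, e3⟩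
  have right : ∀ n, X₁ n₀ u₁ k₁ → X₂ n u₂ k₂ → o ∈ Function.update A n₀ A₂ n →
      ∃ m ∈ o.2, ∃ (u' : Fin d → ℕ) (k' : ℕ), (∀ i, (u' i : ℤ) = (u₁ + u₂) i + m.1 i) ∧
        (∃ u₁ k₁ u₂ k₂, u' = u₁ + u₂ ∧ k' = k₁ + k₂ ∧
          (X₁ m.2 u₁ k₁ ∧ X₂ n₀ u₂ k₂ ∨ X₁ n₀ u₁ k₁ ∧ X₂ m.2 u₂ k₂)) ∧
        (o.1 = false → k' < k₁ + k₂) := by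
    intro n h1 h2 ho
    obtain ⟨m, hm, u', k', e1, e2, e3⟩ := hX₂.shift h2 ho u₁ k₁
    refine ⟨m, hm, u₁ + u', k₁ + k', fun i => ?_, ⟨u₁, k₁, u', k', rfl, rfl, .inr ⟨h1, e2⟩⟩,
      fun h => ?_⟩
    · rw [add_comm u₁ u', add_comm u₁ u₂]; exact e1 i
    · rw [add_comm k₁, add_comm k₁]; exact e3 h
  rcases mem ho with hn | ⟨rfl, hmem⟩
  · rcases h with ⟨h1, h2⟩ | ⟨h1, h2⟩
    · exact left n h1 h2 (by rwa [Function.update_of_ne hn])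
    · exact right n h1 h2 (by rwa [Function.update_of_ne hn])
  · have h12 : X₁ n u₁ k₁ ∧ X₂ n u₂ k₂ := h.elim id id
    rcases hmem with hmem | hmem
    · exact left n h12.1 h12.2 (by rwa [Function.update_self])
    · exact right n h12.1 h12.2 (by rwa [Function.update_self])

open Classical in
/-- If the player does not win, then a memoryless strategy of the opponent shows it. -/
theorem exists_memoryless [Fintype N] (A : N → Finset (Choice N d)) (hne : ∀ n, (A n).Nonempty)
    (hA : ¬ Winnable A) : ∃ f : N → Choice N d, (∀ n, f n ∈ A n) ∧ ¬ Winnable fun n => {f n} := by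
  induction hs : ∑ n, (A n).card using Nat.strong_induction_on generalizing A with
  | _ s ih =>
    by_cases h1 : ∀ n, (A n).card = 1
    · choose f hf using fun n => Finset.card_eq_one.1 (h1 n)
      refine ⟨f, fun n => by simp [hf], ?_⟩
      rwa [show (fun n => {f n}) = A from funext fun n => (hf n).symm]
    · push Not at h1
      obtain ⟨n₀, hn₀⟩ := h1
      obtain ⟨o, ho⟩ := hne n₀
      have key : ∀ B : Finset (Choice N d), B ⊂ A n₀ → B.Nonempty →
          ¬ Winnable (Function.update A n₀ B) →
          ∃ f : N → Choice N d, (∀ n, f n ∈ A n) ∧ ¬ Winnable fun n => {f n} := by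
        intro B hB hBne hw
        have hle : ∀ n, Function.update A n₀ B n ⊆ A n := by
          intro n
          by_cases h : n = n₀
          · subst h; rw [Function.update_self]; exact hB.1
          · rw [Function.update_of_ne h]
        have hlt : ∑ n, (Function.update A n₀ B n).card < ∑ n, (A n).card := by
          refine Finset.sum_lt_sum (fun n _ => Finset.card_le_card (hle n))
            ⟨n₀, Finset.mem_univ _, ?_⟩
          rw [Function.update_self]
          exact Finset.card_lt_card hB
        obtain ⟨f, hf, hf'⟩ := ih _ (hs ▸ hlt) (Function.update A n₀ B) (fun n => by
          by_cases h : n = n₀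
          · subst h; rwa [Function.update_self]
          · rw [Function.update_of_ne h]; exact hne n) hw rfl
        exact ⟨f, fun n => hle n (hf n), hf'⟩
      have hne' : ((A n₀).erase o).Nonempty := by
        rw [← Finset.card_pos, Finset.card_erase_of_mem ho]
        have := Finset.card_pos.2 (hne n₀)
        omega
      -- By `Winnable.of_split` the player must lose one of the two reduced games at `n₀`; each has
      -- fewer options in total, so the induction applies.
      by_cases hw : Winnable (Function.update A n₀ {o})
      · refine key _ (Finset.erase_ssubset ho) hne' fun hw' => hA (.of_split ?_ hw hw')
        rw [← Finset.insert_eq, Finset.insert_erase ho]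
      · refine key {o} ?_ (Finset.singleton_nonempty o) hw
        refine Finset.ssubset_iff_subset_ne.2 ⟨Finset.singleton_subset_iff.2 ho, fun h => hn₀ ?_⟩
        rw [← h, Finset.card_singleton]

/-! ### Walks in weighted graphs -/

/-- Edges: source, weight, target, and whether the edge is accepting. -/
abbrev Edge (N : Type*) (d : ℕ) := N × (Fin d → ℤ) × N × Bool

/-- `l` is a walk from `a` to `b` with edges in `E`. -/
def IsWalk (E : Finset (Edge N d)) : N → List (Edge N d) → N → Prop
  | a, [], b => a = b
  | a, e :: l, b => e ∈ E ∧ e.1 = a ∧ IsWalk E e.2.2.1 l b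

/-- The total weight of a walk. -/
def effect (l : List (Edge N d)) : Fin d → ℤ := (l.map fun e => e.2.1).sum

@[simp] lemma effect_nil : effect ([] : List (Edge N d)) = 0 := rfl

@[simp] lemma effect_cons (e : Edge N d) (l : List (Edge N d)) :
    effect (e :: l) = e.2.1 + effect l := by simp [effect]

@[simp] lemma effect_append (l l' : List (Edge N d)) :
    effect (l ++ l') = effect l + effect l' := by simp [effect]

/-- Some closed walk through an accepting edge has nonnegative total weight. -/
def HasAcceptingCycle (E : Finset (Edge N d)) : Prop :=
  ∃ e ∈ E, e.2.2.2 = true ∧ ∃ l, IsWalk E e.2.2.1 l e.1 ∧ 0 ≤ e.2.1 + effect l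

/-- The sum of the absolute values of the weights along a walk. -/
def cost (l : List (Edge N d)) (i : Fin d) : ℕ := (l.map fun e => (e.2.1 i).natAbs).sum

/-- The graph of the moves of the player when the opponent plays `f`. -/
noncomputable def graph [Fintype N] (f : N → Choice N d) : Finset (Edge N d) :=
  open Classical in
  Finset.univ.biUnion fun n => (f n).2.image fun m => (n, m.1, m.2, (f n).1)

lemma mem_graph [Fintype N] {f : N → Choice N d} {e : Edge N d} :
    e ∈ graph f ↔ (e.2.1, e.2.2.1) ∈ (f e.1).2 ∧ e.2.2.2 = (f e.1).1 := by
  obtain ⟨a, z, b, t⟩ := e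
  simp only [graph, Finset.mem_biUnion, Finset.mem_univ, Finset.mem_image, true_and,
    Prod.mk.injEq]
  constructor
  · rintro ⟨n, ⟨z', b'⟩, hm, rfl, rfl, rfl, rfl⟩
    exact ⟨hm, rfl⟩
  · rintro ⟨h, rfl⟩
    exact ⟨a, (z, b), h, rfl, rfl, rfl, rfl⟩

/-- The player circles forever. The rank is the length of the rest `w` of the walk back to the
accepting edge. The credit covers the cost of `w` and, after `w`, still that of a full round; a
round loses nothing, so this persists. -/
lemma winnable_of_hasAcceptingCycle [Fintype N] {f : N → Choice N d}
    (h : HasAcceptingCycle (graph f)) : Winnable fun n => {f n} := by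
  obtain ⟨e, he, hacc, l, hl, hnn⟩ := h
  refine ⟨fun n u k => ∃ w, IsWalk (graph f) n w e.1 ∧ k = w.length ∧
    (∀ i, cost w i ≤ u i) ∧ ∀ i, (cost (e :: l) i : ℤ) ≤ u i + effect w i, ?_,
    e.1, cost (e :: l), 0, [], rfl, rfl, by simp [cost], by simp⟩
  rintro n u k ⟨w, hw, rfl, h1, h2⟩ o ho
  obtain rfl := Finset.mem_singleton.1 ho
  have hcc : ∀ (a : Edge N d) w i, cost (a :: w) i = (a.2.1 i).natAbs + cost w i := fun a w i => by
    simp [cost]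
  cases w with
  | nil =>
    obtain rfl : n = e.1 := hw
    obtain ⟨hm, hb⟩ := mem_graph.1 he
    refine ⟨_, hm, fun i => (u i + e.2.1 i).toNat, l.length, fun i => ?_,
      ⟨l, hl, rfl, fun i => ?_, fun i => ?_⟩, fun h => by rw [← hb, hacc] at h; cases h⟩ <;>
    · have h3 := h2 i
      have h4 := hnn i
      simp only [effect_nil, Pi.zero_apply, hcc, Pi.add_apply] at h3 h4 ⊢
      omega
  | cons a w =>
    obtain ⟨ha, rfl, hw⟩ := hw
    obtain ⟨hm, hb⟩ := mem_graph.1 ha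
    refine ⟨_, hm, fun i => (u i + a.2.1 i).toNat, w.length, fun i => ?_,
      ⟨w, hw, rfl, fun i => ?_, fun i => ?_⟩, fun _ => by simp⟩ <;>
    · have h3 := h2 i
      have h4 := h1 i
      simp only [effect_cons, hcc, Pi.add_apply] at h3 h4 ⊢
      omega

end EnergyGame

/-! ### Farkas' lemma -/

/-- **Farkas' lemma** for finitely many linear functionals over an ordered field. -/
theorem exists_nonneg_combination_of_forall_nonpos {K V ι : Type*} [Field K] [LinearOrder K]
    [IsStrictOrderedRing K] [AddCommGroup V] [Module K V] (s : Finset ι) (a : ι → V →ₗ[K] K)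
    (b : V →ₗ[K] K) (h : ∀ x, (∀ i ∈ s, a i x ≤ 0) → b x ≤ 0) :
    ∃ u : ι → K, (∀ i, 0 ≤ u i) ∧ b = ∑ i ∈ s, u i • a i := by
  classical
  induction s using Finset.induction_on generalizing a b with
  | empty =>
    refine ⟨0, fun _ => le_rfl, LinearMap.ext fun x => ?_⟩
    have h1 := h x (by simp)
    have h2 := h (-x) (by simp)
    simp only [map_neg] at h2
    simp only [Finset.sum_empty, LinearMap.zero_apply]
    linarith
  | insert j s hj ih =>
    by_cases hs : ∀ x, (∀ i ∈ s, a i x ≤ 0) → b x ≤ 0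
    · obtain ⟨u, hu, rfl⟩ := ih a b hs
      refine ⟨Function.update u j 0, fun i => ?_, ?_⟩
      · by_cases hi : i = j
        · subst hi; simp
        · rw [Function.update_of_ne hi]; exact hu i
      · rw [Finset.sum_insert hj, Function.update_self, zero_smul, zero_add]
        refine Finset.sum_congr rfl fun i hi => ?_
        rw [Function.update_of_ne (by rintro rfl; exact hj hi)]
    push Not at hs
    obtain ⟨x₀, hx₀, hbx₀⟩ := hs
    have hj0 : 0 < a j x₀ := by
      by_contra hcon
      refine absurd (h x₀ fun i hi => ?_) (not_le.2 hbx₀)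
      rcases Finset.mem_insert.1 hi with rfl | hi
      exacts [not_lt.1 hcon, hx₀ i hi]
    -- Subtracting multiples of `a j` makes all functionals vanish at `x₀`. To check the hypothesis
    -- at `x`, shift `x` along `x₀` into the kernel of `a j`.
    obtain ⟨u, hu, hb⟩ := ih (fun i => a i - (a i x₀ / a j x₀) • a j)
      (b - (b x₀ / a j x₀) • a j) (fun x hx => by
        have h1 := h (x - (a j x / a j x₀) • x₀) (fun i hi => by
          rcases Finset.mem_insert.1 hi with rfl | hi
          · simp only [map_sub, map_smul, smul_eq_mul]
            rw [div_mul_cancel₀ _ hj0.ne', sub_self]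
          · have := hx i hi
            simp only [LinearMap.sub_apply, LinearMap.smul_apply, smul_eq_mul] at this
            simp only [map_sub, map_smul, smul_eq_mul]
            rw [div_mul_comm] at this
            exact this)
        simp only [map_sub, map_smul, smul_eq_mul] at h1
        simp only [LinearMap.sub_apply, LinearMap.smul_apply, smul_eq_mul]
        rw [div_mul_comm]
        exact h1)
    -- The coefficient of `a j` is nonnegative because `b x₀ > 0` while every `a i x₀` with `i ∈ s`
    -- is at most `0`.
    have hle : ∑ i ∈ s, u i * (a i x₀ / a j x₀) ≤ 0 :=
      Finset.sum_nonpos fun i hi => mul_nonpos_of_nonneg_of_nonpos (hu i)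
        (div_nonpos_of_nonpos_of_nonneg (hx₀ i hi) hj0.le)
    refine ⟨Function.update u j (b x₀ / a j x₀ - ∑ i ∈ s, u i * (a i x₀ / a j x₀)),
      fun i => ?_, ?_⟩
    · by_cases hi : i = j
      · subst hi
        rw [Function.update_self]
        have := div_pos hbx₀ hj0
        linarith
      · rw [Function.update_of_ne hi]; exact hu i
    · rw [Finset.sum_insert hj, Function.update_self]
      have h2 : ∑ i ∈ s, Function.update u j
          (b x₀ / a j x₀ - ∑ i ∈ s, u i * (a i x₀ / a j x₀)) i • a i = ∑ i ∈ s, u i • a i :=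
        Finset.sum_congr rfl fun i hi => by
          rw [Function.update_of_ne (by rintro rfl; exact hj hi)]
      rw [h2]
      ext x
      have hx := LinearMap.congr_fun hb x
      simp only [LinearMap.sub_apply, LinearMap.smul_apply, LinearMap.sum_apply, smul_eq_mul,
        mul_sub, Finset.sum_sub_distrib, LinearMap.add_apply, sub_mul, Finset.sum_mul] at hx ⊢
      simp only [← mul_assoc] at hx ⊢
      linarith

namespace EnergyGame

variable {N : Type*} {d : ℕ}

/-! ### Closed walks from circulations -/

lemma isWalk_append {E : Finset (Edge N d)} {l l' : List (Edge N d)} {a b : N} :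
    IsWalk E a (l ++ l') b ↔ ∃ c, IsWalk E a l c ∧ IsWalk E c l' b := by
  induction l generalizing a with
  | nil => simp [IsWalk]
  | cons e l ih => simp [IsWalk, ih, and_assoc]

lemma IsWalk.mem {E : Finset (Edge N d)} {l : List (Edge N d)} {a b : N} (h : IsWalk E a l b) :
    ∀ e ∈ l, e ∈ E := by
  induction l generalizing a with
  | nil => simp
  | cons e l ih =>
    intro g hg
    rcases List.mem_cons.1 hg with rfl | hg
    exacts [h.1, ih h.2.2 g hg]

lemma IsWalk.mono {E E' : Finset (Edge N d)} (hE : E ⊆ E') {l : List (Edge N d)} {a b : N}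
    (h : IsWalk E a l b) : IsWalk E' a l b := by
  induction l generalizing a with
  | nil => exact h
  | cons e l ih => exact ⟨hE h.1, h.2.1, ih h.2.2⟩

lemma IsWalk.balance {E : Finset (Edge N d)} {l : List (Edge N d)} {a b : N}
    (h : IsWalk E a l b) : (l : Multiset (Edge N d)).map (fun e => e.1) + {b} =
      (l : Multiset (Edge N d)).map (fun e => e.2.2.1) + {a} := by
  induction l generalizing a with
  | nil =>
    obtain rfl : a = b := h
    rfl
  | cons e l ih =>
    obtain ⟨-, rfl, h⟩ := h
    have := ih h
    rw [← Multiset.cons_coe, Multiset.map_cons, Multiset.map_cons, Multiset.cons_add, this,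
      Multiset.cons_add, ← Multiset.singleton_add, ← Multiset.singleton_add]
    abel

open Classical in
-- Greedy walk: as long as the current node is not `b`, the balance supplies an unused edge leaving
-- it, and removing that edge preserves the balance.
lemma exists_walk_of_balance {E : Finset (Edge N d)} (f : Multiset (Edge N d))
    (hf : ∀ e ∈ f, e ∈ E) {a b : N}
    (h : f.map (fun e => e.1) + {b} = f.map (fun e => e.2.2.1) + {a}) :
    ∃ l, IsWalk E a l b ∧ (l : Multiset (Edge N d)) ≤ f := by
  induction hs : f.card generalizing f a with
  | zero =>
    obtain rfl := Multiset.card_eq_zero.1 hs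
    exact ⟨[], by simpa [IsWalk] using h.symm, by simp⟩
  | succ s ih =>
    by_cases hab : a = b
    · exact ⟨[], hab, by simp⟩
    have ha : a ∈ f.map (fun e => e.1) + {b} := by rw [h]; simp
    simp only [Multiset.mem_add, Multiset.mem_singleton, hab, or_false, Multiset.mem_map] at ha
    obtain ⟨e, he, rfl⟩ := ha
    obtain ⟨f, rfl⟩ := Multiset.exists_cons_of_mem he
    obtain ⟨l, hl, hle⟩ := ih f (fun g hg => hf g (Multiset.mem_cons_of_mem hg)) (a := e.2.2.1) (by
      simp only [Multiset.map_cons] at h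
      simp only [← Multiset.singleton_add] at h
      refine add_left_cancel (a := {e.1}) ?_
      rw [← add_assoc, h]
      abel) (by simpa using hs)
    exact ⟨e :: l, ⟨hf e he, rfl, hl⟩, by
      rw [← Multiset.cons_coe]; exact Multiset.cons_le_cons e hle⟩

open Classical in
-- Hierholzer's argument: an unused edge lies on a closed walk of unused edges, which is spliced
-- into `w` at an edge with the same source. The remaining edges are balanced again.
lemma exists_closed_walk_add {E : Finset (Edge N d)} (f : Multiset (Edge N d))
    (hf : ∀ e ∈ f, e ∈ E) (hbal : f.map (fun e => e.1) = f.map (fun e => e.2.2.1)) {a : N}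
    {w : List (Edge N d)} (hw : IsWalk E a w a) (hcov : ∀ e ∈ f, ∃ g ∈ w, g.1 = e.1) :
    ∃ w', IsWalk E a w' a ∧ (w' : Multiset (Edge N d)) = w + f := by
  induction hs : f.card using Nat.strong_induction_on generalizing f w with
  | _ s ih =>
    rcases Multiset.empty_or_exists_mem f with rfl | ⟨e, he⟩
    · exact ⟨w, hw, by simp⟩
    have hcov' := hcov
    obtain ⟨f, rfl⟩ := Multiset.exists_cons_of_mem he
    obtain ⟨l, hl, hle⟩ := exists_walk_of_balance (E := E) f
      (fun g hg => hf g (Multiset.mem_cons_of_mem hg)) (a := e.2.2.1) (b := e.1) (by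
        simp only [Multiset.map_cons] at hbal
        simp only [← Multiset.singleton_add] at hbal
        rw [add_comm, hbal, add_comm])
    obtain ⟨f', rfl⟩ := Multiset.le_iff_exists_add.1 hle
    obtain ⟨g, hg, hge⟩ := hcov e he
    obtain ⟨w₁, w₂, rfl⟩ := List.append_of_mem hg
    obtain ⟨c, h1, h2⟩ := isWalk_append.1 hw
    have hce : c = e.1 := by rw [← hge]; exact h2.2.1.symm
    subst hce
    have hloop : IsWalk E e.1 (e :: l) e.1 := ⟨hf e he, rfl, hl⟩
    have hbal' : f'.map (fun e => e.1) = f'.map (fun e => e.2.2.1) := by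
      have h3 := hloop.balance
      have h4 : ((e :: l : List _) : Multiset (Edge N d)).map (fun e => e.1) =
        ((e :: l : List _) : Multiset (Edge N d)).map (fun e => e.2.2.1) := add_right_cancel h3
      rw [← Multiset.cons_add, Multiset.cons_coe, Multiset.map_add, Multiset.map_add, h4] at hbal
      exact add_left_cancel hbal
    obtain ⟨w', hw', heq⟩ := ih f'.card (by
        rw [← hs]; simp only [Multiset.card_cons, Multiset.card_add]; omega) f'
      (fun g hg => hf g (by simp [hg])) hbal' (w := w₁ ++ ((e :: l) ++ g :: w₂))
      (isWalk_append.2 ⟨e.1, h1, isWalk_append.2 ⟨e.1, hloop, h2⟩⟩)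
      (fun g' hg' => by
        obtain ⟨g'', h5, h6⟩ := hcov g' (by simp [hg'])
        refine ⟨g'', ?_, h6⟩
        simp only [List.mem_append, List.mem_cons] at h5 ⊢
        tauto) rfl
    refine ⟨w', hw', ?_⟩
    rw [heq]
    simp only [← Multiset.coe_add, ← Multiset.cons_coe, ← Multiset.singleton_add]
    abel

/-- `b` can be reached from `a`. -/
def Conn (E : Finset (Edge N d)) (a b : N) : Prop := ∃ l, IsWalk E a l b

lemma Conn.trans {E : Finset (Edge N d)} {a b c : N} (h : Conn E a b) (h' : Conn E b c) :
    Conn E a c := by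
  obtain ⟨l, hl⟩ := h
  obtain ⟨l', hl'⟩ := h'
  exact ⟨l ++ l', isWalk_append.2 ⟨b, hl, hl'⟩⟩

lemma Conn.edge {E : Finset (Edge N d)} {e : Edge N d} (he : e ∈ E) : Conn E e.1 e.2.2.1 :=
  ⟨[e], he, rfl, rfl⟩

lemma effect_eq_multiset_sum (l : List (Edge N d)) :
    effect l = ((l : Multiset (Edge N d)).map fun e => e.2.1).sum := by
  rw [Multiset.map_coe, Multiset.sum_coe, effect]

lemma map_sum_nsmul_singleton {α β : Type*} (E : Finset α) (x : α → ℕ) (φ : α → β) :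
    (∑ e ∈ E, x e • ({e} : Multiset α)).map φ = ∑ e ∈ E, x e • ({φ e} : Multiset β) := by
  rw [← Multiset.coe_mapAddMonoidHom, map_sum]
  simp [Multiset.map_nsmul]

open Classical in
/-- In a strongly connected graph, a positive circulation of nonnegative total weight yields a
closed walk of nonnegative total weight through all edges. -/
lemma hasAcceptingCycle_of_circulation {E : Finset (Edge N d)}
    (hconn : ∀ e ∈ E, ∀ g ∈ E, Conn E e.2.2.1 g.1) {e₀ : Edge N d} (he₀ : e₀ ∈ E)
    (hacc : e₀.2.2.2 = true) (x : Edge N d → ℕ) (hx : ∀ e ∈ E, 0 < x e)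
    (hbal : ∑ e ∈ E, x e • ({e.1} : Multiset N) = ∑ e ∈ E, x e • ({e.2.2.1} : Multiset N))
    (heff : 0 ≤ ∑ e ∈ E, x e • e.2.1) : HasAcceptingCycle E := by
  obtain ⟨w, hw, hcov⟩ : ∃ w, IsWalk E e₀.1 w e₀.1 ∧ ∀ e ∈ E, e ∈ w := by
    suffices h : ∀ L : List (Edge N d), (∀ e ∈ L, e ∈ E) →
        ∃ w, IsWalk E e₀.1 w e₀.1 ∧ ∀ e ∈ L, e ∈ w by
      obtain ⟨w, hw, h⟩ := h E.toList (fun e he => Finset.mem_toList.1 he)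
      exact ⟨w, hw, fun e he => h e (Finset.mem_toList.2 he)⟩
    intro L hL
    induction L with
    | nil => exact ⟨[], rfl, by simp⟩
    | cons e L ih =>
      obtain ⟨w, hw, h⟩ := ih fun g hg => hL g (List.mem_cons_of_mem _ hg)
      obtain ⟨l, hl⟩ := (Conn.edge he₀).trans (hconn e₀ he₀ e (hL e (by simp)))
      obtain ⟨l', hl'⟩ := hconn e (hL e (by simp)) e₀ he₀
      refine ⟨l ++ e :: l' ++ w, isWalk_append.2 ⟨e₀.1, isWalk_append.2
        ⟨e.1, hl, hL e (by simp), rfl, hl'⟩, hw⟩, fun g hg => ?_⟩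
      rcases List.mem_cons.1 hg with rfl | hg
      · simp
      · simp [h g hg]
  set F : Multiset (Edge N d) := ∑ e ∈ E, x e • ({e} : Multiset (Edge N d)) with hF
  have hcount : ∀ e ∈ E, 0 < F.count e := by
    intro e he
    rw [hF, Multiset.count_sum']
    refine lt_of_lt_of_le ?_ (Finset.single_le_sum (fun _ _ => Nat.zero_le _) he)
    simp [hx e he]
  have hFE : ∀ e ∈ F, e ∈ E := by
    intro e he
    rw [hF, Multiset.mem_sum] at he
    obtain ⟨g, hg, he⟩ := he
    have := Multiset.mem_of_mem_nsmul he
    rw [Multiset.mem_singleton] at this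
    exact this ▸ hg
  -- Every edge occurs at most `K` times in `w` and at least once in `F`, so `K • F` contains `w`;
  -- the balanced remainder is spliced in, and the total weight becomes `K` times that of the
  -- circulation.
  set K := w.length with hK
  have hwF : (w : Multiset (Edge N d)) ≤ K • F := by
    rw [Multiset.le_iff_count]
    intro e
    rw [Multiset.count_nsmul]
    by_cases he : e ∈ w
    · exact (Multiset.count_le_card e (w : Multiset (Edge N d))).trans
        (Nat.le_mul_of_pos_right _ (hcount e (hw.mem e he)))
    · rw [Multiset.count_eq_zero_of_notMem (by simpa using he)]; exact Nat.zero_le _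
  obtain ⟨f, hf⟩ := Multiset.le_iff_exists_add.1 hwF
  have hfE : ∀ e ∈ f, e ∈ E := fun e he => hFE e (by
    have : e ∈ K • F := by rw [hf]; exact Multiset.mem_add.2 (.inr he)
    exact Multiset.mem_of_mem_nsmul this)
  have hfbal : f.map (fun e => e.1) = f.map (fun e => e.2.2.1) := by
    have h1 := congrArg (Multiset.map fun e : Edge N d => e.1) hf
    have h2 := congrArg (Multiset.map fun e : Edge N d => e.2.2.1) hf
    have h3 := add_right_cancel hw.balance
    rw [Multiset.map_nsmul, hF, map_sum_nsmul_singleton, Multiset.map_add] at h1 h2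
    rw [hbal, h2, h3] at h1
    exact (add_left_cancel h1).symm
  obtain ⟨w', hw', heq⟩ := exists_closed_walk_add f hfE hfbal hw
    (fun e he => ⟨e, hcov e (hfE e he), rfl⟩)
  rw [← hf] at heq
  have hmem : e₀ ∈ w' := by
    have : e₀ ∈ (w : Multiset (Edge N d)) := hcov e₀ he₀
    have : e₀ ∈ (w' : Multiset (Edge N d)) := heq ▸ Multiset.mem_of_le hwF this
    exact this
  have heff' : 0 ≤ effect w' := by
    rw [effect_eq_multiset_sum, heq, Multiset.map_nsmul, Multiset.sum_nsmul, hF, map_sum_nsmul_singleton]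
    refine nsmul_nonneg ?_ K
    have : (∑ e ∈ E, x e • ({e.2.1} : Multiset (Fin d → ℤ))).sum = ∑ e ∈ E, x e • e.2.1 := by
      rw [← Multiset.coe_sumAddMonoidHom, map_sum]
      simp [Multiset.sum_nsmul]
    rw [this]
    exact heff
  obtain ⟨w₁, w₂, rfl⟩ := List.append_of_mem hmem
  obtain ⟨c, h1, -, rfl, h2⟩ := isWalk_append.1 hw'
  refine ⟨e₀, he₀, hacc, w₂ ++ w₁, isWalk_append.2 ⟨_, h2, h1⟩, ?_⟩
  have h3 : effect (w₁ ++ e₀ :: w₂) = e₀.2.1 + effect (w₂ ++ w₁) := by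
    simp only [effect_append, effect_cons]; abel
  rwa [h3] at heff'

end EnergyGame

/-! ### Affine potentials and lexicographic rankings -/

lemma exists_common_denominator {ι : Type*} (s : Finset ι) (r : ι → ℚ) :
    ∃ K : ℕ, 0 < K ∧ ∀ i ∈ s, ∃ z : ℤ, (K : ℚ) * r i = z := by
  refine ⟨∏ i ∈ s, (r i).den, Finset.prod_pos fun i _ => (r i).den_pos, fun i hi => ?_⟩
  obtain ⟨m, hm⟩ := Finset.dvd_prod_of_mem (fun i => (r i).den) hi
  refine ⟨m * (r i).num, ?_⟩
  rw [hm]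
  push_cast
  have := Rat.den_mul_eq_num (r i)
  rw [← this]
  ring

namespace EnergyGame

variable {N : Type*} {d : ℕ}

/-- The variation of the potential `u ↦ y · u + p` along an edge. -/
def variation (y : N → Fin d → ℕ) (p : N → ℕ) (e : Edge N d) : ℤ :=
  ∑ i, (y e.1 i : ℤ) * e.2.1 i + p e.2.2.1 - p e.1

/-- The variation along an edge as a linear functional of the potential. -/
def variationMap (e : Edge N d) : ((Fin d → ℚ) × (N → ℚ)) →ₗ[ℚ] ℚ where
  toFun x := ∑ i, x.1 i * e.2.1 i + x.2 e.2.2.1 - x.2 e.1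
  map_add' x x' := by
    simp only [Prod.fst_add, Prod.snd_add, Pi.add_apply, add_mul, Finset.sum_add_distrib]
    ring
  map_smul' r x := by
    simp only [Prod.smul_fst, Prod.smul_snd, Pi.smul_apply, smul_eq_mul, RingHom.id_apply,
      mul_sub, mul_add, Finset.mul_sum, mul_assoc]

open Classical in
/-- Either some potential decreases strictly along `e₀` and nowhere increases, or some circulation
of nonnegative total weight is positive on `e₀`. -/
lemma potential_or_circulation (E : Finset (Edge N d)) {e₀ : Edge N d} (he₀ : e₀ ∈ E) :
    (∃ x : (Fin d → ℚ) × (N → ℚ), (∀ i, 0 ≤ x.1 i) ∧ (∀ e ∈ E, variationMap e x ≤ 0) ∧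
      variationMap e₀ x < 0) ∨
    ∃ u : Edge N d → ℚ, (∀ e, 0 ≤ u e) ∧ 0 < u e₀ ∧
      (∀ n, ∑ e ∈ E, u e * (if e.1 = n then 1 else 0) =
        ∑ e ∈ E, u e * (if e.2.2.1 = n then 1 else 0)) ∧
      ∀ i, 0 ≤ ∑ e ∈ E, u e * e.2.1 i := by
  refine or_iff_not_imp_left.2 fun hno => ?_
  push Not at hno
  -- The functionals on the right component encode the constraint that the coefficients of the
  -- potential are nonnegative.
  let a : Edge N d ⊕ Fin d → ((Fin d → ℚ) × (N → ℚ)) →ₗ[ℚ] ℚ :=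
    Sum.elim variationMap fun i => -(LinearMap.proj i ∘ₗ LinearMap.fst ℚ _ _)
  obtain ⟨u, hu, heq⟩ := exists_nonneg_combination_of_forall_nonpos
    (E.disjSum (Finset.univ : Finset (Fin d))) a (-variationMap e₀) (fun x hx => by
      rw [LinearMap.neg_apply, neg_nonpos]
      refine hno x (fun i => ?_) (fun e he => hx (.inl e) (by simp [he]))
      have := hx (.inr i) (by simp)
      simpa [a] using this)
  have hval : ∀ x : (Fin d → ℚ) × (N → ℚ),
      ∑ e ∈ E, (u (.inl e) + if e = e₀ then 1 else 0) * variationMap e x =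
        ∑ i, u (.inr i) * x.1 i := by
    intro x
    have h1 := LinearMap.congr_fun heq x
    simp only [Finset.sum_disjSum, LinearMap.neg_apply, LinearMap.add_apply, LinearMap.sum_apply,
      LinearMap.smul_apply, smul_eq_mul, a, Sum.elim_inl, Sum.elim_inr, LinearMap.comp_apply,
      LinearMap.proj_apply, LinearMap.fst_apply, mul_neg, Finset.sum_neg_distrib] at h1
    simp only [add_mul, Finset.sum_add_distrib, ite_mul, one_mul, zero_mul]
    rw [Finset.sum_ite_eq' E e₀, if_pos he₀]
    linarith
  -- Moving the term of `e₀` across the Farkas identity adds `1` to its coefficient, which makes it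
  -- positive.
  refine ⟨fun e => u (.inl e) + if e = e₀ then 1 else 0, fun e => ?_, ?_, fun n => ?_,
    fun i => ?_⟩
  · have := hu (.inl e)
    dsimp only
    split_ifs <;> linarith
  · have := hu (.inl e₀)
    simp only [if_true]
    linarith
  -- Evaluating the identity at the unit vector of a node gives conservation there; at the unit
  -- vector of a counter it gives a nonnegative total weight.
  · have h := hval (0, Pi.single n 1)
    simp only [variationMap, LinearMap.coe_mk, AddHom.coe_mk, Pi.zero_apply, zero_mul, mul_zero,
      Finset.sum_const_zero, zero_add, Pi.single_apply, mul_sub, Finset.sum_sub_distrib] at h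
    exact (sub_eq_zero.1 h).symm
  · have h := hval (Pi.single i 1, 0)
    simp only [variationMap, LinearMap.coe_mk, AddHom.coe_mk, Pi.zero_apply, Pi.single_apply,
      ite_mul, one_mul, zero_mul, Finset.sum_ite_eq', Finset.mem_univ, if_true, add_zero,
      sub_zero, mul_ite, mul_one, mul_zero] at h
    exact h.symm ▸ hu (.inr i)

lemma HasAcceptingCycle.mono {E E' : Finset (Edge N d)} (hE : E ⊆ E') (h : HasAcceptingCycle E) :
    HasAcceptingCycle E' := by
  obtain ⟨e, he, hacc, l, hl, hnn⟩ := h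
  exact ⟨e, hE he, hacc, l, hl.mono hE, hnn⟩

open Classical in
-- If no edge admits a potential decreasing on it, duality gives each edge a circulation positive on
-- that edge. Their sum is positive everywhere and, with denominators cleared, produces a forbidden
-- cycle.
lemma exists_potential_of_connected [Fintype N] {E : Finset (Edge N d)}
    (hconn : ∀ e ∈ E, ∀ g ∈ E, Conn E e.2.2.1 g.1) {e₀ : Edge N d} (he₀ : e₀ ∈ E)
    (hacc : e₀.2.2.2 = true) (h : ¬ HasAcceptingCycle E) :
    ∃ (y : Fin d → ℕ) (p : N → ℤ),
      (∀ e ∈ E, ∑ i, (y i : ℤ) * e.2.1 i + p e.2.2.1 - p e.1 ≤ 0) ∧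
        ∃ e ∈ E, ∑ i, (y i : ℤ) * e.2.1 i + p e.2.2.1 - p e.1 < 0 := by
  by_cases hx : ∃ e₁ ∈ E, ∃ x : (Fin d → ℚ) × (N → ℚ), (∀ i, 0 ≤ x.1 i) ∧
      (∀ e ∈ E, variationMap e x ≤ 0) ∧ variationMap e₁ x < 0
  · obtain ⟨e₁, he₁, ⟨a, b⟩, h1, h2, h3⟩ := hx
    obtain ⟨K, hK, hKz⟩ := exists_common_denominator (Finset.univ : Finset (Fin d ⊕ N))
      (Sum.elim a b)
    have hKa : ∀ i, ∃ m : ℕ, (m : ℚ) = K * a i := by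
      intro i
      obtain ⟨z, hz⟩ := hKz (.inl i) (Finset.mem_univ _)
      have h0 : (0 : ℚ) ≤ z := by
        rw [← hz]; exact mul_nonneg (Nat.cast_nonneg _) (h1 i)
      have hz0 : 0 ≤ z := by exact_mod_cast h0
      refine ⟨z.toNat, ?_⟩
      have : ((z.toNat : ℤ) : ℚ) = z := by rw [Int.toNat_of_nonneg hz0]
      rw [Int.cast_natCast] at this
      rw [this, ← hz]
      rfl
    have hKb : ∀ n, ∃ z : ℤ, (z : ℚ) = K * b n := fun n => by
      obtain ⟨z, hz⟩ := hKz (.inr n) (Finset.mem_univ _)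
      exact ⟨z, hz.symm⟩
    choose y hy using hKa
    choose p hp using hKb
    have hval : ∀ e : Edge N d,
        ((∑ i, (y i : ℤ) * e.2.1 i + p e.2.2.1 - p e.1 : ℤ) : ℚ) = K * variationMap e (a, b) := by
      intro e
      push_cast
      simp only [hy, hp, variationMap, LinearMap.coe_mk, AddHom.coe_mk, mul_sub, mul_add,
        Finset.mul_sum, mul_assoc]
    have hK0 : (0 : ℚ) < K := by exact_mod_cast hK
    refine ⟨y, p, fun e he => ?_, e₁, he₁, ?_⟩
    · have : ((∑ i, (y i : ℤ) * e.2.1 i + p e.2.2.1 - p e.1 : ℤ) : ℚ) ≤ 0 := by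
        rw [hval]; exact mul_nonpos_of_nonneg_of_nonpos hK0.le (h2 e he)
      exact_mod_cast this
    · have : ((∑ i, (y i : ℤ) * e₁.2.1 i + p e₁.2.2.1 - p e₁.1 : ℤ) : ℚ) < 0 := by
        rw [hval]; exact mul_neg_of_pos_of_neg hK0 h3
      exact_mod_cast this
  · exfalso
    push Not at hx
    have hcirc : ∀ g : E, _ := fun g => (potential_or_circulation E g.2).resolve_left (by
      rintro ⟨x, h1, h2, h3⟩
      exact absurd h3 (not_lt.2 (hx g.1 g.2 x h1 h2)))
    choose u hu0 hupos hubal hueff using hcirc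
    set v : Edge N d → ℚ := fun e => ∑ g : E, u g e with hv
    have hv0 : ∀ e, 0 ≤ v e := fun e => Finset.sum_nonneg fun g _ => hu0 g e
    have hvpos : ∀ e ∈ E, 0 < v e := fun e he =>
      (hupos ⟨e, he⟩).trans_le
        (Finset.single_le_sum (f := fun g : E => u g e) (fun g _ => hu0 g e) (Finset.mem_univ _))
    have hswap : ∀ φ : Edge N d → ℚ, ∑ e ∈ E, v e * φ e = ∑ g : E, ∑ e ∈ E, u g e * φ e := by
      intro φ
      simp only [hv, Finset.sum_mul]
      exact Finset.sum_comm
    obtain ⟨K, hK, hKz⟩ := exists_common_denominator E v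
    have hK0 : (0 : ℚ) < K := by exact_mod_cast hK
    have hnat : ∀ e, ∃ m : ℕ, e ∈ E → (m : ℚ) = K * v e := by
      intro e
      by_cases he : e ∈ E
      · obtain ⟨z, hz⟩ := hKz e he
        have h0 : (0 : ℚ) ≤ z := by
          rw [← hz]; exact mul_nonneg hK0.le (hv0 e)
        have hz0 : 0 ≤ z := by exact_mod_cast h0
        refine ⟨z.toNat, fun _ => ?_⟩
        have : ((z.toNat : ℤ) : ℚ) = z := by rw [Int.toNat_of_nonneg hz0]
        rw [Int.cast_natCast] at this
        rw [this, ← hz]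
      · exact ⟨0, fun h => absurd h he⟩
    choose x hxv using hnat
    have hsum : ∀ φ : Edge N d → ℚ, ∑ e ∈ E, (x e : ℚ) * φ e = K * ∑ e ∈ E, v e * φ e := by
      intro φ
      rw [Finset.mul_sum]
      exact Finset.sum_congr rfl fun e he => by rw [hxv e he, mul_assoc]
    refine h (hasAcceptingCycle_of_circulation hconn he₀ hacc x (fun e he => ?_) ?_ fun i => ?_)
    · have : (0 : ℚ) < x e := by rw [hxv e he]; exact mul_pos hK0 (hvpos e he)
      exact_mod_cast this
    · ext n
      rw [Multiset.count_sum', Multiset.count_sum']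
      simp only [Multiset.count_nsmul, Multiset.count_singleton]
      have h1 : ∑ e ∈ E, (x e : ℚ) * (if e.1 = n then 1 else 0) =
          ∑ e ∈ E, (x e : ℚ) * (if e.2.2.1 = n then 1 else 0) := by
        rw [hsum, hsum, hswap, hswap]
        simp only [hubal]
      have h2 : ((∑ e ∈ E, x e * (if n = e.1 then 1 else 0) : ℕ) : ℚ) =
          ((∑ e ∈ E, x e * (if n = e.2.2.1 then 1 else 0) : ℕ) : ℚ) := by
        push_cast
        simpa only [eq_comm (a := n)] using h1
      exact_mod_cast h2
    · have h1 : (0 : ℚ) ≤ ∑ e ∈ E, (x e : ℚ) * e.2.1 i := by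
        rw [hsum, hswap]
        exact mul_nonneg hK0.le (Finset.sum_nonneg fun g _ => hueff g i)
      rw [Pi.zero_apply, Finset.sum_apply]
      simp only [Pi.smul_apply, nsmul_eq_mul]
      exact_mod_cast h1

open Classical in
-- If some edge lies on no cycle, the indicator of the nodes not reachable from its target drops
-- along it and never rises. Otherwise reachability is symmetric, and the connected case applies to
-- the component of `e₀`, with zero potential elsewhere.
lemma exists_potential [Fintype N] {E : Finset (Edge N d)} {e₀ : Edge N d} (he₀ : e₀ ∈ E)
    (hacc : e₀.2.2.2 = true) (h : ¬ HasAcceptingCycle E) :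
    ∃ (y : N → Fin d → ℕ) (p : N → ℕ),
      (∀ e ∈ E, y e.1 = y e.2.2.1 ∧ variation y p e ≤ 0) ∧ ∃ e ∈ E, variation y p e < 0 := by
  by_cases hall : ∀ e ∈ E, Conn E e.2.2.1 e.1
  · have hsymm : ∀ {a b}, Conn E a b → Conn E b a := by
      rintro a b ⟨l, hl⟩
      induction l generalizing a with
      | nil => obtain rfl : a = b := hl; exact ⟨[], rfl⟩
      | cons e l ih =>
        obtain ⟨he, rfl, hl⟩ := hl
        exact (ih hl).trans (hall e he)
    set F := E.filter fun e => Conn E e₀.1 e.1 with hF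
    have hlift : ∀ {a b l}, IsWalk E a l b → Conn E e₀.1 a → IsWalk F a l b := by
      intro a b l hl ha
      induction l generalizing a with
      | nil => exact hl
      | cons e l ih =>
        obtain ⟨he, rfl, hl⟩ := hl
        exact ⟨Finset.mem_filter.2 ⟨he, ha⟩, rfl, ih hl (ha.trans (.edge he))⟩
    have hconn : ∀ e ∈ F, ∀ g ∈ F, Conn F e.2.2.1 g.1 := by
      intro e he g hg
      obtain ⟨he, he'⟩ := Finset.mem_filter.1 he
      obtain ⟨hg, hg'⟩ := Finset.mem_filter.1 hg
      obtain ⟨l, hl⟩ := ((hall e he).trans (hsymm he')).trans hg'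
      exact ⟨l, hlift hl (he'.trans (.edge he))⟩
    obtain ⟨y, p, hle, e₁, he₁, hlt⟩ := exists_potential_of_connected hconn
      (Finset.mem_filter.2 ⟨he₀, ⟨[], rfl⟩⟩) hacc fun h' => h (h'.mono (Finset.filter_subset _ _))
    obtain ⟨M, hM⟩ : ∃ M : ℕ, ∀ n, 0 ≤ p n + M := by
      refine ⟨∑ n, (p n).natAbs, fun n => ?_⟩
      have := Finset.single_le_sum (f := fun n => (p n).natAbs) (fun _ _ => Nat.zero_le _)
        (Finset.mem_univ n)
      omega
    set y' : N → Fin d → ℕ := fun n => if Conn E e₀.1 n then y else 0 with hy'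
    set p' : N → ℕ := fun n => if Conn E e₀.1 n then (p n + M).toNat else 0 with hp'
    have hin : ∀ e ∈ F, variation y' p' e = ∑ i, (y i : ℤ) * e.2.1 i + p e.2.2.1 - p e.1 := by
      intro e he
      obtain ⟨he, hc⟩ := Finset.mem_filter.1 he
      simp only [variation, hy', hp', if_pos hc, if_pos (hc.trans (.edge he)),
        Int.toNat_of_nonneg (hM _)]
      ring
    refine ⟨y', p', fun e he => ?_, e₁, (Finset.mem_filter.1 he₁).1, (hin e₁ he₁).trans_lt hlt⟩
    have hiff : Conn E e₀.1 e.1 ↔ Conn E e₀.1 e.2.2.1 :=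
      ⟨fun h => h.trans (.edge he), fun h => h.trans (hall e he)⟩
    refine ⟨by simp only [hy', hiff], ?_⟩
    by_cases hc : Conn E e₀.1 e.1
    · have hmem : e ∈ F := Finset.mem_filter.2 ⟨he, hc⟩
      exact (hin e hmem).trans_le (hle e hmem)
    · simp [variation, hy', hp', if_neg hc, if_neg (fun h => hc (hiff.2 h))]
  · push Not at hall
    obtain ⟨e₁, he₁, hne⟩ := hall
    refine ⟨0, fun n => if Conn E e₁.2.2.1 n then 0 else 1, fun e he => ⟨rfl, ?_⟩, e₁, he₁, ?_⟩
    · simp only [variation, Pi.zero_apply, Nat.cast_zero, zero_mul, Finset.sum_const_zero, zero_add]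
      by_cases hc : Conn E e₁.2.2.1 e.1
      · simp [hc, hc.trans (.edge he)]
      · rw [if_neg hc]
        split_ifs <;> simp
    · have h0 : Conn E e₁.2.2.1 e₁.2.2.1 := ⟨[], rfl⟩
      simp [variation, hne, h0]

/-- A graph without accepting closed walk of nonnegative weight has a lexicographic ranking by
affine functions that decreases strictly along accepting edges. -/
theorem exists_lexRanking [Fintype N] (E : Finset (Edge N d)) (h : ¬ HasAcceptingCycle E) :
    ∃ (m : ℕ) (Y : ℕ → N → Fin d → ℕ) (P : ℕ → N → ℕ), ∀ e ∈ E, ∃ j ≤ m,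
      (∀ i < j, Y i e.1 = Y i e.2.2.1 ∧ variation (Y i) (P i) e = 0) ∧
      (j < m ∧ Y j e.1 = Y j e.2.2.1 ∧ variation (Y j) (P j) e < 0 ∨ j = m ∧ e.2.2.2 = false) := by
  classical
  induction hs : E.card using Nat.strong_induction_on generalizing E with
  | _ s ih =>
    by_cases hacc : ∃ e ∈ E, e.2.2.2 = true
    · obtain ⟨e₀, he₀, hacc⟩ := hacc
      obtain ⟨y, p, hle, e₁, he₁, hlt⟩ := exists_potential he₀ hacc h
      -- Edges with strict decrease are settled by this component of the ranking; the others form a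
      -- smaller graph, ranked by the later components.
      set F := E.filter fun e => variation y p e = 0 with hF
      have hFE : F ⊂ E := by
        refine Finset.filter_ssubset.2 ⟨e₁, he₁, hlt.ne⟩
      obtain ⟨m, Y, P, hYP⟩ := ih F.card (hs ▸ Finset.card_lt_card hFE) F
        (fun h' => h (h'.mono hFE.1)) rfl
      refine ⟨m + 1, fun i => Nat.casesOn i y Y, fun i => Nat.casesOn i p P, fun e he => ?_⟩
      obtain ⟨h1, h2⟩ := hle e he
      rcases h2.lt_or_eq with h2 | h2
      · exact ⟨0, Nat.zero_le _, by simp, .inl ⟨Nat.succ_pos _, h1, h2⟩⟩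
      · obtain ⟨j, hj, h3, h4⟩ := hYP e (Finset.mem_filter.2 ⟨he, h2⟩)
        refine ⟨j + 1, Nat.succ_le_succ hj, fun i hi => ?_, ?_⟩
        · cases i with
          | zero => exact ⟨h1, h2⟩
          | succ i => exact h3 i (by omega)
        · rcases h4 with ⟨h4, h5, h6⟩ | ⟨rfl, h4⟩
          exacts [.inl ⟨Nat.succ_lt_succ h4, h5, h6⟩, .inr ⟨rfl, h4⟩]
    · push Not at hacc
      exact ⟨0, fun _ => 0, fun _ => 0, fun e he => ⟨0, le_rfl, by simp,
        .inr ⟨rfl, by simpa using hacc e he⟩⟩⟩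

end EnergyGame

/-! ### Certificates for configurations outside the winning set -/

namespace VASSMDP

open EnergyGame

variable {Q : Type*} {d : ℕ} {N : Type*}

/-- `c` lies in the downward closed set `x`: a control-state with exclusive bounds on the counters,
where the bound `0` stands for no bound. -/
def Covers (x : Q × (Fin d → ℕ)) (c : Config Q d) : Prop :=
  c.state = x.1 ∧ ∀ i, x.2 i = 0 ∨ c.count i < x.2 i

/-- Along the edge, the lexicographic ranking given by `m`, `Y`, `P` does not increase, and it
decreases if the edge is accepting. -/
def LexDecreases (m : ℕ) (Y : ℕ → N → Fin d → ℕ) (P : ℕ → N → ℕ) (e : Edge N d) : Prop :=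
  ∃ j ≤ m, (∀ i < j, Y i e.1 = Y i e.2.2.1 ∧ variation (Y i) (P i) e = 0) ∧
    (j < m ∧ Y j e.1 = Y j e.2.2.1 ∧ variation (Y j) (P j) e < 0 ∨ j = m ∧ e.2.2.2 = false)

/-- The transition `t` leads from `n` into `n'`. -/
def CertStep (loc : N → Q × (Fin d → ℕ)) (m : ℕ) (Y : ℕ → N → Fin d → ℕ) (P : ℕ → N → ℕ)
    (t : VTrans Q d) (n n' : N) (acc : Bool) : Prop :=
  t.2.2 = (loc n').1 ∧
  (∀ i, (loc n').2 i = 0 ∨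
    ((loc n).2 i ≠ 0 ∧ ((loc n).2 i : ℤ) + t.2.1 i ≤ (loc n').2 i)) ∧
  LexDecreases m Y P (n, t.2.1, n', acc)

/-- A strategy of Player P on the sets `loc n`, with a ranking that bounds the number of the
accepting moves. -/
def IsLosingCert (S : VASSMDP Q d) (qF : Q) (loc : N → Q × (Fin d → ℕ)) (m : ℕ)
    (Y : ℕ → N → Fin d → ℕ) (P : ℕ → N → ℕ) : Prop :=
  ∀ n, (loc n).1 ≠ qF ∧
    ((∀ t ∈ S.T, t.1 = (loc n).1 → (∀ i, (loc n).2 i = 0 ∨ 0 < ((loc n).2 i : ℤ) + t.2.1 i) →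
        ∃ n', CertStep loc m Y P t n n' false) ∨
      ((loc n).1 ∉ S.Q₁ ∧ ∃ t ∈ S.T, t.1 = (loc n).1 ∧ ∃ n', CertStep loc m Y P t n n' true))

/-- The value of the ranking. -/
def certRank (m : ℕ) (Y : ℕ → N → Fin d → ℕ) (P : ℕ → N → ℕ) (n : N) (v : Fin d → ℕ) :
    Lex (Fin m → ℕ) :=
  toLex fun j => ∑ i, Y j n i * v i + P j n

lemma CertStep.covers {loc : N → Q × (Fin d → ℕ)} {m : ℕ} {Y : ℕ → N → Fin d → ℕ}
    {P : ℕ → N → ℕ} {t : VTrans Q d} {n n' : N} {acc : Bool}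
    (h : CertStep loc m Y P t n n' acc) {c : Config Q d} (hc : Covers (loc n) c)
    (hen : c.Enabled t) : Covers (loc n') (c.fire t) := by
  refine ⟨h.1, fun i => ?_⟩
  have h1 := h.2.1 i
  have h2 := hc.2 i
  have h3 := hen.2 i
  simp only [Config.fire]
  omega

/-- The coefficients that matter agree at both ends of the edge, so the variations along it are the
actual changes of the affine functions when `t` is fired. -/
lemma CertStep.rank {loc : N → Q × (Fin d → ℕ)} {m : ℕ} {Y : ℕ → N → Fin d → ℕ}
    {P : ℕ → N → ℕ} {t : VTrans Q d} {n n' : N} {acc : Bool}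
    (h : CertStep loc m Y P t n n' acc) {c : Config Q d} (hen : c.Enabled t) :
    certRank m Y P n' (c.fire t).count < certRank m Y P n c.count ∨
      (certRank m Y P n' (c.fire t).count = certRank m Y P n c.count ∧ acc = false) := by
  obtain ⟨j, hj, h1, h2⟩ := h.2.2
  have hvar : ∀ i, Y i n = Y i n' →
      ((∑ k, Y i n' k * (c.fire t).count k + P i n' : ℕ) : ℤ) =
        (∑ k, Y i n k * c.count k + P i n : ℕ) + variation (Y i) (P i) (n, t.2.1, n', acc) := by
    intro i hi
    have hcount : ∀ k, ((c.fire t).count k : ℤ) = c.count k + t.2.1 k := fun k =>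
      Int.toNat_of_nonneg (hen.2 k)
    push_cast
    simp only [hcount, ← hi, variation, mul_add, Finset.sum_add_distrib]
    ring
  have heq : ∀ i < j, ∑ k, Y i n' k * (c.fire t).count k + P i n' =
      ∑ k, Y i n k * c.count k + P i n := by
    intro i hi
    have h3 := hvar i (h1 i hi).1
    rw [(h1 i hi).2, add_zero] at h3
    exact_mod_cast h3
  rcases h2 with ⟨hjm, h3, h4⟩ | ⟨rfl, h3⟩
  · refine .inl ⟨⟨j, hjm⟩, fun i hi => heq i hi, ?_⟩
    have h5 := hvar j h3
    change ∑ k, Y j n' k * (c.fire t).count k + P j n' < ∑ k, Y j n k * c.count k + P j n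
    omega
  · exact .inr ⟨funext fun i => heq i i.2, h3⟩

/-- An unforced step within a level either lowers the ranking or keeps it while lowering the level.
A forced step of Player P lowers the ranking, hence leaves `winSet` by induction, although
membership in a level puts all successors of a Player P configuration in `winSet`. -/
theorem IsLosingCert.notMem_winSet [Fintype Q] [DecidableEq Q] {S : VASSMDP Q d}
    (hS : S.IsOneVASSMDP) {qF : Q} {loc : N → Q × (Fin d → ℕ)} {m : ℕ} {Y : ℕ → N → Fin d → ℕ}
    {P : ℕ → N → ℕ} (h : IsLosingCert S qF loc m Y P) {n : N} {c : Config Q d}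
    (hc : Covers (loc n) c) : c ∉ S.winSet qF := by
  induction hr : certRank m Y P n c.count using WellFoundedLT.induction generalizing n c with
  | _ r ih =>
    subst hr
    rw [winSet_eq_iUnion, Set.mem_iUnion, not_exists]
    intro k
    -- All configurations of the same ranking value are treated together, so that steps keeping the
    -- value fall under the induction on the level.
    suffices hmain : ∀ k n' c', Covers (loc n') c' →
        certRank m Y P n' c'.count = certRank m Y P n c.count → c' ∉ S.winLevel qF k from
      hmain k n c hc rfl
    clear k
    intro k
    induction k with
    | zero => exact fun _ _ _ _ h => h
    | succ k ihk =>
      intro n₁ c₁ hc₁ hr₁ hmem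
      obtain ⟨hF, hopt⟩ := h n₁
      have key : ∀ t ∈ S.T, c₁.Enabled t → c₁.fire t ∈ S.winLevel qF k →
          c₁.fire t ∈ S.winSet qF → (∃ n', CertStep loc m Y P t n₁ n' false) → False := by
        rintro t ht hen h1 h2 ⟨n', hn'⟩
        rcases hn'.rank hen with h3 | ⟨h3, -⟩
        · exact ih _ (hr₁ ▸ h3) (hn'.covers hc₁ hen) rfl h2
        · exact ihk n' _ (hn'.covers hc₁ hen) (h3.trans hr₁) h1
      have hen' : ∀ t ∈ S.T, c₁.Enabled t →
          ∀ i, (loc n₁).2 i = 0 ∨ 0 < ((loc n₁).2 i : ℤ) + t.2.1 i := by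
        intro t _ hen i
        have h1 := hc₁.2 i
        have h2 := hen.2 i
        omega
      rcases hmem with h1 | ⟨h1, c', ⟨t, ht, hen, rfl⟩, h2, h3⟩ |
        ⟨h1, ⟨c', ⟨t, ht, hen, rfl⟩, h2⟩, h3⟩
      · exact hF (hc₁.1 ▸ h1)
      · rcases hopt with hopt | ⟨hopt, -⟩
        · exact key t ht hen h3 h2 (hopt t ht (hen.1.trans hc₁.1) (hen' t ht hen))
        · exact hopt (hc₁.1 ▸ h1)
      · rcases hopt with hopt | ⟨-, t', ht', hst, n', hn'⟩
        · exact key t ht hen h2 (S.winLevel_subset_winSet qF k h2)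
            (hopt t ht (hen.1.trans hc₁.1) (hen' t ht hen))
        · have hst' : t'.1 = c₁.state := hst.trans hc₁.1.symm
          have hz := hS.weight_eq_zero ht' (hst' ▸ h1)
          have hen₁ : c₁.Enabled t' := ⟨hst', fun i => by simp [hz]⟩
          rcases hn'.rank hen₁ with h4 | ⟨-, h4⟩
          · exact ih _ (hr₁ ▸ h4) (hn'.covers hc₁ hen₁) rfl (h3 _ ⟨t', ht', hen₁, rfl⟩)
          · cases h4

/-! ### Completeness of the certificates -/

lemma exists_bound_basis [Finite Q] (U : Set (Config Q d)) :
    ∃ M : ℕ, ∀ c ∈ U, ∃ b ∈ U, b ≤ c ∧ ∀ i, b.count i < M := by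
  obtain ⟨B, hB, hB'⟩ := exists_finset_basis U
  refine ⟨∑ b ∈ B, ∑ i, b.count i + 1, fun c hc => ?_⟩
  obtain ⟨b, hb, hle⟩ := hB' c hc
  refine ⟨b, hB b hb, hle, fun i => Nat.lt_succ_of_le ?_⟩
  exact (Finset.single_le_sum (f := b.count) (fun _ _ => Nat.zero_le _) (Finset.mem_univ i)).trans
    (Finset.single_le_sum (f := fun b : Config Q d => ∑ i, b.count i) (fun _ _ => Nat.zero_le _) hb)

/-- The largest configuration below the bounds `x`, when counters above `M` are irrelevant. -/
def topConfig (M : ℕ) (x : Q × (Fin d → ℕ)) : Config Q d :=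
  ⟨x.1, fun i => if x.2 i = 0 then M else x.2 i - 1⟩

/-- The bounds after firing `t`, where bounds above `M` are dropped. -/
def capFire (M : ℕ) (x : Q × (Fin d → ℕ)) (t : VTrans Q d) : Q × (Fin d → ℕ) :=
  (t.2.2, fun i => if x.2 i = 0 ∨ (M : ℤ) < x.2 i + t.2.1 i then 0 else (x.2 i + t.2.1 i).toNat)

/-- `t` is enabled in some configuration below the bounds `x`. -/
def CapEnabled (x : Q × (Fin d → ℕ)) (t : VTrans Q d) : Prop :=
  t.1 = x.1 ∧ ∀ i, x.2 i = 0 ∨ 0 < (x.2 i : ℤ) + t.2.1 i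

section Completeness

variable [Fintype Q] [DecidableEq Q] {S : VASSMDP Q d} {qF : Q} {M : ℕ}

/-- Winning configurations dominate winning ones with counters below `M`, so the value `M` is as
good as any in an unbounded coordinate, and one configuration decides whether the box meets the
winning set. -/
lemma topConfig_mem (hS : S.IsOneVASSMDP)
    (hM : ∀ c ∈ S.winSet qF, ∃ b ∈ S.winSet qF, b ≤ c ∧ ∀ i, b.count i < M)
    {x : Q × (Fin d → ℕ)} {c : Config Q d} (hc : Covers x c) (hw : c ∈ S.winSet qF) :
    topConfig M x ∈ S.winSet qF := by
  obtain ⟨b, hb, hle, hlt⟩ := hM c hw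
  refine hS.isUpperSet_winSet (a := b) ⟨hle.1.trans hc.1, fun i => ?_⟩ hb
  have h1 := hc.2 i
  have h2 : b.count i ≤ c.count i := hle.2 i
  have h3 := hlt i
  simp only [topConfig]
  split_ifs <;> omega

lemma topConfig_capFire_notMem (hS : S.IsOneVASSMDP)
    (hM : ∀ c ∈ S.winSet qF, ∃ b ∈ S.winSet qF, b ≤ c ∧ ∀ i, b.count i < M)
    {x : Q × (Fin d → ℕ)} (hx : topConfig M x ∉ S.winSet qF) (hq : x.1 ∈ S.Q₁)
    {t : VTrans Q d} (ht : t ∈ S.T) (hen : CapEnabled x t) :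
    topConfig M (capFire M x t) ∉ S.winSet qF := by
  intro hw
  obtain ⟨b, hb, hle, hlt⟩ := hM _ hw
  -- The surplus in the unbounded coordinates enables `t` and leaves at least `M` after firing it.
  set c : Config Q d := ⟨x.1, fun i => if x.2 i = 0 then M + (t.2.1 i).natAbs else x.2 i - 1⟩
    with hc
  have hcx : Covers x c := by
    refine ⟨rfl, fun i => ?_⟩
    simp only [hc]
    split_ifs with h
    · exact .inl h
    · right; omega
  have hcen : c.Enabled t := by
    refine ⟨hen.1, fun i => ?_⟩
    have := hen.2 i
    simp only [hc]
    split_ifs <;> omega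
  refine hx (topConfig_mem hS hM hcx (S.reachStep_winSet_subset qF
    (.inr (.inl ⟨hq, c.fire t, ⟨t, ht, hcen, rfl⟩, ?_⟩))))
  have hmem : c.fire t ∈ S.winSet qF := by
    refine hS.isUpperSet_winSet (a := b) ⟨hle.1, fun i => ?_⟩ hb
    have h1 : b.count i ≤ (topConfig M (capFire M x t)).count i := hle.2 i
    have h2 := hlt i
    have h3 := hen.2 i
    simp only [topConfig, capFire] at h1
    simp only [Config.fire, hc]
    split_ifs at h1 ⊢ <;> omega
  exact ⟨hmem, hmem⟩

omit [Fintype Q] [DecidableEq Q] in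
lemma capFire_of_weight_eq_zero {x : Q × (Fin d → ℕ)} (hx : ∀ i, x.2 i ≤ M) {t : VTrans Q d}
    (hz : t.2.1 = 0) : capFire M x t = (t.2.2, x.2) := by
  refine Prod.ext rfl (funext fun i => ?_)
  have := hx i
  simp only [capFire, hz, Pi.zero_apply, add_zero, Nat.cast_lt, Int.toNat_natCast]
  split_ifs <;> omega

variable (S qF M)

/-- The sets of configurations with bounds at most `M` that are disjoint from the winning set. -/
abbrev LosingNode : Type _ :=
  {x : Q × (Fin d → ℕ) // (∀ i, x.2 i ≤ M) ∧ topConfig M x ∉ S.winSet qF}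

instance : Finite (LosingNode S qF M) := by
  have : {x : Q × (Fin d → ℕ) | ∀ i, x.2 i ≤ M}.Finite := by
    refine (Set.finite_univ.prod (Set.finite_Iic fun _ : Fin d => M)).subset fun x hx => ?_
    exact ⟨Set.mem_univ _, hx⟩
  exact (this.subset fun x hx => hx.1 :
    {x : Q × (Fin d → ℕ) | (∀ i, x.2 i ≤ M) ∧ topConfig M x ∉ S.winSet qF}.Finite)

noncomputable instance : Fintype (LosingNode S qF M) := Fintype.ofFinite _

open Classical in
/-- The moves of the player that stay in losing nodes. -/
noncomputable def losingMoves (x : LosingNode S qF M) :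
    Finset ((Fin d → ℤ) × LosingNode S qF M) :=
  {m ∈ (S.T.image fun t => t.2.1) ×ˢ Finset.univ |
    ∃ t ∈ S.T, CapEnabled x.1 t ∧ t.2.1 = m.1 ∧ m.2.1 = capFire M x.1 t}

open Classical in
/-- The choices of Player P in the energy game on the losing nodes. -/
noncomputable def losingChoices (x : LosingNode S qF M) :
    Finset (Choice (LosingNode S qF M) d) :=
  -- A `false` option leaves the move to the player and requires a decrease of rank, as for the
  -- existential successor in `reachStep`. At a node of Player P it is offered only when no
  -- successor is winning. A `true` option forces one losing move and puts no condition on the rank,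
  -- matching the universal clause.
  if x.1.1 ∈ S.Q₁ then {(false, losingMoves S qF M x)}
  else if ∀ t ∈ S.T, t.1 = x.1.1 → topConfig M (capFire M x.1 t) ∉ S.winSet qF then
    insert (false, losingMoves S qF M x) ((losingMoves S qF M x).image fun m => (true, {m}))
  else (losingMoves S qF M x).image fun m => (true, {m})

variable {S qF M}

omit [Fintype Q] [DecidableEq Q] in
lemma capFire_le {x : Q × (Fin d → ℕ)} {t : VTrans Q d} (i : Fin d) :
    (capFire M x t).2 i ≤ M := by
  simp only [capFire]
  split_ifs <;> omega

lemma mem_losingMoves {x : LosingNode S qF M} {m : (Fin d → ℤ) × LosingNode S qF M} :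
    m ∈ losingMoves S qF M x ↔
      ∃ t ∈ S.T, CapEnabled x.1 t ∧ t.2.1 = m.1 ∧ m.2.1 = capFire M x.1 t := by
  simp only [losingMoves, Finset.mem_filter, Finset.mem_product, Finset.mem_image,
    Finset.mem_univ, and_true, and_iff_right_iff_imp]
  rintro ⟨t, ht, -, h, -⟩
  exact ⟨t, ht, h⟩

lemma IsOneVASSMDP.capEnabled (hS : S.IsOneVASSMDP) {x : Q × (Fin d → ℕ)} (hq : x.1 ∉ S.Q₁)
    {t : VTrans Q d} (ht : t ∈ S.T) (hst : t.1 = x.1) : CapEnabled x t := by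
  refine ⟨hst, fun i => ?_⟩
  rw [hS.weight_eq_zero ht (hst ▸ hq), Pi.zero_apply]
  omega

/-- If all successors of a Player P node were winning, and one existed, the top configuration of the
box would win too. -/
lemma losingChoices_nonempty (hS : S.IsOneVASSMDP) (x : LosingNode S qF M) :
    (losingChoices S qF M x).Nonempty := by
  classical
  rw [losingChoices]
  split_ifs with hq hall
  · exact Finset.singleton_nonempty _
  · exact Finset.insert_nonempty _ _
  · rw [Finset.image_nonempty]
    push Not at hall
    obtain ⟨t, ht, hst, hw⟩ := hall
    by_contra hemp
    rw [Finset.not_nonempty_iff_eq_empty] at hemp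
    have hall' : ∀ t ∈ S.T, t.1 = x.1.1 → topConfig M (t.2.2, x.1.2) ∈ S.winSet qF := by
      intro t ht hst
      by_contra hl
      have hz := hS.weight_eq_zero ht (hst ▸ hq)
      have hcap := capFire_of_weight_eq_zero x.2.1 hz
      have : (t.2.1, (⟨(t.2.2, x.1.2), x.2.1, hl⟩ : LosingNode S qF M)) ∈ losingMoves S qF M x :=
        mem_losingMoves.2 ⟨t, ht, hS.capEnabled hq ht hst, rfl, hcap.symm⟩
      rw [hemp] at this
      exact absurd this (Finset.notMem_empty _)
    have hfire : ∀ t ∈ S.T, t.1 = x.1.1 →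
        (topConfig M x.1).fire t = topConfig M (t.2.2, x.1.2) := by
      intro t ht hst
      have hz := hS.weight_eq_zero ht (hst ▸ hq)
      ext i
      · rfl
      · simp only [Config.fire, topConfig, hz, Pi.zero_apply, add_zero, Int.toNat_natCast]
    refine x.2.2 (S.reachStep_winSet_subset qF (.inr (.inr ⟨hq, ⟨_, ⟨t, ht, ⟨hst, fun i => ?_⟩,
      rfl⟩, ?_⟩, ?_⟩)))
    · rw [hS.weight_eq_zero ht (hst ▸ hq)]; simp
    · rw [hfire t ht hst]; exact hall' t ht hst
    · rintro c' ⟨t', ht', hen', rfl⟩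
      rw [hfire t' ht' hen'.1]; exact hall' t' ht' hen'.1

/-- The player cannot win the energy game on the losing nodes. -/
lemma not_winnable_losingChoices (hS : S.IsOneVASSMDP)
    (hM : ∀ c ∈ S.winSet qF, ∃ b ∈ S.winSet qF, b ≤ c ∧ ∀ i, b.count i < M) :
    ¬ Winnable (losingChoices S qF M) := by
  classical
  rintro ⟨X, hX, hne⟩
  -- Moves never restore a dropped bound. At nodes of the family with the fewest bounded counters,
  -- no bound can be dropped either, so the bounded counters are tracked exactly.
  let fin : LosingNode S qF M → Finset (Fin d) := fun x => {i | x.1.2 i ≠ 0}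
  obtain ⟨f₀, hf₀, hmin⟩ : ∃ f₀, (∃ x u k, X x u k ∧ (fin x).card = f₀) ∧
      ∀ x u k, X x u k → f₀ ≤ (fin x).card := by
    have hex : ∃ f, ∃ x u k, X x u k ∧ (fin x).card = f := by
      obtain ⟨x, u, k, h⟩ := hne
      exact ⟨_, x, u, k, h, rfl⟩
    exact ⟨Nat.find hex, Nat.find_spec hex, fun x u k h => Nat.find_min' hex ⟨x, u, k, h, rfl⟩⟩
  -- Bounded counters sit just below their strict bounds. Unbounded ones hold the credit plus `M`,
  -- which places the configuration above `topConfig`.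
  let Z : Config Q d → ℕ → Prop := fun c k => ∃ (x : LosingNode S qF M) (u : Fin d → ℕ),
    X x u k ∧ (fin x).card = f₀ ∧ c.state = x.1.1 ∧
      ∀ i, c.count i = if x.1.2 i = 0 then u i + M else x.1.2 i - 1
  have hcov : ∀ {c k}, Z c k → ∃ x : LosingNode S qF M, Covers x.1 c := by
    rintro c k ⟨x, u, -, -, h1, h2⟩
    refine ⟨x, h1, fun i => ?_⟩
    have := h2 i
    split_ifs at this <;> omega
  have hmove : ∀ {c : Config Q d} {k : ℕ} {x : LosingNode S qF M} {u : Fin d → ℕ} {t : VTrans Q d}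
      {y : LosingNode S qF M} {u' : Fin d → ℕ} {k' : ℕ}, (fin x).card = f₀ → c.state = x.1.1 →
      (∀ i, c.count i = if x.1.2 i = 0 then u i + M else x.1.2 i - 1) → X x u k →
      CapEnabled x.1 t → y.1 = capFire M x.1 t → (∀ i, (u' i : ℤ) = u i + t.2.1 i) →
      X y u' k' → c.Enabled t ∧ Z (c.fire t) k' := by
    intro c k x u t y u' k' hf hst hcount hXx hen hy hu' hXy
    have hsub : fin y ⊆ fin x := by
      intro i hi
      simp only [fin, Finset.mem_filter, Finset.mem_univ, true_and] at hi ⊢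
      rintro h0
      rw [hy] at hi
      simp [capFire, h0] at hi
    have hfy : fin y = fin x := Finset.eq_of_subset_of_card_le hsub (hf ▸ hmin y u' k' hXy)
    have hiff : ∀ i, y.1.2 i = 0 ↔ x.1.2 i = 0 := by
      intro i
      have := Finset.ext_iff.1 hfy i
      simp only [fin, Finset.mem_filter, Finset.mem_univ, true_and] at this
      exact not_iff_not.1 this
    have hen' : c.Enabled t := by
      refine ⟨hen.1.trans hst.symm, fun i => ?_⟩
      have h1 := hcount i
      have h2 := hu' i
      have h3 := hen.2 i
      split_ifs at h1 <;> omega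
    refine ⟨hen', y, u', hXy, hfy ▸ hf, by rw [hy]; rfl, fun i => ?_⟩
    have h1 := hcount i
    have h2 := hu' i
    have h3 := hen.2 i
    have h4 := hiff i
    simp only [Config.fire]
    by_cases h0 : x.1.2 i = 0
    · rw [if_pos (h4.2 h0)]
      rw [if_pos h0] at h1
      omega
    · rw [if_neg (fun h => h0 (h4.1 h))]
      rw [if_neg h0] at h1
      have h5 : y.1.2 i = (x.1.2 i + t.2.1 i).toNat := by
        have h6 : y.1.2 i = (capFire M x.1 t).2 i := by rw [hy]
        rw [h6]
        simp only [capFire] at h6 ⊢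
        split_ifs at h6 ⊢
        · exact absurd (h4.1 h6) h0
        · rfl
      omega
  have hmain : ∀ c k, Z c k → c ∈ S.winSet qF := by
    intro c k hc
    refine S.mem_winSet_of_ranked qF Z (fun c k hc => ?_) hc
    obtain ⟨x, u, hXx, hf, hst, hcount⟩ := hc
    have hfree : ∀ o ∈ losingChoices S qF M x, o = (false, losingMoves S qF M x) →
        ∃ c', VStep S.T c c' ∧ ∃ k' < k, Z c' k' := by
      rintro o ho rfl
      obtain ⟨m, hm, u', k', h1, h2, h3⟩ := hX x u k hXx _ ho
      obtain ⟨t, ht, hen, hz, hy⟩ := mem_losingMoves.1 hm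
      obtain ⟨h4, h5⟩ := hmove hf hst hcount hXx hen hy (fun i => by rw [hz]; exact h1 i) h2
      exact ⟨c.fire t, ⟨t, ht, h4, rfl⟩, k', h3 rfl, h5⟩
    by_cases hq : x.1.1 ∈ S.Q₁
    · obtain ⟨c', h1, h2⟩ := hfree _ (by rw [losingChoices, if_pos hq]; simp) rfl
      exact .inr (.inl ⟨hst ▸ hq, c', h1, .inr h2⟩)
    · have hwin : ∀ t ∈ S.T, t.1 = x.1.1 → topConfig M (capFire M x.1 t) ∈ S.winSet qF →
          c.fire t ∈ S.winSet qF := by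
        intro t ht hst' hw
        have hz := hS.weight_eq_zero ht (hst' ▸ hq)
        rw [capFire_of_weight_eq_zero x.2.1 hz] at hw
        refine hS.isUpperSet_winSet (a := topConfig M (t.2.2, x.1.2)) ⟨rfl, fun i => ?_⟩ hw
        have := hcount i
        simp only [topConfig, Config.fire, hz, Pi.zero_apply, add_zero, Int.toNat_natCast]
        split_ifs at this ⊢ <;> omega
      have hacc : ∀ t ∈ S.T, t.1 = x.1.1 → topConfig M (capFire M x.1 t) ∉ S.winSet qF →
          ∃ k', Z (c.fire t) k' := by
        intro t ht hst' hl
        have hm : (t.2.1, (⟨capFire M x.1 t, capFire_le, hl⟩ : LosingNode S qF M)) ∈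
            losingMoves S qF M x := mem_losingMoves.2 ⟨t, ht, hS.capEnabled hq ht hst', rfl, rfl⟩
        obtain ⟨m, hm', u', k', h1, h2, -⟩ := hX x u k hXx (true, {_}) (by
          rw [losingChoices, if_neg hq]
          split_ifs
          · exact Finset.mem_insert_of_mem (Finset.mem_image_of_mem _ hm)
          · exact Finset.mem_image_of_mem _ hm)
        obtain rfl := Finset.mem_singleton.1 hm'
        exact ⟨k', (hmove hf hst hcount hXx (hS.capEnabled hq ht hst') rfl h1 h2).2⟩
      refine .inr (.inr ⟨hst ▸ hq, ?_, ?_⟩)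
      · by_cases hall : ∀ t ∈ S.T, t.1 = x.1.1 → topConfig M (capFire M x.1 t) ∉ S.winSet qF
        · obtain ⟨c', h1, h2⟩ := hfree _ (by
            rw [losingChoices, if_neg hq, if_pos hall]; exact Finset.mem_insert_self _ _) rfl
          exact ⟨c', h1, .inr h2⟩
        · push Not at hall
          obtain ⟨t, ht, hst', hw⟩ := hall
          refine ⟨c.fire t, ⟨t, ht, ⟨hst'.trans hst.symm, fun i => ?_⟩, rfl⟩,
            .inl (hwin t ht hst' hw)⟩
          rw [hS.weight_eq_zero ht (hst' ▸ hq)]; simp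
      · rintro c' ⟨t, ht, hen, rfl⟩
        have hst' : t.1 = x.1.1 := hen.1.trans hst
        by_cases hw : topConfig M (capFire M x.1 t) ∈ S.winSet qF
        · exact .inl (hwin t ht hst' hw)
        · exact .inr (hacc t ht hst' hw)
  -- A configuration of `Z` wins although it lies in a box disjoint from the winning set.
  obtain ⟨x, u, k, hXx, hf⟩ := hf₀
  have hz : Z ⟨x.1.1, fun i => if x.1.2 i = 0 then u i + M else x.1.2 i - 1⟩ k :=
    ⟨x, u, hXx, hf, rfl, fun _ => rfl⟩
  obtain ⟨y, hy⟩ := hcov hz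
  exact y.2.2 (topConfig_mem hS hM hy (hmain _ k hz))

/-- The memoryless refutation of the energy game is the strategy of Player P, and the lexicographic
ranking of its graph is the ranking of the certificate, on all losing nodes at once. -/
theorem exists_losingCert (hS : S.IsOneVASSMDP) {c : Config Q d} (hc : c ∉ S.winSet qF) :
    ∃ (K : ℕ) (loc : Fin K → Q × (Fin d → ℕ)) (m : ℕ) (Y : ℕ → Fin K → Fin d → ℕ)
      (P : ℕ → Fin K → ℕ), IsLosingCert S qF loc m Y P ∧ ∃ n, Covers (loc n) c := by
  classical
  obtain ⟨M, hM⟩ := exists_bound_basis (S.winSet qF)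
  obtain ⟨f, hf, hfw⟩ := exists_memoryless (losingChoices S qF M) (losingChoices_nonempty hS)
    (not_winnable_losingChoices hS hM)
  obtain ⟨m, Y, P, hYP⟩ := exists_lexRanking (graph f)
    fun h => hfw (winnable_of_hasAcceptingCycle h)
  have hcert : IsLosingCert S qF (fun x : LosingNode S qF M => x.1) m Y P := by
    intro x
    refine ⟨fun h => x.2.2 (S.reachStep_winSet_subset qF (.inl h)), ?_⟩
    have hstep : ∀ t ∈ S.T, CapEnabled x.1 t → ∀ y : LosingNode S qF M, y.1 = capFire M x.1 t →
        (t.2.1, y) ∈ (f x).2 →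
        CertStep (fun x : LosingNode S qF M => x.1) m Y P t x y (f x).1 := by
      intro t ht hen y hy hmem
      refine ⟨show t.2.2 = y.1.1 by rw [hy]; rfl, fun i => ?_, hYP _ (mem_graph.2 ⟨hmem, rfl⟩)⟩
      have := hen.2 i
      simp only [hy, capFire]
      split_ifs <;> omega
    have hfree : (∀ t ∈ S.T, CapEnabled x.1 t → topConfig M (capFire M x.1 t) ∉ S.winSet qF) →
        f x = (false, losingMoves S qF M x) → ∀ t ∈ S.T, t.1 = x.1.1 →
        (∀ i, x.1.2 i = 0 ∨ 0 < (x.1.2 i : ℤ) + t.2.1 i) →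
        ∃ y, CertStep (fun x : LosingNode S qF M => x.1) m Y P t x y false := by
      intro hl hfx t ht hst hen
      have := hstep t ht ⟨hst, hen⟩ ⟨_, capFire_le, hl t ht ⟨hst, hen⟩⟩ rfl (by
        rw [hfx]; exact mem_losingMoves.2 ⟨t, ht, ⟨hst, hen⟩, rfl, rfl⟩)
      rw [hfx] at this
      exact ⟨_, this⟩
    have hacc : x.1.1 ∉ S.Q₁ → (∃ m ∈ losingMoves S qF M x, (true, {m}) = f x) →
        ∃ t ∈ S.T, t.1 = x.1.1 ∧
          ∃ y, CertStep (fun x : LosingNode S qF M => x.1) m Y P t x y true := by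
      rintro hq ⟨⟨z, y⟩, hmv, hfx⟩
      obtain ⟨t, ht, hen, rfl, hy⟩ := mem_losingMoves.1 hmv
      have := hstep t ht hen y hy (by rw [← hfx]; exact Finset.mem_singleton_self _)
      rw [← hfx] at this
      exact ⟨t, ht, hen.1, y, this⟩
    have hfx := hf x
    rw [losingChoices] at hfx
    split_ifs at hfx with hq hall
    · exact .inl (hfree (fun t ht hen => topConfig_capFire_notMem hS hM x.2.2 hq ht hen)
        (Finset.mem_singleton.1 hfx))
    · rcases Finset.mem_insert.1 hfx with hfx | hfx
      · exact .inl (hfree (fun t ht hen => hall t ht hen.1) hfx)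
      · exact .inr ⟨hq, hacc hq (Finset.mem_image.1 hfx)⟩
    · exact .inr ⟨hq, hacc hq (Finset.mem_image.1 hfx)⟩
  let φ := Fintype.equivFin (LosingNode S qF M)
  have hφ : ∀ {t x y b}, CertStep (fun x : LosingNode S qF M => x.1) m Y P t x y b →
      CertStep (fun k => (φ.symm k).1) m (fun i k => Y i (φ.symm k)) (fun i k => P i (φ.symm k))
        t (φ x) (φ y) b := by
    rintro t x y b ⟨h1, h2, h3⟩
    refine ⟨by simpa using h1, by simpa using h2, ?_⟩
    simpa [LexDecreases, variation] using h3
  refine ⟨Fintype.card (LosingNode S qF M), fun k => (φ.symm k).1, m, fun i k => Y i (φ.symm k),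
    fun i k => P i (φ.symm k), fun k => ?_, ?_⟩
  · obtain ⟨h1, h2⟩ := hcert (φ.symm k)
    refine ⟨h1, h2.imp (fun h t ht hst hen => ?_) (fun ⟨hq, t, ht, hst, y, hy⟩ => ?_)⟩
    · obtain ⟨y, hy⟩ := h t ht hst hen
      exact ⟨φ y, by simpa using hφ hy⟩
    · exact ⟨hq, t, ht, hst, φ y, by simpa using hφ hy⟩
  · set x : Q × (Fin d → ℕ) := (c.state, fun i => if c.count i < M then c.count i + 1 else 0)
      with hx
    have hl : topConfig M x ∉ S.winSet qF := by
      intro hw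
      obtain ⟨b, hb, hle, hlt⟩ := hM _ hw
      refine hc (hS.isUpperSet_winSet (a := b) ⟨hle.1, fun i => ?_⟩ hb)
      have h1 : b.count i ≤ (topConfig M x).count i := hle.2 i
      have h2 := hlt i
      simp only [topConfig, hx] at h1
      change b.count i ≤ c.count i
      by_cases hcM : c.count i < M
      · simpa [hcM] using h1
      · omega
    refine ⟨φ ⟨x, fun i => ?_, hl⟩, by simp [hx], fun i => ?_⟩
    · simp only [hx]
      split_ifs <;> omega
    · simp only [Equiv.symm_apply_apply, hx]
      split_ifs <;> omega

end Completeness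

end VASSMDP

/-! ### Primitive recursive predicates -/

section PrimrecTools

attribute [fun_prop] Primrec

attribute [fun_prop] Primrec.id Primrec.const Primrec.comp Primrec.pair Primrec.fst Primrec.snd

variable {α β σ : Type*} [Primcodable α] [Primcodable β] [Primcodable σ]

@[fun_prop]
lemma Primrec.prod_fst {f : α → β × σ} (hf : Primrec f) : Primrec fun a => (f a).1 :=
  Primrec.fst.comp hf

@[fun_prop]
lemma Primrec.prod_snd {f : α → β × σ} (hf : Primrec f) : Primrec fun a => (f a).2 :=
  Primrec.snd.comp hf

@[fun_prop]
lemma Primrec.add_comp {f g : α → ℕ} (hf : Primrec f) (hg : Primrec g) :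
    Primrec fun a => f a + g a := Primrec.nat_add.comp hf hg

@[fun_prop]
lemma Primrec.mul_comp {f g : α → ℕ} (hf : Primrec f) (hg : Primrec g) :
    Primrec fun a => f a * g a := Primrec.nat_mul.comp hf hg

@[fun_prop]
lemma Primrec.getD_comp {f : α → List β} {g : α → ℕ} (c : β) (hf : Primrec f) (hg : Primrec g) :
    Primrec fun a => (f a).getD (g a) c := (Primrec.list_getD c).comp hf hg

@[fun_prop]
lemma Primrec.length_comp {f : α → List β} (hf : Primrec f) :
    Primrec fun a => (f a).length := Primrec.list_length.comp hf

/-- The coding of `ℤ` interleaves the nonnegative and the negative integers, so `g` is `f` read on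
codes. -/
lemma Primrec.of_int {f : ℤ → ℕ} {g : ℕ → ℕ} (hg : Primrec g) (h₁ : ∀ k : ℕ, g (2 * k) = f k)
    (h₂ : ∀ k : ℕ, g (2 * k + 1) = f (Int.negSucc k)) : Primrec f := by
  rw [Primrec.dom_denumerable]
  refine (Primrec.nat_iff.1 hg).of_eq fun n => ?_
  obtain ⟨z, rfl⟩ : ∃ z : ℤ, Encodable.encode z = n := ⟨Denumerable.ofNat ℤ n, Denumerable.encode_ofNat n⟩
  rw [Denumerable.ofNat_encode]
  cases z with
  | ofNat k => exact h₁ k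
  | negSucc k => exact h₂ k

lemma Primrec.int_toNat : Primrec Int.toNat :=
  Primrec.of_int (g := fun n => bif n.bodd then 0 else n.div2)
    (Primrec.cond Primrec.nat_bodd (Primrec.const 0) Primrec.nat_div2)
    (fun k => by simp [Nat.div2_val]) (fun k => by simp)

lemma Primrec.int_neg_toNat : Primrec fun z : ℤ => (-z).toNat :=
  Primrec.of_int (g := fun n => bif n.bodd then n.div2 + 1 else 0)
    (Primrec.cond Primrec.nat_bodd (Primrec.succ.comp Primrec.nat_div2) (Primrec.const 0))
    (fun k => by simp) (fun k => by simp [Nat.div2_val])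

@[fun_prop]
lemma Primrec.toNat_comp {f : α → ℤ} (hf : Primrec f) : Primrec fun a => (f a).toNat :=
  Primrec.int_toNat.comp hf

@[fun_prop]
lemma Primrec.neg_toNat_comp {f : α → ℤ} (hf : Primrec f) : Primrec fun a => (-(f a)).toNat :=
  Primrec.int_neg_toNat.comp hf

@[fun_prop]
lemma Primrec.sum_range_comp {f : α → ℕ} {g : α → ℕ → ℕ} (hf : Primrec f)
    (hg : Primrec fun p : α × ℕ => g p.1 p.2) :
    Primrec fun a => ∑ i ∈ Finset.range (f a), g a i := by
  have h : Primrec fun a => ((List.range (f a)).map (g a)).foldr (fun x s => x + s) 0 :=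
    Primrec.list_foldr (Primrec.list_map (Primrec.list_range.comp hf) hg) (Primrec.const 0)
      (h := fun _ p => p.1 + p.2) (by unfold Primrec₂; fun_prop)
  refine h.of_eq fun a => ?_
  rw [Finset.sum_eq_multiset_sum, Finset.range_val, Multiset.range, Multiset.map_coe,
    Multiset.sum_coe, List.sum_eq_foldr]

lemma PrimrecPred.forall_mem {f : α → List β} {p : α → β → Prop} (hf : Primrec f)
    (hp : PrimrecPred fun x : α × β => p x.1 x.2) : PrimrecPred fun a => ∀ b ∈ f a, p a b := by
  have : PrimrecRel fun (b : β) (a : α) => p a b :=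
    PrimrecPred.comp hp (Primrec.snd.pair Primrec.fst)
  exact this.forall_mem_list.comp hf Primrec.id

lemma PrimrecPred.exists_mem {f : α → List β} {p : α → β → Prop} (hf : Primrec f)
    (hp : PrimrecPred fun x : α × β => p x.1 x.2) : PrimrecPred fun a => ∃ b ∈ f a, p a b := by
  have : PrimrecRel fun (b : β) (a : α) => p a b :=
    PrimrecPred.comp hp (Primrec.snd.pair Primrec.fst)
  exact this.exists_mem_list.comp hf Primrec.id

lemma PrimrecPred.forall_lt_comp {f : α → ℕ} {p : α → ℕ → Prop} (hf : Primrec f)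
    (hp : PrimrecPred fun x : α × ℕ => p x.1 x.2) : PrimrecPred fun a => ∀ b < f a, p a b :=
  (PrimrecPred.forall_mem (Primrec.list_range.comp hf) hp).of_eq (by simp)

lemma PrimrecPred.exists_lt_comp {f : α → ℕ} {p : α → ℕ → Prop} (hf : Primrec f)
    (hp : PrimrecPred fun x : α × ℕ => p x.1 x.2) : PrimrecPred fun a => ∃ b < f a, p a b :=
  (PrimrecPred.exists_mem (Primrec.list_range.comp hf) hp).of_eq (by simp)

lemma PrimrecPred.imp {p q : α → Prop} (hp : PrimrecPred p) (hq : PrimrecPred q) :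
    PrimrecPred fun a => p a → q a :=
  (hp.not.or hq).of_eq fun _ => by tauto

lemma PrimrecPred.eq_comp {f g : α → β} (hf : Primrec f) (hg : Primrec g) :
    PrimrecPred fun a => f a = g a := Primrec.eq.comp hf hg

lemma PrimrecPred.le_comp {f g : α → ℕ} (hf : Primrec f) (hg : Primrec g) :
    PrimrecPred fun a => f a ≤ g a := Primrec.nat_le.comp hf hg

lemma PrimrecPred.lt_comp {f g : α → ℕ} (hf : Primrec f) (hg : Primrec g) :
    PrimrecPred fun a => f a < g a := Primrec.nat_lt.comp hf hg

/-- Projections of primitive recursive predicates are recursively enumerable. -/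
lemma PrimrecPred.rePred_exists {p : α → β → Prop}
    (hp : PrimrecPred fun x : α × β => p x.1 x.2) : REPred fun a => ∃ b, p a b := by
  classical
  let P : α → ℕ → Prop := fun a n => ∃ b ∈ (Encodable.decode (α := β) n).toList, p a b
  have hP : PrimrecPred fun x : α × ℕ => P x.1 x.2 :=
    PrimrecPred.exists_mem (Primrec.optionToList.comp (Primrec.decode.comp Primrec.snd))
      (PrimrecPred.comp hp (by fun_prop : Primrec fun y : (α × ℕ) × β => (y.1.1, y.2)))
  have h : Partrec fun a => Nat.rfind fun n => Part.some (decide (P a n)) :=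
    Partrec.rfind hP.computablePred.decide.partrec
  refine h.dom_re.of_eq fun a => ?_
  refine Nat.rfind_dom.trans ?_
  simp only [Part.mem_some_iff, true_eq_decide_iff, Part.some_dom, implies_true, and_true, P]
  constructor
  · rintro ⟨n, b, -, hb⟩
    exact ⟨b, hb⟩
  · rintro ⟨b, hb⟩
    exact ⟨Encodable.encode b, b, by simp, hb⟩

end PrimrecTools

/-! ### Certificates for codes -/

namespace Code

/-- A weighted transition of a code. -/
abbrev Trans : Type := (ℕ × List ℤ × ℕ) × ℕ

/-- The number of control-states. -/
def numStates (w : Code) : ℕ := w.1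

/-- The dimension. -/
def dim (w : Code) : ℕ := w.2.1

/-- Whether the control-state `q` belongs to Player 1. -/
def owner (w : Code) (q : ℕ) : Bool := w.2.2.1.getD q false

/-- The weighted transitions. -/
def trans (w : Code) : List Trans := w.2.2.2.1

/-- The initial configuration. -/
def init (w : Code) : ℕ × List ℕ := w.2.2.2.2.1

/-- The target control-state. -/
def target (w : Code) : ℕ := w.2.2.2.2.2

/-- The code describes a 1-VASS-MDP, an initial configuration and a control-state. -/
def Wf (w : Code) : Prop :=
  w.2.2.1.length = w.numStates ∧
  (∀ e ∈ w.trans, e.1.1 < w.numStates ∧ e.1.2.1.length = w.dim ∧ e.1.2.2 < w.numStates ∧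
    (w.owner e.1.1 = true ∨ (0 < e.2 ∧ ∀ x ∈ e.1.2.1, x = 0))) ∧
  (∀ e ∈ w.trans, ∀ e' ∈ w.trans, e.1 = e'.1 → e.2 = e'.2) ∧
  w.init.1 < w.numStates ∧ w.init.2.length = w.dim ∧ w.target < w.numStates

/-- A control-state, lower bounds for the counters, and a rank. -/
abbrev PosEntry : Type := ℕ × List ℕ × ℕ

/-- Firing `t` leads from the configurations described by `x` to configurations described
by `x'`. -/
def PosStep (w : Code) (x : PosEntry) (t : Trans) (x' : PosEntry) : Prop :=
  t.1.2.2 = x'.1 ∧ ∀ i < w.dim, x'.2.1.getD i 0 + (-(t.1.2.1.getD i 0)).toNat ≤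
    x.2.1.getD i 0 + (t.1.2.1.getD i 0).toNat

/-- A certificate for almost-sure reachability. -/
def IsPosCert (w : Code) (P : List PosEntry) : Prop :=
  (∃ x ∈ P, x.1 = w.init.1 ∧ ∀ i < w.dim, x.2.1.getD i 0 ≤ w.init.2.getD i 0) ∧
  ∀ x ∈ P, x.1 = w.target ∨
    ((∃ t ∈ w.trans, t.1.1 = x.1 ∧ ∃ x' ∈ P, w.PosStep x t x' ∧ x'.2.2 < x.2.2) ∧
      (w.owner x.1 = true ∨ ∀ t ∈ w.trans, t.1.1 = x.1 → ∃ x' ∈ P, w.PosStep x t x'))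

/-- A control-state, strict upper bounds for the counters (with `0` for no bound), and
rankings. -/
abbrev NegEntry : Type := ℕ × List ℕ × List (List ℕ × ℕ)

/-- The coefficients of the ranking `j`. -/
def NegEntry.coeff (g : NegEntry) (j i : ℕ) : ℕ := (g.2.2.getD j ([], 0)).1.getD i 0

/-- The offset of the ranking `j`. -/
def NegEntry.offset (g : NegEntry) (j : ℕ) : ℕ := (g.2.2.getD j ([], 0)).2

/-- The part of the ranking `j` that is added by a step. -/
def gain (w : Code) (g : NegEntry) (t : Trans) (g' : NegEntry) (j : ℕ) : ℕ :=
  ∑ i ∈ Finset.range w.dim, g.coeff j i * (t.1.2.1.getD i 0).toNat + g'.offset j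

/-- The part of the ranking `j` that is removed by a step. -/
def loss (w : Code) (g : NegEntry) (t : Trans) (j : ℕ) : ℕ :=
  ∑ i ∈ Finset.range w.dim, g.coeff j i * (-(t.1.2.1.getD i 0)).toNat + g.offset j

/-- A step from `g` to `g'` that respects the bounds and the rankings. -/
def NegStep (w : Code) (m : ℕ) (g : NegEntry) (t : Trans) (g' : NegEntry) (acc : Bool) : Prop :=
  t.1.2.2 = g'.1 ∧
  (∀ i < w.dim, g'.2.1.getD i 0 = 0 ∨ (g.2.1.getD i 0 ≠ 0 ∧
    g.2.1.getD i 0 + (t.1.2.1.getD i 0).toNat ≤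
      g'.2.1.getD i 0 + (-(t.1.2.1.getD i 0)).toNat)) ∧
  ∃ j < m + 1, (∀ k < j, (∀ i < w.dim, g.coeff k i = g'.coeff k i) ∧
      w.gain g t g' k = w.loss g t k) ∧
    ((j < m ∧ (∀ i < w.dim, g.coeff j i = g'.coeff j i) ∧ w.gain g t g' j < w.loss g t j) ∨
      (j = m ∧ acc = false))

/-- Some configuration within the bounds of `g` may enable `t`. -/
def MayFire (w : Code) (g : NegEntry) (t : Trans) : Prop :=
  ∀ i < w.dim, g.2.1.getD i 0 = 0 ∨
    (-(t.1.2.1.getD i 0)).toNat < g.2.1.getD i 0 + (t.1.2.1.getD i 0).toNat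

/-- A certificate for the failure of almost-sure reachability. -/
def IsNegCert (w : Code) (C : ℕ × List NegEntry) : Prop :=
  (∃ g ∈ C.2, g.1 = w.init.1 ∧
    ∀ i < w.dim, g.2.1.getD i 0 = 0 ∨ w.init.2.getD i 0 < g.2.1.getD i 0) ∧
  ∀ g ∈ C.2, g.1 < w.numStates ∧ g.1 ≠ w.target ∧
    ((∀ t ∈ w.trans, t.1.1 = g.1 → w.MayFire g t →
        ∃ g' ∈ C.2, w.NegStep C.1 g t g' false) ∨
      (w.owner g.1 = false ∧
        ∃ t ∈ w.trans, t.1.1 = g.1 ∧ ∃ g' ∈ C.2, w.NegStep C.1 g t g' true))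

/-! ### Certificate checking is primitive recursive -/

section Primrec

variable {α : Type*} [Primcodable α] {w : α → Code}

@[fun_prop]
lemma primrec_numStates (hw : Primrec w) : Primrec fun a => (w a).numStates := by
  unfold numStates; fun_prop

@[fun_prop]
lemma primrec_dim (hw : Primrec w) : Primrec fun a => (w a).dim := by
  unfold dim; fun_prop

@[fun_prop]
lemma primrec_owner {q : α → ℕ} (hw : Primrec w) (hq : Primrec q) :
    Primrec fun a => (w a).owner (q a) := by
  unfold owner; fun_prop

@[fun_prop]
lemma primrec_trans (hw : Primrec w) : Primrec fun a => (w a).trans := by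
  unfold trans; fun_prop

@[fun_prop]
lemma primrec_init (hw : Primrec w) : Primrec fun a => (w a).init := by
  unfold init; fun_prop

@[fun_prop]
lemma primrec_target (hw : Primrec w) : Primrec fun a => (w a).target := by
  unfold target; fun_prop

@[fun_prop]
lemma primrec_coeff {g : α → NegEntry} {j i : α → ℕ} (hg : Primrec g) (hj : Primrec j)
    (hi : Primrec i) : Primrec fun a => (g a).coeff (j a) (i a) := by
  unfold NegEntry.coeff; fun_prop

@[fun_prop]
lemma primrec_offset {g : α → NegEntry} {j : α → ℕ} (hg : Primrec g) (hj : Primrec j) :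
    Primrec fun a => (g a).offset (j a) := by
  unfold NegEntry.offset; fun_prop

@[fun_prop]
lemma primrec_gain {g g' : α → NegEntry} {t : α → Trans} {j : α → ℕ} (hw : Primrec w)
    (hg : Primrec g) (ht : Primrec t) (hg' : Primrec g') (hj : Primrec j) :
    Primrec fun a => (w a).gain (g a) (t a) (g' a) (j a) := by
  unfold gain; fun_prop

@[fun_prop]
lemma primrec_loss {g : α → NegEntry} {t : α → Trans} {j : α → ℕ} (hw : Primrec w)
    (hg : Primrec g) (ht : Primrec t) (hj : Primrec j) :
    Primrec fun a => (w a).loss (g a) (t a) (j a) := by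
  unfold loss; fun_prop

open PrimrecPred

lemma primrecPred_wf : PrimrecPred Wf := by
  unfold Wf
  refine (eq_comp (by fun_prop) (by fun_prop)).and (.and (forall_mem (by fun_prop) ?_)
    (.and (forall_mem (by fun_prop) (forall_mem (by fun_prop) ?_)) (.and ?_ (.and ?_ ?_))))
  · exact (lt_comp (by fun_prop) (by fun_prop)).and (.and (eq_comp (by fun_prop) (by fun_prop))
      (.and (lt_comp (by fun_prop) (by fun_prop)) (.or (eq_comp (by fun_prop) (by fun_prop))
      (.and (lt_comp (by fun_prop) (by fun_prop)) (forall_mem (by fun_prop)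
        (eq_comp (by fun_prop) (by fun_prop)))))))
  · exact (eq_comp (by fun_prop) (by fun_prop)).imp (eq_comp (by fun_prop) (by fun_prop))
  · exact lt_comp (by fun_prop) (by fun_prop)
  · exact eq_comp (by fun_prop) (by fun_prop)
  · exact lt_comp (by fun_prop) (by fun_prop)

lemma primrecPred_posStep {x x' : α → PosEntry} {t : α → Trans} (hw : Primrec w)
    (hx : Primrec x) (ht : Primrec t) (hx' : Primrec x') :
    PrimrecPred fun a => (w a).PosStep (x a) (t a) (x' a) := by
  unfold PosStep
  exact (eq_comp (by fun_prop) (by fun_prop)).and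
    (forall_lt_comp (by fun_prop) (le_comp (by fun_prop) (by fun_prop)))

lemma primrecPred_isPosCert : PrimrecPred fun p : Code × List PosEntry => p.1.IsPosCert p.2 := by
  unfold IsPosCert
  refine .and (exists_mem (by fun_prop) (.and (eq_comp (by fun_prop) (by fun_prop)) (forall_lt_comp
    (by fun_prop) (le_comp (by fun_prop) (by fun_prop))))) (forall_mem (by fun_prop)
    (.or (eq_comp (by fun_prop) (by fun_prop)) (.and ?_ (.or (eq_comp (by fun_prop)
    (by fun_prop)) ?_))))
  · exact exists_mem (by fun_prop) (.and (eq_comp (by fun_prop) (by fun_prop))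
      (exists_mem (by fun_prop) (.and (primrecPred_posStep (by fun_prop) (by fun_prop)
        (by fun_prop) (by fun_prop)) (lt_comp (by fun_prop) (by fun_prop)))))
  · exact forall_mem (by fun_prop) (.imp (eq_comp (by fun_prop) (by fun_prop))
      (exists_mem (by fun_prop) (primrecPred_posStep (by fun_prop) (by fun_prop)
        (by fun_prop) (by fun_prop))))

lemma primrecPred_negStep {m : α → ℕ} {g g' : α → NegEntry} {t : α → Trans} (acc : Bool)
    (hw : Primrec w) (hm : Primrec m) (hg : Primrec g) (ht : Primrec t) (hg' : Primrec g') :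
    PrimrecPred fun a => (w a).NegStep (m a) (g a) (t a) (g' a) acc := by
  unfold NegStep
  refine (eq_comp (by fun_prop) (by fun_prop)).and (.and (forall_lt_comp (by fun_prop) (.or
    (eq_comp (by fun_prop) (by fun_prop)) (.and (.not (eq_comp (by fun_prop) (by fun_prop)))
    (le_comp (by fun_prop) (by fun_prop))))) (exists_lt_comp (by fun_prop) (.and ?_ (.or ?_ ?_))))
  · exact forall_lt_comp (by fun_prop) (.and (forall_lt_comp (by fun_prop)
      (eq_comp (by fun_prop) (by fun_prop))) (eq_comp (by fun_prop) (by fun_prop)))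
  · exact (lt_comp (by fun_prop) (by fun_prop)).and (.and (forall_lt_comp (by fun_prop)
      (eq_comp (by fun_prop) (by fun_prop))) (lt_comp (by fun_prop) (by fun_prop)))
  · exact (eq_comp (by fun_prop) (by fun_prop)).and (eq_comp (by fun_prop) (by fun_prop))

lemma primrecPred_exists_negStep {C : α → ℕ × List NegEntry} {g : α → NegEntry} {t : α → Trans}
    (acc : Bool) (hw : Primrec w) (hC : Primrec C) (hg : Primrec g) (ht : Primrec t) :
    PrimrecPred fun a => ∃ g' ∈ (C a).2, (w a).NegStep (C a).1 (g a) (t a) g' acc :=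
  exists_mem (by fun_prop) (primrecPred_negStep acc (by fun_prop) (by fun_prop) (by fun_prop)
    (by fun_prop) (by fun_prop))

lemma primrecPred_mayFire {g : α → NegEntry} {t : α → Trans} (hw : Primrec w) (hg : Primrec g)
    (ht : Primrec t) : PrimrecPred fun a => (w a).MayFire (g a) (t a) :=
  forall_lt_comp (by fun_prop) (.or (eq_comp (by fun_prop) (by fun_prop))
    (lt_comp (by fun_prop) (by fun_prop)))

lemma primrecPred_isNegCert :
    PrimrecPred fun p : Code × (ℕ × List NegEntry) => p.1.IsNegCert p.2 := by
  unfold IsNegCert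
  refine .and (exists_mem (by fun_prop) (.and (eq_comp (by fun_prop) (by fun_prop))
    (forall_lt_comp (by fun_prop) (.or (eq_comp (by fun_prop) (by fun_prop)) (lt_comp (by fun_prop)
    (by fun_prop)))))) (forall_mem (by fun_prop) (.and ?_ (.and ?_ (.or ?_ (.and ?_ ?_)))))
  · exact lt_comp (by fun_prop) (by fun_prop)
  · exact .not (eq_comp (by fun_prop) (by fun_prop))
  · refine forall_mem (by fun_prop) (.imp ?_ (.imp ?_ ?_))
    · exact eq_comp (by fun_prop) (by fun_prop)
    · exact primrecPred_mayFire (by fun_prop) (by fun_prop) (by fun_prop)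
    · exact primrecPred_exists_negStep _ (by fun_prop) (by fun_prop) (by fun_prop) (by fun_prop)
  · exact eq_comp (by fun_prop) (by fun_prop)
  · refine exists_mem (by fun_prop) (.and ?_ ?_)
    · exact eq_comp (by fun_prop) (by fun_prop)
    · exact primrecPred_exists_negStep _ (by fun_prop) (by fun_prop) (by fun_prop) (by fun_prop)

end Primrec

end Code

namespace Code

open VASSMDP EnergyGame

lemma getD_ofFn {α : Type*} {n : ℕ} (f : Fin n → α) (i : Fin n) (a : α) :
    (List.ofFn f).getD i a = f i := by
  simp [List.getD]

lemma forall_lt_iff {d : ℕ} {p : ℕ → Prop} {q : Fin d → Prop} (h : ∀ i : Fin d, p i ↔ q i) :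
    (∀ i < d, p i) ↔ ∀ i, q i :=
  ⟨fun hp i => (h i).1 (hp i i.2), fun hq i hi => (h ⟨i, hi⟩).2 (hq ⟨i, hi⟩)⟩

variable {n d : ℕ} {w : Code} {S : VASSMDP (Fin n) d} {c₀ : Config (Fin n) d} {qF : Fin n}

/-- The code of a weighted transition. -/
def ofTrans (S : VASSMDP (Fin n) d) (t : VTrans (Fin n) d) : Trans :=
  (((t.1 : ℕ), List.ofFn t.2.1, (t.2.2 : ℕ)), S.τ t)

lemma numStates_eq (h : Encodes w S c₀ qF) : w.numStates = n := by
  obtain ⟨L, -, rfl⟩ := h; rfl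

lemma dim_eq (h : Encodes w S c₀ qF) : w.dim = d := by
  obtain ⟨L, -, rfl⟩ := h; rfl

lemma owner_eq (h : Encodes w S c₀ qF) (q : Fin n) : w.owner q = decide (q ∈ S.Q₁) := by
  obtain ⟨L, -, rfl⟩ := h; exact getD_ofFn (fun q => decide (q ∈ S.Q₁)) q false

lemma mem_trans (h : Encodes w S c₀ qF) (t' : Trans) :
    t' ∈ w.trans ↔ ∃ t ∈ S.T, ofTrans S t = t' := by
  obtain ⟨L, hL, rfl⟩ := h
  simp only [trans, List.mem_map, ← hL, List.mem_toFinset, ofTrans]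

lemma init_eq (h : Encodes w S c₀ qF) : w.init = ((c₀.state : ℕ), List.ofFn c₀.count) := by
  obtain ⟨L, -, rfl⟩ := h; rfl

lemma target_eq (h : Encodes w S c₀ qF) : w.target = qF := by
  obtain ⟨L, -, rfl⟩ := h; rfl

/-! ### Positive certificates -/

/-- Coded conditions put the positive and negative parts of a weight on opposite sides, to stay
within `ℕ`; here they are recombined. -/
lemma posStep_iff (h : Encodes w S c₀ qF) {x x' : PosEntry} {t : VTrans (Fin n) d} :
    w.PosStep x (ofTrans S t) x' ↔ (t.2.2 : ℕ) = x'.1 ∧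
      ∀ i : Fin d, (x'.2.1.getD i 0 : ℤ) ≤ x.2.1.getD i 0 + t.2.1 i := by
  simp only [PosStep, dim_eq h, ofTrans]
  refine and_congr_right fun _ => forall_lt_iff fun i => ?_
  rw [getD_ofFn]
  omega

/-- The configurations above the one given by `x`. -/
def Below (x : PosEntry) (c : Config (Fin n) d) : Prop :=
  x.1 = c.state ∧ ∀ i : Fin d, x.2.1.getD i 0 ≤ c.count i

lemma PosStep.fire (h : Encodes w S c₀ qF) {x x' : PosEntry} {t : VTrans (Fin n) d}
    {c : Config (Fin n) d} (hx : Below x c) (hs : w.PosStep x (ofTrans S t) x') :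
    (∀ i, 0 ≤ (c.count i : ℤ) + t.2.1 i) ∧ Below x' (c.fire t) := by
  obtain ⟨h1, h2⟩ := (posStep_iff h).1 hs
  refine ⟨fun i => ?_, h1.symm, fun i => ?_⟩
  · have := h2 i
    have := hx.2 i
    omega
  · have := h2 i
    have := hx.2 i
    simp only [Config.fire]
    omega

theorem IsPosCert.mem_winSet (h : Encodes w S c₀ qF) {P : List PosEntry} (hP : w.IsPosCert P) :
    c₀ ∈ S.winSet qF := by
  obtain ⟨⟨x, hxP, hx, hx'⟩, hP⟩ := hP
  have hx₀ : Below x c₀ := by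
    rw [init_eq h] at hx hx'
    rw [dim_eq h] at hx'
    exact ⟨hx, fun i => by simpa [getD_ofFn] using hx' i i.2⟩
  refine mem_winSet_of_ranked S qF (fun c k => ∃ x ∈ P, Below x c ∧ x.2.2 = k) ?_
    (k := x.2.2) ⟨x, hxP, hx₀, rfl⟩
  rintro c k ⟨x, hxP, hxc, rfl⟩
  rcases hP x hxP with hF | ⟨⟨t', ht', hxt, x', hx', hs, hlt⟩, hP⟩
  · left
    rw [target_eq h, hxc.1] at hF
    exact Fin.ext hF
  obtain ⟨t, ht, rfl⟩ := (mem_trans h t').1 ht'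
  obtain ⟨h1, h2⟩ := hs.fire h hxc
  have hstep : ∃ c', VStep S.T c c' ∧
      (c' ∈ S.winSet qF ∨ ∃ k' < x.2.2, ∃ x ∈ P, Below x c' ∧ x.2.2 = k') :=
    ⟨c.fire t, ⟨t, ht, ⟨Fin.ext (hxt.trans hxc.1), h1⟩, rfl⟩, .inr ⟨_, hlt, x', hx', h2, rfl⟩⟩
  by_cases hq : c.state ∈ S.Q₁
  · exact .inr (.inl ⟨hq, hstep⟩)
  refine .inr (.inr ⟨hq, hstep, ?_⟩)
  rintro _ ⟨t, ht, hen, rfl⟩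
  rcases hP with hP | hP
  · rw [hxc.1, owner_eq h] at hP
    exact absurd (of_decide_eq_true hP) hq
  · obtain ⟨x', hx', hs⟩ := hP _ ((mem_trans h _).2 ⟨t, ht, rfl⟩)
      ((congrArg Fin.val hen.1).trans hxc.1.symm)
    exact .inr ⟨_, x', hx', (hs.fire h hxc).2, rfl⟩

/-- The entry of a configuration with a rank. -/
def posEntry (c : Config (Fin n) d) (k : ℕ) : PosEntry := ((c.state : ℕ), List.ofFn c.count, k)

lemma posStep_posEntry (h : Encodes w S c₀ qF) {c c' : Config (Fin n) d} {t : VTrans (Fin n) d}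
    (hen : c.Enabled t) (hle : c' ≤ c.fire t) (k k' : ℕ) :
    w.PosStep (posEntry c k) (ofTrans S t) (posEntry c' k') := by
  refine (posStep_iff h).2 ⟨congrArg Fin.val hle.1.symm, fun i => ?_⟩
  have h1 : c'.count i ≤ (c.fire t).count i := hle.2 i
  have h2 := hen.2 i
  simp only [Config.fire] at h1
  simp only [posEntry, getD_ofFn]
  omega

/-- The entries are finite bases of the levels up to `N`, ranked by level. One successor descends a
level; the other successors at a Player P configuration only need some entry, and level `N` has one
for every winning configuration. -/
theorem exists_isPosCert (hS : S.IsOneVASSMDP) (h : Encodes w S c₀ qF) (hc : c₀ ∈ S.winSet qF) :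
    ∃ P, w.IsPosCert P := by
  obtain ⟨N, hN⟩ := hS.exists_winLevel_eq (qF := qF)
  choose B hB hB' using fun k => exists_finset_basis (S.winLevel qF k)
  let P : List PosEntry := (List.range (N + 1)).flatMap fun k =>
    (B k).toList.map fun b => posEntry b k
  have hP : ∀ x, x ∈ P ↔ ∃ k ≤ N, ∃ b ∈ B k, posEntry b k = x := fun x => by
    simp [P]
  refine ⟨P, ?_, fun x hx => ?_⟩
  · obtain ⟨b, hb, hbc⟩ := hB' N c₀ (hN ▸ hc)
    refine ⟨posEntry b N, (hP _).2 ⟨N, le_rfl, b, hb, rfl⟩, ?_⟩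
    rw [init_eq h, dim_eq h]
    refine ⟨congrArg Fin.val hbc.1, fun i hi => ?_⟩
    have := hbc.2 ⟨i, hi⟩
    rw [← getD_ofFn b.count _ 0, ← getD_ofFn c₀.count _ 0] at this
    exact this
  obtain ⟨k, hk, b, hb, rfl⟩ := (hP x).1 hx
  have hbk := hB k b hb
  cases k with
  | zero => exact hbk.elim
  | succ k =>
    have key : ∀ c', VStep S.T b c' → c' ∈ S.winLevel qF k → ∃ t ∈ w.trans,
        t.1.1 = (posEntry b (k + 1)).1 ∧ ∃ x' ∈ P, w.PosStep (posEntry b (k + 1)) t x' ∧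
          x'.2.2 < (posEntry b (k + 1)).2.2 := by
      rintro _ ⟨t, ht, hen, rfl⟩ hw
      obtain ⟨b', hb', hle⟩ := hB' k _ hw
      exact ⟨_, (mem_trans h _).2 ⟨t, ht, rfl⟩, congrArg Fin.val hen.1, posEntry b' k,
        (hP _).2 ⟨k, by omega, b', hb', rfl⟩, posStep_posEntry h hen hle _ _, Nat.lt_succ_self k⟩
    rcases hbk with hF | ⟨hq, c', hs, -, hw⟩ | ⟨hq, ⟨c', hs, hw⟩, hall⟩
    · exact .inl ((congrArg Fin.val hF).trans (target_eq h).symm)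
    · exact .inr ⟨key c' hs hw, .inl (by
        rw [posEntry, owner_eq h]; exact decide_eq_true hq)⟩
    · refine .inr ⟨key c' hs hw, .inr fun t' ht' hxt => ?_⟩
      obtain ⟨t, ht, rfl⟩ := (mem_trans h _).1 ht'
      have htq : t.1 = b.state := Fin.ext hxt
      have hen : b.Enabled t :=
        ⟨htq, fun i => by rw [hS.weight_eq_zero ht (htq ▸ hq)]; simp⟩
      have hw' := hall _ ⟨t, ht, hen, rfl⟩
      rw [hN] at hw'
      obtain ⟨b', hb', hle⟩ := hB' N _ hw'
      exact ⟨posEntry b' N, (hP _).2 ⟨N, le_rfl, b', hb', rfl⟩, posStep_posEntry h hen hle _ _⟩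

/-! ### Negative certificates -/

section Negative

variable {N : Type*} {node : N → NegEntry} {loc : N → Fin n × (Fin d → ℕ)} {m : ℕ}
  {Y : ℕ → N → Fin d → ℕ} {R : ℕ → N → ℕ}

/-- The entries `node ν` describe the data `loc`, `Y`, `R`. -/
structure Describes (node : N → NegEntry) (loc : N → Fin n × (Fin d → ℕ)) (m : ℕ)
    (Y : ℕ → N → Fin d → ℕ) (R : ℕ → N → ℕ) : Prop where
  state : ∀ ν, (node ν).1 = (loc ν).1
  bound : ∀ ν (i : Fin d), (node ν).2.1.getD i 0 = (loc ν).2 i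
  coeff : ∀ j < m, ∀ ν (i : Fin d), (node ν).coeff j i = Y j ν i
  offset : ∀ j < m, ∀ ν, (node ν).offset j = R j ν

lemma gain_sub_loss (h : Encodes w S c₀ qF) (hD : Describes node loc m Y R) {j : ℕ} (hj : j < m)
    (ν ν' : N) (t : VTrans (Fin n) d) (acc : Bool) :
    (w.gain (node ν) (ofTrans S t) (node ν') j : ℤ) - w.loss (node ν) (ofTrans S t) j =
      variation (Y j) (R j) (ν, t.2.1, ν', acc) := by
  simp only [gain, loss, variation, dim_eq h, hD.offset j hj, Finset.sum_range, hD.coeff j hj,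
    ofTrans, getD_ofFn]
  have : ∀ i, (Y j ν i : ℤ) * t.2.1 i =
      (Y j ν i : ℤ) * (t.2.1 i).toNat - (Y j ν i : ℤ) * (-(t.2.1 i)).toNat := fun i => by
    rw [← mul_sub]; congr 1; omega
  simp only [this, Finset.sum_sub_distrib]
  push_cast
  ring

lemma coeff_eq_iff (h : Encodes w S c₀ qF) (hD : Describes node loc m Y R) {j : ℕ} (hj : j < m)
    (ν ν' : N) : (∀ i < w.dim, (node ν).coeff j i = (node ν').coeff j i) ↔ Y j ν = Y j ν' := by
  rw [dim_eq h, funext_iff]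
  exact forall_lt_iff (fun i => by
    rw [hD.coeff j hj, hD.coeff j hj])

lemma negStep_iff (h : Encodes w S c₀ qF) (hD : Describes node loc m Y R) {ν ν' : N}
    {t : VTrans (Fin n) d} {acc : Bool} :
    w.NegStep m (node ν) (ofTrans S t) (node ν') acc ↔ CertStep loc m Y R t ν ν' acc := by
  refine and_congr ?_ (and_congr ?_ ?_)
  · rw [hD.state]
    exact Fin.ext_iff.symm
  · rw [dim_eq h]
    refine forall_lt_iff fun i => ?_
    simp only [hD.bound, ofTrans, getD_ofFn]
    omega
  · simp only [LexDecreases, ← Nat.lt_succ_iff (n := m)]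
    refine exists_congr fun j => and_congr_right fun hj => and_congr ?_ (or_congr_left ?_)
    · refine forall_congr' fun k => forall_congr' fun hk => and_congr ?_ ?_
      · exact coeff_eq_iff h hD (by omega) ν ν'
      · have := gain_sub_loss h hD (j := k) (by omega) ν ν' t acc
        omega
    · refine and_congr_right fun hj' => and_congr (coeff_eq_iff h hD hj' ν ν') ?_
      have := gain_sub_loss h hD hj' ν ν' t acc
      omega

lemma mayFire_iff (h : Encodes w S c₀ qF) (hD : Describes node loc m Y R) {ν : N}
    {t : VTrans (Fin n) d} : w.MayFire (node ν) (ofTrans S t) ↔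
      ∀ i, (loc ν).2 i = 0 ∨ 0 < ((loc ν).2 i : ℤ) + t.2.1 i := by
  rw [MayFire, dim_eq h]
  refine forall_lt_iff fun i => ?_
  simp only [hD.bound, ofTrans, getD_ofFn]
  omega

/-- Stated for an arbitrary index type so that it serves both soundness, with the entries of the
list as nodes, and completeness, with nodes in `Fin K`. -/
lemma isNegCert_iff (h : Encodes w S c₀ qF) (hD : Describes node loc m Y R) {G : List NegEntry}
    (hG : ∀ g, g ∈ G ↔ ∃ ν, node ν = g) :
    w.IsNegCert (m, G) ↔ (∃ ν, Covers (loc ν) c₀) ∧ IsLosingCert S qF loc m Y R := by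
  have hT : ∀ (ν : N) (p : Trans → Prop), (∀ t ∈ w.trans, t.1.1 = (node ν).1 → p t) ↔
      ∀ t ∈ S.T, t.1 = (loc ν).1 → p (ofTrans S t) := fun ν p => by
    simp only [mem_trans h, forall_exists_index, and_imp, forall_apply_eq_imp_iff₂, hD.state]
    exact forall₂_congr fun t _ => imp_congr_left Fin.ext_iff.symm
  have hT' : ∀ (ν : N) (p : Trans → Prop), (∃ t ∈ w.trans, t.1.1 = (node ν).1 ∧ p t) ↔
      ∃ t ∈ S.T, t.1 = (loc ν).1 ∧ p (ofTrans S t) := fun ν p => by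
    have := (hT ν fun t => ¬ p t).not
    push Not at this
    exact this
  simp only [IsNegCert, IsLosingCert, hG, exists_exists_eq_and, forall_exists_index,
    forall_apply_eq_imp_iff]
  refine and_congr (exists_congr fun ν => and_congr ?_ ?_) (forall_congr' fun ν => ?_)
  · rw [hD.state, init_eq h, eq_comm]
    exact Fin.ext_iff.symm
  · rw [dim_eq h, init_eq h]
    refine forall_lt_iff fun i => ?_
    rw [hD.bound, getD_ofFn]
  · rw [hT ν, hT' ν, hD.state, owner_eq h, numStates_eq h, target_eq h]
    simp only [mayFire_iff h hD, negStep_iff h hD, decide_eq_false_iff_not, (loc ν).1.2, true_and,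
      ne_eq, Fin.ext_iff]

end Negative

theorem IsNegCert.notMem_winSet (hS : S.IsOneVASSMDP) (h : Encodes w S c₀ qF)
    {C : ℕ × List NegEntry} (hC : w.IsNegCert C) : c₀ ∉ S.winSet qF := by
  have hlt : ∀ g : {g // g ∈ C.2}, g.1.1 < n := fun g => numStates_eq h ▸ (hC.2 g.1 g.2).1
  obtain ⟨⟨ν, hν⟩, hl⟩ := (isNegCert_iff h (node := fun g : {g // g ∈ C.2} => g.1)
    (loc := fun g => (⟨g.1.1, hlt g⟩, fun i => g.1.2.1.getD i 0)) (m := C.1)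
    (Y := fun j g i => g.1.coeff j i) (R := fun j g => g.1.offset j)
    ⟨fun _ => rfl, fun _ _ => rfl, fun _ _ _ _ => rfl, fun _ _ _ => rfl⟩ (by simp)).1 hC
  exact hl.notMem_winSet hS hν

theorem exists_isNegCert (hS : S.IsOneVASSMDP) (h : Encodes w S c₀ qF) (hc : c₀ ∉ S.winSet qF) :
    ∃ C, w.IsNegCert C := by
  obtain ⟨K, loc, m, Y, R, hl, hν⟩ := exists_losingCert hS hc
  let node : Fin K → NegEntry := fun ν => (((loc ν).1 : ℕ), List.ofFn (loc ν).2,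
    (List.range m).map fun j => (List.ofFn (Y j ν), R j ν))
  have hr : ∀ j < m, ∀ ν, (node ν).2.2.getD j ([], 0) = (List.ofFn (Y j ν), R j ν) :=
    fun j hj ν => by simp [node, List.getD, hj]
  refine ⟨(m, List.ofFn node), (isNegCert_iff h (node := node) (loc := loc) (Y := Y) (R := R)
    ⟨fun _ => rfl, fun _ _ => getD_ofFn _ _ _, fun j hj ν i => ?_, fun j hj ν => ?_⟩
    (by simp [List.mem_ofFn])).2 ⟨hν, hl⟩⟩
  · rw [NegEntry.coeff, hr j hj, getD_ofFn]
  · rw [NegEntry.offset, hr j hj]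

end Code

/-! ### Decidability -/

namespace Code

open VASSMDP

lemma wf_of_encodes {n d : ℕ} {w : Code} {S : VASSMDP (Fin n) d} {c₀ : Config (Fin n) d}
    {qF : Fin n} (hS : S.IsOneVASSMDP) (h : Encodes w S c₀ qF) : w.Wf := by
  have ht := mem_trans h
  have ho := owner_eq h
  simp only [Wf, ht, init_eq h, target_eq h, numStates_eq h, dim_eq h, forall_exists_index,
    and_imp, forall_apply_eq_imp_iff₂, List.length_ofFn, Fin.is_lt, and_true]
  refine ⟨?_, fun t ht => ⟨t.1.2, List.length_ofFn, t.2.2.2, ?_⟩, fun t _ t' _ htt => ?_⟩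
  · obtain ⟨L, -, rfl⟩ := h
    exact List.length_ofFn
  · by_cases hq : t.1 ∈ S.Q₁
    · exact .inl ((ho t.1).trans (decide_eq_true hq))
    · refine .inr ⟨S.τ_pos t ht hq, ?_⟩
      simp [ofTrans, hS.weight_eq_zero ht hq, List.mem_ofFn]
  · simp only [ofTrans, Prod.mk.injEq, List.ofFn_inj, Fin.val_inj] at htt
    have : t = t' := Prod.ext htt.1 (Prod.ext htt.2.1 htt.2.2)
    rw [this]

/-- Transitions are decoded entry by entry and weights are looked up in the list; the lookup is
unambiguous since `Wf` forbids two weights for one transition. -/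
lemma Wf.exists_encodes {w : Code} (hw : w.Wf) :
    ∃ (n d : ℕ) (S : VASSMDP (Fin n) d) (c₀ : Config (Fin n) d) (qF : Fin n),
      S.IsOneVASSMDP ∧ Encodes w S c₀ qF := by
  classical
  obtain ⟨n, d, L₁, tr, ⟨q₀, v₀⟩, qF⟩ := w
  obtain ⟨hl, htr, hτ, hq₀, hv₀, hqF⟩ := hw
  simp only [numStates, dim, owner, trans, init, target] at hl htr hτ hq₀ hv₀ hqF
  -- The initial control-state witnesses `n ≠ 0`; reduction modulo `n` in `Fin.ofNat` then changes
  -- nothing on listed transitions.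
  have : NeZero n := ⟨by omega⟩
  let dec : Trans → VTrans (Fin n) d := fun e =>
    (Fin.ofNat n e.1.1, fun i => e.1.2.1.getD i 0, Fin.ofNat n e.1.2.2)
  let enc : VTrans (Fin n) d → ℕ × List ℤ × ℕ := fun t => ((t.1 : ℕ), List.ofFn t.2.1, (t.2.2 : ℕ))
  let τ : VTrans (Fin n) d → ℕ := fun t => if h : ∃ k, (enc t, k) ∈ tr then h.choose else 0
  have hget : ∀ (l : List ℤ), l.length = d → List.ofFn (fun i : Fin d => l.getD i 0) = l := by
    rintro l rfl
    exact List.ext_getElem (by simp) fun i h₁ h₂ => by simp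
  have hget' : ∀ (l : List ℕ), l.length = d → List.ofFn (fun i : Fin d => l.getD i 0) = l := by
    rintro l rfl
    exact List.ext_getElem (by simp) fun i h₁ h₂ => by simp
  have henc : ∀ e ∈ tr, enc (dec e) = e.1 := fun e he => by
    obtain ⟨h₁, h₂, h₃, -⟩ := htr e he
    simp only [enc, dec, hget _ h₂, Fin.val_ofNat, Nat.mod_eq_of_lt h₁, Nat.mod_eq_of_lt h₃]
  have hτe : ∀ e ∈ tr, τ (dec e) = e.2 := fun e he => by
    have hex : ∃ k, (enc (dec e), k) ∈ tr := ⟨e.2, by rw [henc e he]; exact he⟩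
    simp only [τ, dif_pos hex]
    exact hτ _ hex.choose_spec _ he (henc e he)
  have hsrc : ∀ e ∈ tr, (dec e).1 ∉ Finset.univ.filter (fun q : Fin n => L₁.getD q false = true) →
      0 < e.2 ∧ ∀ x ∈ e.1.2.1, x = 0 := fun e he hq => by
    obtain ⟨h₁, -, -, h₂⟩ := htr e he
    refine h₂.resolve_left fun h₃ => hq ?_
    simpa [dec, Nat.mod_eq_of_lt h₁] using h₃
  refine ⟨n, d, ⟨Finset.univ.filter fun q : Fin n => L₁.getD q false = true,
    (tr.map dec).toFinset, τ, ?_⟩, ⟨⟨q₀, hq₀⟩, fun i => v₀.getD i 0⟩, ⟨qF, hqF⟩, ?_,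
    tr.map dec, rfl, ?_⟩
  · simp only [List.mem_toFinset, List.mem_map, forall_exists_index, and_imp,
      forall_apply_eq_imp_iff₂]
    intro e he hq
    rw [hτe e he]
    exact (hsrc e he hq).1
  · simp only [IsOneVASSMDP, IsSingleSided, QP, List.mem_toFinset, List.mem_map,
      forall_exists_index, and_imp, forall_apply_eq_imp_iff₂, Finset.mem_sdiff]
    rintro e he - hq
    have h₀ := (hsrc e he hq).2
    funext i
    exact h₀ (e.1.2.1.getD i 0) (by
      have hi : (i : ℕ) < e.1.2.1.length := (htr e he).2.1 ▸ i.2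
      simp only [List.getD_eq_getElem _ _ hi, List.getElem_mem])
  · have h₁ : List.ofFn (fun q : Fin n => L₁.getD q false) = L₁ := by
      subst hl
      exact List.ext_getElem (by simp) fun i h₁ h₂ => by simp
    simp only [Prod.mk.injEq, true_and, List.map_map, hget' v₀ hv₀, and_true, Finset.mem_filter,
      Finset.mem_univ, Bool.decide_eq_true]
    refine ⟨h₁.symm, ?_⟩
    refine (List.map_id _).symm.trans (List.map_congr_left fun e he => ?_)
    exact Prod.ext (henc e he).symm (hτe e he).symm

theorem almostSureReachability_iff (w : Code) :
    AlmostSureReachability w ↔ ∃ P, w.Wf ∧ w.IsPosCert P := by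
  constructor
  · rintro ⟨n, d, S, c₀, qF, hS, h, hc⟩
    rw [hS.almostSureSet_eq_winSet] at hc
    obtain ⟨P, hP⟩ := exists_isPosCert hS h hc
    exact ⟨P, wf_of_encodes hS h, hP⟩
  · rintro ⟨P, hw, hP⟩
    obtain ⟨n, d, S, c₀, qF, hS, h⟩ := hw.exists_encodes
    refine ⟨n, d, S, c₀, qF, hS, h, ?_⟩
    rw [hS.almostSureSet_eq_winSet]
    exact hP.mem_winSet h

/-- A code may have several decodings, since weights off `T` are not recorded, but a certificate
refers to the code only and so refutes all of them. -/
theorem not_almostSureReachability_iff (w : Code) :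
    ¬ AlmostSureReachability w ↔ ∃ C, ¬ w.Wf ∨ w.IsNegCert C := by
  constructor
  · intro hA
    by_cases hw : w.Wf
    · obtain ⟨n, d, S, c₀, qF, hS, h⟩ := hw.exists_encodes
      obtain ⟨C, hC⟩ := exists_isNegCert hS h fun hc =>
        hA ⟨n, d, S, c₀, qF, hS, h, by rwa [hS.almostSureSet_eq_winSet]⟩
      exact ⟨C, .inr hC⟩
    · exact ⟨(0, []), .inl hw⟩
  · rintro ⟨C, hC⟩ ⟨n, d, S, c₀, qF, hS, h, hc⟩
    rw [hS.almostSureSet_eq_winSet] at hc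
    rcases hC with hC | hC
    · exact hC (wf_of_encodes hS h)
    · exact hC.notMem_winSet hS h hc

/-- Post's theorem: the set and its complement are both projections of primitive recursive
predicates. -/
theorem computablePred_almostSureReachability : ComputablePred AlmostSureReachability := by
  refine ComputablePred.computable_iff_re_compl_re'.2 ⟨?_, ?_⟩
  · refine (PrimrecPred.rePred_exists (p := fun w P => w.Wf ∧ w.IsPosCert P) ?_).of_eq fun w =>
      (almostSureReachability_iff w).symm
    exact .and (primrecPred_wf.comp Primrec.fst) primrecPred_isPosCert
  · refine (PrimrecPred.rePred_exists (p := fun w C => ¬ w.Wf ∨ w.IsNegCert C) ?_).of_eq fun w =>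
      (not_almostSureReachability_iff w).symm
    exact .or (.not (primrecPred_wf.comp Primrec.fst)) primrecPred_isNegCert

end Code

theorem mainTheorem2 :
    -- The almost-sure reachability problem for 1-VASS-MDPs is decidable.
    ComputablePred AlmostSureReachability ∧
    -- Characterization of the set of almost surely winning configurations.
    ∀ (Q : Type*) [Fintype Q] [DecidableEq Q] (d : ℕ) (S : VASSMDP Q d) (qF : Q),
      S.IsOneVASSMDP →
      MuForm.InLsv S.QP (MuForm.almostSureForm S.Q₁ S.QP qF) ∧
      S.almostSureSet qF = MuForm.denot S.T (MuForm.almostSureForm S.Q₁ S.QP qF) ∧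
      IsUpperSet (S.almostSureSet qF) ∧
      -- One strategy and one bound for all winning configurations.
      ∃ (N : ℕ) (σ : S.Strategy), ∀ c ∈ S.almostSureSet qF,
        S.playMeasure c σ (VASSMDP.Reach d qF) = 1 ∧
        ∃ ω ∈ S.Outcome c σ, ∃ i ≤ N,
          (ω i).state = qF ∧
          (∀ j ≤ i, ω j ∈ S.almostSureSet qF) ∧
          (∀ j < i, (ω j).state ∈ S.QP → ∀ c', VStep S.T (ω j) c' → c' ∈ S.almostSureSet qF) := by
  refine ⟨Code.computablePred_almostSureReachability, fun Q _ _ d S qF hS => ?_⟩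
  rw [hS.almostSureSet_eq_winSet]
  refine ⟨MuForm.inLsv_almostSureForm _ _ _, (S.denot_almostSureForm qF).symm,
    hS.isUpperSet_winSet, ?_⟩
  obtain ⟨N, hN⟩ := hS.exists_winLevel_eq (qF := qF)
  refine ⟨N, S.rankStrategy qF, fun c hc => ⟨S.playMeasure_rankStrategy qF hN hc, ?_⟩⟩
  obtain ⟨ω, hω, i, hi, h₁, h₂, h₃⟩ := S.exists_outcome_rankStrategy qF hN hc
  exact ⟨ω, hω, i, hi, h₁, h₂, fun j hj hq => h₃ j hj (Finset.mem_sdiff.1 hq).2⟩
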